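/- **Proposition 1.1.** Let $M$ be a compact (Hausdorff, smooth) $n$-manifold with an affine structure, that is, a smooth connection $\nabla$ on $TM$ whose curvature and torsion vanish identically. Let $f:M\to M$ be a diffeomorphism which is affine (it preserves $\nabla$) and Anosov: $TM=TM^s\oplus TM^u$ is a $df$-invariant splitting into continuous subbundles, and there are a Riemannian metric on $M$ with norm $\|\cdot\|$ and constants $c,c'>0$, $0<\lambda<1$ such that for all integers $m\ge 1$ $$\|df^m(v)\|\le c\,\lambda^m\|v\|\quad (v\in TM^s),\qquad \|df^m(w)\|\ge c'\lambda^{-m}\|w\|\quad (w\in TM^u).$$ Then there are topological foliations $\mathcal F^s$ and $\mathcal F^u$ of $M$ (given by foliated atlases of continuous charts with values in $\mathbb R^p\times\mathbb R^q$, $p+q=n$; if $M$ is not connected, $p$ may depend on the component) whose leaves, with their leaf topology, are injectively immersed smooth submanifolds of $M$ (Hausdorff and second countable), tangent at each point to $TM^s$, respectively $TM^u$. These leaves are affine submanifolds of $(M,\nabla)$: around each point of a leaf $L$ there are an affine chart of $M$ (a smooth chart in which the coordinate vector fields are $\nabla$-parallel) and smooth coordinates of $L$ in which the inclusion $L\to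 M$ is the restriction of an injective affine map $\mathbb R^k\to\mathbb R^n$, where $k=\dim L$. Moreover the leaves are totally geodesic: if a smooth vector field $\sigma$ on $M$ is tangent to $L$ along a neighbourhood in $L$ of $p\in L$, then $\nabla_v\sigma\in T_pL$ for every $v\in T_pL$. -/

import Mathlib

open Set Filter Topology Manifold ContDiff

noncomputable section

namespace AffineAnosov

/-- `ℝⁿ` with its Euclidean structure. -/
abbrev Euc (n : ℕ) : Type := EuclideanSpace ℝ (Fin n)

section Affine

/-- Connections (Koszul) on the tangent bundle of a smooth `n`-manifold `M`.
In Mathlib's convention `D σ x v` is `(∇_v σ)(x)`. -/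
abbrev Connection (n : ℕ) (M : Type*) [TopologicalSpace M] [ChartedSpace (Euc n) M]
    [IsManifold (𝓡 n) ∞ M] : Type _ :=
  CovariantDerivative (𝓡 n) (Euc n) (TangentSpace (𝓡 n) : M → Type _)

variable {n : ℕ} {M : Type*} [TopologicalSpace M] [ChartedSpace (Euc n) M]
  [IsManifold (𝓡 n) ∞ M]

/-- `σ` is a smooth vector field on `M`. -/
def IsSmoothField (σ : Π x : M, TangentSpace (𝓡 n) x) : Prop :=
  ContMDiff (𝓡 n) (𝓡 n).tangent ∞ (fun x ↦ (⟨x, σ x⟩ : TangentBundle (𝓡 n) M))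

/-- The curvature `R(X,Y)Z = ∇_X ∇_Y Z - ∇_Y ∇_X Z - ∇_[X,Y] Z` vanishes identically. -/
def HasZeroCurvature (D : Connection n M) : Prop :=
  ∀ X Y Z : (Π x : M, TangentSpace (𝓡 n) x),
    IsSmoothField X → IsSmoothField Y → IsSmoothField Z → ∀ x : M,
      D (fun y ↦ D Z y (Y y)) x (X x) - D (fun y ↦ D Z y (X y)) x (Y x)
        - D Z x (VectorField.mlieBracket (𝓡 n) X Y x) = 0

/-- An affine structure on `M`: a smooth connection on `TM` whose curvature and torsion vanish
identically. -/
structure IsAffineStructure (D : Connection n M) : Prop where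
  smooth : CovariantDerivative.ContMDiffCovariantDerivative D ∞
  curvature : HasZeroCurvature D
  torsion : D.torsion = 0

/-- The diffeomorphism `f` is affine: it preserves the connection, that is
`df (∇_v (f^*σ)) = ∇_{df v} σ` for every smooth vector field `σ`. -/
def IsAffineDiffeo (D : Connection n M) (f : M ≃ₘ^∞⟮𝓡 n, 𝓡 n⟯ M) : Prop :=
  ∀ σ : (Π x : M, TangentSpace (𝓡 n) x), IsSmoothField σ →
    ∀ (x : M) (v : TangentSpace (𝓡 n) x),
      mfderiv (𝓡 n) (𝓡 n) f x (D (VectorField.mpullback (𝓡 n) (𝓡 n) f σ) x v)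
        = D σ (f x) (mfderiv (𝓡 n) (𝓡 n) f x v)

/-- `φ` is an affine chart of `(M, ∇)`: a smooth chart whose coordinate vector fields
`x ↦ (dφ_x)⁻¹ w` are parallel on the domain of `φ`. -/
def IsAffineChart (D : Connection n M) (φ : OpenPartialHomeomorph M (Euc n)) : Prop :=
  φ ∈ IsManifold.maximalAtlas (𝓡 n) ∞ M ∧
    ∀ x ∈ φ.source, ∀ w : Euc n,
      D (VectorField.mpullback (𝓡 n) 𝓘(ℝ, Euc n) φ (fun _ ↦ w)) x = 0

end Affine

section Anosov

variable {n : ℕ} {M : Type*} [TopologicalSpace M] [ChartedSpace (Euc n) M]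
  [IsManifold (𝓡 n) ∞ M]

/-- A distribution on `M`: a choice of a linear subspace in each tangent space. -/
abbrev Distribution (n : ℕ) (M : Type*) [TopologicalSpace M] [ChartedSpace (Euc n) M] : Type _ :=
  Π x : M, Submodule ℝ (TangentSpace (𝓡 n) x)

/-- The distribution is a continuous subbundle of `TM`: it is spanned, near each point, by a
continuous frame. -/
def IsContinuousSubbundle (E : Distribution n M) : Prop :=
  ∀ x₀ : M, ∃ U ∈ 𝓝 x₀, ∃ (k : ℕ) (σ : Fin k → Π x : M, TangentSpace (𝓡 n) x),
    (∀ i, ContinuousOn (fun x ↦ (⟨x, σ i x⟩ : TangentBundle (𝓡 n) M)) U) ∧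
    ∀ x ∈ U, LinearIndependent ℝ (fun i ↦ σ i x) ∧
      Submodule.span ℝ (Set.range fun i ↦ σ i x) = E x

/-- The norm of a tangent vector for a Riemannian metric. -/
def gnorm (g : Bundle.ContMDiffRiemannianMetric (𝓡 n) ∞ (Euc n)
      (TangentSpace (𝓡 n) : M → Type _)) {x : M} (v : TangentSpace (𝓡 n) x) : ℝ :=
  Real.sqrt (g.inner x v v)

/-- `f` is an Anosov diffeomorphism with stable distribution `Es` and unstable distribution `Eu`:
`TM = Es ⊕ Eu` is a `df`-invariant splitting into continuous subbundles and, for some Riemannian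
metric, `df` contracts `Es` and expands `Eu` exponentially. -/
structure IsAnosov (f : M ≃ₘ^∞⟮𝓡 n, 𝓡 n⟯ M) (Es Eu : Distribution n M) : Prop where
  bundle_s : IsContinuousSubbundle Es
  bundle_u : IsContinuousSubbundle Eu
  splitting : ∀ x, IsCompl (Es x) (Eu x)
  invariant_s : ∀ x, (Es x).map (mfderiv (𝓡 n) (𝓡 n) f x).toLinearMap = Es (f x)
  invariant_u : ∀ x, (Eu x).map (mfderiv (𝓡 n) (𝓡 n) f x).toLinearMap = Eu (f x)
  hyperbolic : ∃ (g : Bundle.ContMDiffRiemannianMetric (𝓡 n) ∞ (Euc n)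
      (TangentSpace (𝓡 n) : M → Type _)) (c c' lam : ℝ),
    0 < c ∧ 0 < c' ∧ 0 < lam ∧ lam < 1 ∧
    (∀ (m : ℕ), 1 ≤ m → ∀ (x : M), ∀ v ∈ Es x,
      gnorm g (mfderiv (𝓡 n) (𝓡 n) (⇑f)^[m] x v) ≤ c * lam ^ m * gnorm g v) ∧
    (∀ (m : ℕ), 1 ≤ m → ∀ (x : M), ∀ w ∈ Eu x,
      c' * (lam ^ m)⁻¹ * gnorm g w ≤ gnorm g (mfderiv (𝓡 n) (𝓡 n) (⇑f)^[m] x w))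

end Anosov

section Foliation

/-- A foliated chart: a chart with values in `ℝᵖ × ℝ^q`, `p + q = n`. Its plaques are the
level sets of the second (transverse) component. -/
structure FoliatedChart (n : ℕ) (M : Type*) [TopologicalSpace M] where
  p : ℕ
  q : ℕ
  dim_eq : p + q = n
  chart : OpenPartialHomeomorph M (Euc p × Euc q)

/-- A topological foliation of the `n`-manifold `M`, given by a foliated atlas: the coordinate
changes locally preserve the plaques, i.e. locally have the form
`(x, y) ↦ (h₁(x, y), h₂(y))` with `h₂` injective. -/
structure TopFoliation (n : ℕ) (M : Type*) [TopologicalSpace M] where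
  atlas : Set (FoliatedChart n M)
  cover : ∀ x : M, ∃ c ∈ atlas, x ∈ c.chart.source
  compatible : ∀ c ∈ atlas, ∀ c' ∈ atlas, ∀ x ∈ c.chart.source ∩ c'.chart.source,
    ∃ U ∈ 𝓝 x, ∀ y ∈ U, ∀ z ∈ U,
      ((c.chart y).2 = (c.chart z).2 ↔ (c'.chart y).2 = (c'.chart z).2)

namespace TopFoliation

variable {n : ℕ} {M : Type*} [TopologicalSpace M]

/-- A copy of `M`, to carry the leaf topology. -/
def Fine (_F : TopFoliation n M) : Type _ := M

/-- The leaf topology: it is generated by the open subsets of the plaques. -/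
instance (F : TopFoliation n M) : TopologicalSpace F.Fine :=
  TopologicalSpace.generateFrom
    {P : Set M | ∃ c ∈ F.atlas, ∃ (U : Set M) (t : Euc c.q), IsOpen U ∧ U ⊆ c.chart.source ∧
      P = {y ∈ U | (c.chart y).2 = t}}

/-- The leaf through `x`: the connected component of `x` for the leaf topology, with this
topology. -/
abbrev Leaf (F : TopFoliation n M) (x : M) : Type _ :=
  {y : F.Fine // y ∈ connectedComponent (α := F.Fine) x}

/-- The inclusion of a leaf in `M`. -/
def Leaf.incl (F : TopFoliation n M) (x : M) : F.Leaf x → M := fun y ↦ y.1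

end TopFoliation

end Foliation

section Submanifold

variable {n : ℕ} {M : Type*} [TopologicalSpace M] [ChartedSpace (Euc n) M]
  [IsManifold (𝓡 n) ∞ M]

/-- The map `j : L → M` makes the topological space `L` an (injectively) immersed affine
submanifold of `(M, ∇)` which is tangent to the distribution `E`: `L` carries the structure of a
smooth manifold for which `j` is an injective immersion, and
* the tangent space of `L` at `p` is `E (j p)`;
* around each point, `j` reads as an injective affine map `ℝᵏ → ℝⁿ` in suitable smooth coordinates
  of `L` and an affine chart of `M`, so that `L` is an open piece of an affine subspace there
  (and these coordinates of `L` form an affine atlas);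
* `L` is totally geodesic: if the vector field `σ` is tangent to `L` along `L`, near `p`, then
  `∇_v σ` is tangent to `L` for each `v` tangent to `L` at `p`. -/
def IsImmersedAffineSubmanifold (D : Connection n M) (E : Distribution n M)
    {L : Type*} [TopologicalSpace L] (j : L → M) : Prop :=
  T2Space L ∧ SecondCountableTopology L ∧ Function.Injective j ∧
  ∃ (k : ℕ) (_ : ChartedSpace (Euc k) L), IsManifold (𝓡 k) ∞ L ∧
    IsImmersion (𝓡 k) (𝓡 n) ∞ j ∧
    (∀ p : L, LinearMap.range (mfderiv (𝓡 k) (𝓡 n) j p).toLinearMap = E (j p)) ∧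
    (∀ p : L, ∃ φ : OpenPartialHomeomorph M (Euc n), IsAffineChart D φ ∧
      ∃ ψ ∈ IsManifold.maximalAtlas (𝓡 k) ∞ L, p ∈ ψ.source ∧
      ∃ a : Euc k →ᵃ[ℝ] Euc n, Function.Injective a ∧
        ∀ q ∈ ψ.source, j q ∈ φ.source ∧ φ (j q) = a (ψ q)) ∧
    (∀ σ : (Π x : M, TangentSpace (𝓡 n) x), IsSmoothField σ → ∀ p : L,
      (∀ᶠ q in 𝓝 p, σ (j q) ∈ E (j q)) → ∀ v ∈ E (j p), D σ (j p) v ∈ E (j p))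

/-- The distribution `E` is tangent to the foliation `F`, and the leaves of `F` are immersed
affine submanifolds. -/
def TopFoliation.IsAffineTangentTo (F : TopFoliation n M) (D : Connection n M)
    (E : Distribution n M) : Prop :=
  ∀ x : M, IsImmersedAffineSubmanifold D E (TopFoliation.Leaf.incl F x)

end Submanifold

end AffineAnosov

end

/-! The connection is flat and torsion free, so affine charts exist around every point
(`exists_isAffineChart`). In such charts `∇` is the ordinary derivative, and `f` is locally an
affine map because it preserves parallel fields (`IsAffineDiffeo.affine_in_charts`).

The heart is `isAffinelyIntegrable_of_contracted`: in affine charts the stable distribution `E` is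
constant along its own affine subspaces. Let `v ∈ E x` be small and let `y` be `x + v` in a chart.
By compactness, finitely many affine charts and one radius suffice for `f` to be affine between
them. As `v` is contracted, the orbit of `y` follows that of `x` with displacement `df^m v`, so it
stays within this radius forever, and `f^m` has the same linear part at `x` and at `y`. A vector of
`E x`, moved to `y` with the same components, is therefore contracted as well. By the splitting and
the expansion on `Eu`, only vectors of `E y` have iterates tending to zero (`mem_of_tendsto_gnorm`).
Hence `E x ⊆ E y` in the chart, with equality because the rank is locally constant.

The slices of `E` are thus pieces of affine subspaces, locally graphs. Sliding each point along its
slice to a transversal gives foliated charts, which are only continuous (`exists_slice_chart`).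
Changes of affine charts are affine, so slices of different charts agree, and a leaf inherits smooth
charts in which its inclusion is affine. Tangency and total geodesy then reduce to linear algebra
with a constant subspace (`isImmersedAffineSubmanifold_of_adapted`). Second countability of leaves
comes from a chain-of-plaques argument (`secondCountableTopology_of_plaques`). The unstable
foliation is the stable one of the inverse (`IsAnosov.symm`). -/

noncomputable section

namespace AffineAnosov

/-! ### Integrable linear total differential equations -/

section FlatSystem

variable {E V : Type*} [NormedAddCommGroup E] [NormedSpace ℝ E] [NormedAddCommGroup V]
  [NormedSpace ℝ V]

/-- Existence for small linear differential equations on `[0, 1]`. -/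
theorem exists_solution_linear_ode [CompleteSpace V] {A : ℝ → V →L[ℝ] V}
    (hA : ContinuousOn A (Icc 0 1)) (hbd : ∀ t ∈ Icc (0 : ℝ) 1, ‖A t‖ ≤ 1 / 2) (v₀ : V) :
    ∃ s : ℝ → V, s 0 = v₀ ∧ ∀ t ∈ Icc (0 : ℝ) 1, HasDerivWithinAt s (A t (s t)) (Icc 0 1) t := by
  -- On the ball of radius `‖v₀‖ + 1` about `v₀` the field has norm at most `(2‖v₀‖ + 1) / 2`, so a
  -- solution cannot leave the ball before time 1.
  let a : NNReal := ‖v₀‖₊ + 1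
  have h : IsPicardLindelof (fun t v ↦ A t v) (⟨0, by simp⟩ : Icc (0 : ℝ) 1) v₀ a 0 a 1 := by
    refine ⟨fun t ht ↦ ?_, fun x _ ↦ hA.clm_apply continuousOn_const, fun t ht x hx ↦ ?_, ?_⟩
    · refine ((A t).lipschitz.weaken ?_).lipschitzOnWith
      rw [← NNReal.coe_le_coe]
      exact (hbd t ht).trans (by norm_num)
    · have h1 : ‖x‖ ≤ ‖v₀‖ + (‖v₀‖ + 1) := by
        have := mem_closedBall_iff_norm.1 hx
        have h2 := norm_sub_norm_le x v₀
        simp only [a, NNReal.coe_add, coe_nnnorm, NNReal.coe_one] at this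
        linarith
      refine ((A t).le_opNorm x).trans ?_
      simp only [a, NNReal.coe_add, coe_nnnorm, NNReal.coe_one]
      nlinarith [hbd t ht, norm_nonneg x, norm_nonneg (A t), norm_nonneg v₀]
    · simp
  simpa using h.exists_eq_forall_mem_Icc_hasDerivWithinAt₀

/-- The equation is integrated along each ray from `x₀`, and `F` is the value at time 1. Flatness
identifies the first variation of these solutions with the prescribed derivative; the error is
quadratic by Grönwall's inequality. -/
theorem exists_isFlatSolution_ball [CompleteSpace V] {B : E → E →L[ℝ] V →L[ℝ] V} {x₀ : E}
    {r K L : ℝ} (hr : 0 < r) (hL0 : 0 ≤ L) (hKr : K * r ≤ 1 / 2)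
    (hdiff : ∀ x ∈ Metric.ball x₀ r, DifferentiableAt ℝ B x)
    (hK : ∀ x ∈ Metric.ball x₀ r, ‖B x‖ ≤ K)
    (hL : ∀ x ∈ Metric.ball x₀ r, ∀ y ∈ Metric.ball x₀ r, ‖B y - B x‖ ≤ L * ‖y - x‖)
    (hT : ∀ x ∈ Metric.ball x₀ r, ∀ y ∈ Metric.ball x₀ r,
      ‖B y - B x - fderiv ℝ B x (y - x)‖ ≤ L * ‖y - x‖ ^ 2)
    (hflat : ∀ x ∈ Metric.ball x₀ r, ∀ u w v,
      fderiv ℝ B x u w v + B x w (B x u v) = fderiv ℝ B x w u v + B x u (B x w v)) (v₀ : V) :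
    ∃ F : E → V, F x₀ = v₀ ∧ ∀ x ∈ Metric.ball x₀ r, HasFDerivAt F ((B x).flip (F x)) x := by
  have hK0 : 0 ≤ K := (norm_nonneg (B x₀)).trans (hK x₀ (Metric.mem_ball_self hr))
  have hmem : ∀ x ∈ Metric.ball (0 : E) r, ∀ t ∈ Icc (0 : ℝ) 1, x₀ + t • x ∈ Metric.ball x₀ r := by
    intro x hx t ht
    rw [mem_ball_iff_norm] at hx ⊢
    rw [add_sub_cancel_left, norm_smul, Real.norm_eq_abs, abs_of_nonneg ht.1]
    rw [sub_zero] at hx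
    exact lt_of_le_of_lt (mul_le_of_le_one_left (norm_nonneg _) ht.2) hx
  have hline : ∀ (x : E) (t : ℝ), HasDerivAt (fun t : ℝ ↦ x₀ + t • x) x t := fun x t ↦ by
    simpa using ((hasDerivAt_id t).smul_const x).const_add x₀
  have hex : ∀ x ∈ Metric.ball (0 : E) r, ∃ s : ℝ → V, s 0 = v₀ ∧
      ∀ t ∈ Icc (0 : ℝ) 1, HasDerivWithinAt s (B (x₀ + t • x) x (s t)) (Icc 0 1) t := by
    intro x hx
    apply exists_solution_linear_ode (A := fun t ↦ B (x₀ + t • x) x)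
    · intro t ht
      have h1 : ContinuousAt (fun t : ℝ ↦ B (x₀ + t • x)) t :=
        ContinuousAt.comp (f := fun t : ℝ ↦ x₀ + t • x) (hdiff _ (hmem x hx t ht)).continuousAt
          (hline x t).continuousAt
      exact (h1.clm_apply continuousAt_const).continuousWithinAt
    · intro t ht
      rw [mem_ball_zero_iff] at hx
      calc ‖B (x₀ + t • x) x‖ ≤ ‖B (x₀ + t • x)‖ * ‖x‖ := ContinuousLinearMap.le_opNorm _ _
        _ ≤ K * r := by gcongr; exact hK _ (hmem x (by simpa using hx) t ht)
        _ ≤ 1 / 2 := hKr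
  choose! S hS0 hS using hex
  refine ⟨fun x ↦ S (x - x₀) 1, ?_, ?_⟩
  · have h0 : (0 : E) ∈ Metric.ball (0 : E) r := Metric.mem_ball_self hr
    have h1 : ∀ t ∈ Icc (0 : ℝ) 1, HasDerivWithinAt (S 0) 0 (Icc 0 1) t := by
      intro t ht
      simpa using hS 0 h0 t ht
    have := constant_of_derivWithin_zero (f := S 0) (a := 0) (b := 1)
      (fun t ht ↦ (h1 t ht).differentiableWithinAt)
      (fun t ht ↦ (h1 t ⟨ht.1, ht.2.le⟩).derivWithin (uniqueDiffOn_Icc (by norm_num) t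
        ⟨ht.1, ht.2.le⟩)) 1 (by simp)
    simp [this, hS0 0 h0]
  intro x' hx'
  obtain ⟨x, rfl⟩ : ∃ x, x' = x₀ + x := ⟨x' - x₀, by abel⟩
  have hx : x ∈ Metric.ball (0 : E) r := by simpa [mem_ball_iff_norm] using hx'
  -- a bound for the solution over `x`
  have hScont : ContinuousOn (S x) (Icc 0 1) := fun t ht ↦ (hS x hx t ht).continuousWithinAt
  obtain ⟨C, hC⟩ := isCompact_Icc.exists_bound_of_continuousOn hScont
  have hC0 : 0 ≤ C := (norm_nonneg _).trans (hC 0 (by simp))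
  -- the quadratic estimate
  have key : ∀ h : E, x + h ∈ Metric.ball (0 : E) r →
      ‖S (x + h) 1 - S x 1 - B (x₀ + x) h (S x 1)‖ ≤
        gronwallBound 0 (1 / 2) (((L * r + K) * K * C + (L * r + L) * C) * ‖h‖ ^ 2) 1 := by
    intro h hh
    -- The candidate for the first variation in the direction `h`. By `hflat` for the directions `x`
    -- and `t • h`, its derivative is `J'`, that is, `J` solves the linearised equation with initial
    -- value 0.
    let J : ℝ → V := fun t ↦ B (x₀ + t • x) (t • h) (S x t)
    let J' : ℝ → V := fun t ↦ B (x₀ + t • x) h (S x t) + fderiv ℝ B (x₀ + t • x) (t • h) x (S x t)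
      + B (x₀ + t • x) x (J t)
    have hJ : ∀ t ∈ Icc (0 : ℝ) 1, HasDerivWithinAt J (J' t) (Icc 0 1) t := by
      intro t ht
      have h1 : HasDerivAt (fun t : ℝ ↦ B (x₀ + t • x)) (fderiv ℝ B (x₀ + t • x) x) t :=
        HasFDerivAt.comp_hasDerivAt (l := B) t (hdiff _ (hmem x hx t ht)).hasFDerivAt (hline x t)
      have h2 : HasDerivAt (fun t : ℝ ↦ t • h) h t := by
        simpa using (hasDerivAt_id t).smul_const h
      have h3 := ((h1.clm_apply h2).hasDerivWithinAt (s := Icc 0 1)).clm_apply (hS x hx t ht)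
      convert! h3 using 1
      have h4 := hflat _ (hmem x hx t ht) x (t • h) (S x t)
      simp only [J', J, add_apply]
      rw [add_assoc, ← h4]
      abel
    let R : ℝ → V := fun t ↦ S (x + h) t - S x t - J t
    let R' : ℝ → V := fun t ↦ B (x₀ + t • (x + h)) (x + h) (S (x + h) t)
      - B (x₀ + t • x) x (S x t) - J' t
    have hR : ∀ t ∈ Icc (0 : ℝ) 1, HasDerivWithinAt R (R' t) (Icc 0 1) t := fun t ht ↦
      ((hS _ hh t ht).sub (hS x hx t ht)).sub (hJ t ht)
    have hR0 : ‖R 0‖ ≤ 0 := by simp [R, J, hS0 _ hh, hS0 _ hx]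
    have hbound : ∀ t ∈ Ico (0 : ℝ) 1, ‖R' t‖ ≤ 1 / 2 * ‖R t‖ +
        (((L * r + K) * K * C + (L * r + L) * C) * ‖h‖ ^ 2) := by
      intro t ht
      have ht' : t ∈ Icc (0 : ℝ) 1 := ⟨ht.1, ht.2.le⟩
      set y := x₀ + t • x with hy
      set y' := x₀ + t • (x + h) with hy'
      have hym : y ∈ Metric.ball x₀ r := hmem x hx t ht'
      have hym' : y' ∈ Metric.ball x₀ r := hmem _ hh t ht'
      have hyy : y' - y = t • h := by rw [hy, hy', smul_add]; abel
      have hth : ‖t • h‖ ≤ ‖h‖ := by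
        rw [norm_smul, Real.norm_eq_abs, abs_of_nonneg ht.1]
        exact mul_le_of_le_one_left (norm_nonneg _) ht'.2
      -- The remainder `R` appears linearly with coefficient at most `K * r ≤ 1 / 2`. In the second
      -- term both the coefficient difference and `J` are `O(‖h‖)`; the third consists of the Taylor
      -- remainder of `B` and a product of two increments.
      have eR : R' t = B y' (x + h) (R t) + (B y' (x + h) - B y x) (J t)
          + ((B y' - B y - fderiv ℝ B y (y' - y)) x + (B y' - B y) h) (S x t) := by
        have e1 : S (x + h) t = R t + J t + S x t := by simp only [R]; abel
        simp only [R', J', e1, hyy, map_add, add_apply,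
          sub_apply, ← hy, ← hy']
        abel
      have b1 : ‖B y' (x + h) (R t)‖ ≤ 1 / 2 * ‖R t‖ := by
        refine (ContinuousLinearMap.le_opNorm _ _).trans ?_
        gcongr
        refine (ContinuousLinearMap.le_opNorm _ _).trans (le_trans ?_ hKr)
        gcongr
        · exact hK _ hym'
        · exact (mem_ball_zero_iff.1 hh).le
      have hSt := hC t ht'
      have hJt : ‖J t‖ ≤ K * ‖h‖ * C := by
        refine (ContinuousLinearMap.le_opNorm _ _).trans ?_
        gcongr
        refine (ContinuousLinearMap.le_opNorm _ _).trans ?_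
        gcongr
        exact hK _ hym
      have hLip : ‖B y' - B y‖ ≤ L * ‖t • h‖ := by rw [← hyy]; exact hL _ hym _ hym'
      have hLh : L * ‖t • h‖ ≤ L * ‖h‖ := by gcongr
      have hxr : ‖x‖ ≤ r := (mem_ball_zero_iff.1 hx).le
      have hhr : ‖x + h‖ ≤ r := (mem_ball_zero_iff.1 hh).le
      have b2 : ‖(B y' (x + h) - B y x) (J t)‖ ≤ (L * r + K) * K * C * ‖h‖ ^ 2 := by
        have e2 : B y' (x + h) - B y x = (B y' - B y) (x + h) + B y h := by
          simp only [map_add, sub_apply]; abel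
        have e3 : ‖B y' (x + h) - B y x‖ ≤ (L * r + K) * ‖h‖ := by
          rw [e2]
          refine (norm_add_le _ _).trans ?_
          have e4 : ‖(B y' - B y) (x + h)‖ ≤ L * ‖h‖ * r :=
            (ContinuousLinearMap.le_opNorm (B y' - B y) (x + h)).trans
              (mul_le_mul (hLip.trans hLh) hhr (norm_nonneg _) (by positivity))
          have e5 : ‖B y h‖ ≤ K * ‖h‖ :=
            (ContinuousLinearMap.le_opNorm (B y) h).trans
              (mul_le_mul_of_nonneg_right (hK _ hym) (norm_nonneg _))
          linarith
        calc ‖(B y' (x + h) - B y x) (J t)‖ ≤ ‖B y' (x + h) - B y x‖ * ‖J t‖ :=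
              ContinuousLinearMap.le_opNorm _ _
          _ ≤ ((L * r + K) * ‖h‖) * (K * ‖h‖ * C) :=
              mul_le_mul e3 hJt (norm_nonneg _) (by positivity)
          _ = _ := by ring
      have b3 : ‖((B y' - B y - fderiv ℝ B y (y' - y)) x + (B y' - B y) h) (S x t)‖ ≤
          (L * r + L) * C * ‖h‖ ^ 2 := by
        have e3 : ‖(B y' - B y - fderiv ℝ B y (y' - y)) x + (B y' - B y) h‖ ≤
            (L * r + L) * ‖h‖ ^ 2 := by
          refine (norm_add_le _ _).trans ?_
          have e4 : ‖(B y' - B y - fderiv ℝ B y (y' - y)) x‖ ≤ (L * ‖h‖ ^ 2) * r := by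
            refine (ContinuousLinearMap.le_opNorm _ x).trans
              (mul_le_mul ((hT _ hym _ hym').trans ?_) hxr (norm_nonneg _) (by positivity))
            rw [hyy]
            gcongr
          have e5 : ‖(B y' - B y) h‖ ≤ (L * ‖h‖) * ‖h‖ :=
            (ContinuousLinearMap.le_opNorm _ h).trans
              (mul_le_mul_of_nonneg_right (hLip.trans hLh) (norm_nonneg _))
          nlinarith
        calc _ ≤ _ := ContinuousLinearMap.le_opNorm _ _
          _ ≤ ((L * r + L) * ‖h‖ ^ 2) * C := mul_le_mul e3 hSt (norm_nonneg _) (by positivity)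
          _ = _ := by ring
      rw [eR]
      refine (norm_add₃_le).trans ?_
      linarith
    have hIci : ∀ t ∈ Ico (0 : ℝ) 1, HasDerivWithinAt R (R' t) (Ici t) t := fun t ht ↦
      (hR t ⟨ht.1, ht.2.le⟩).mono_of_mem_nhdsWithin (Icc_mem_nhdsGE_of_mem ht)
    have := norm_le_gronwallBound_of_norm_deriv_right_le
      (fun t ht ↦ (hR t ht).continuousWithinAt) hIci hR0 hbound 1 (by simp)
    simpa [R, J] using this
  set Q := (L * r + K) * K * C + (L * r + L) * C
  rw [hasFDerivAt_iff_isLittleO_nhds_zero]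
  have hO : (fun h : E ↦ S (x₀ + x + h - x₀) 1 - S (x₀ + x - x₀) 1
      - (B (x₀ + x)).flip (S (x₀ + x - x₀) 1) h) =O[𝓝 0] fun h ↦ ‖h‖ ^ 2 := by
    -- Grönwall's bound at time 1, with rate `1 / 2` and zero initial error, is `Q * ‖h‖ ^ 2 * (exp
    -- (1 / 2) - 1) / (1 / 2)`.
    refine Asymptotics.IsBigO.of_bound (Q * (2 * (Real.exp (1 / 2) - 1))) ?_
    have hnhds : ∀ᶠ h in 𝓝 (0 : E), x + h ∈ Metric.ball (0 : E) r := by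
      have : ContinuousAt (fun h : E ↦ x + h) 0 := by fun_prop
      exact this.eventually_mem (by simpa using Metric.isOpen_ball.mem_nhds hx)
    filter_upwards [hnhds] with h hh
    have := key h hh
    rw [gronwallBound_of_K_ne_0 (by norm_num)] at this
    rw [show x₀ + x + h - x₀ = x + h by abel, add_sub_cancel_left, norm_pow, norm_norm,
      ContinuousLinearMap.flip_apply]
    refine this.trans (le_of_eq ?_)
    simp
    ring
  exact hO.trans_isLittleO (by simpa using Asymptotics.isLittleO_norm_pow_id (E' := E) one_lt_two)

/-- `B` and its derivative are Lipschitz near `x₀`, and the mean value inequality for `z ↦ B z -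
fderiv ℝ B x z` gives the quadratic bound. The constants serve every smaller radius, so that `r` can
still be chosen with `K * r ≤ 1 / 2`. -/
theorem exists_ball_taylor_bounds {W : Type*} [NormedAddCommGroup W] [NormedSpace ℝ W] {B : E → W}
    {x₀ : E} (hB : ContDiffAt ℝ 2 B x₀) :
    ∃ K L r₁ : ℝ, 0 < K ∧ 0 ≤ L ∧ 0 < r₁ ∧ ∀ r ≤ r₁,
      (∀ x ∈ Metric.ball x₀ r, DifferentiableAt ℝ B x) ∧
      (∀ x ∈ Metric.ball x₀ r, ‖B x‖ ≤ K) ∧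
      (∀ x ∈ Metric.ball x₀ r, ∀ y ∈ Metric.ball x₀ r, ‖B y - B x‖ ≤ L * ‖y - x‖) ∧
      (∀ x ∈ Metric.ball x₀ r, ∀ y ∈ Metric.ball x₀ r,
        ‖B y - B x - fderiv ℝ B x (y - x)‖ ≤ L * ‖y - x‖ ^ 2) := by
  obtain ⟨L₁, s₁, hs₁, hl₁⟩ := (hB.of_le (by norm_num : (1 : ℕ∞ω) ≤ 2)).exists_lipschitzOnWith
  obtain ⟨L₂, s₂, hs₂, hl₂⟩ :=
    (hB.fderiv_right (m := 1) (by norm_num)).exists_lipschitzOnWith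
  have hd : ∀ᶠ x in 𝓝 x₀, DifferentiableAt ℝ B x :=
    (hB.eventually (by simp)).mono fun x hx ↦ hx.differentiableAt (by norm_num)
  have hb : ∀ᶠ x in 𝓝 x₀, ‖B x‖ < ‖B x₀‖ + 1 :=
    hB.continuousAt.norm.eventually_lt_const (lt_add_one _)
  obtain ⟨r₁, hr₁, h₁⟩ := Metric.eventually_nhds_iff_ball.1
    ((hd.and hb).and (Filter.inter_mem hs₁ hs₂))
  refine ⟨‖B x₀‖ + 1, max L₁ L₂, r₁, by positivity, by positivity, hr₁, fun r hr ↦ ?_⟩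
  have hsub : Metric.ball x₀ r ⊆ Metric.ball x₀ r₁ := Metric.ball_subset_ball hr
  refine ⟨fun x hx ↦ (h₁ x (hsub hx)).1.1, fun x hx ↦ (h₁ x (hsub hx)).1.2.le,
    fun x hx y hy ↦ ?_, fun x hx y hy ↦ ?_⟩
  · have := hl₁.norm_sub_le (h₁ y (hsub hy)).2.1 (h₁ x (hsub hx)).2.1
    exact this.trans (by gcongr; exact le_max_left _ _)
  · have hseg : segment ℝ x y ⊆ Metric.ball x₀ r := (convex_ball x₀ r).segment_subset hx hy
    have := (convex_segment x y).norm_image_sub_le_of_norm_hasFDerivWithin_le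
      (f := fun z ↦ B z - fderiv ℝ B x z) (f' := fun z ↦ fderiv ℝ B z - fderiv ℝ B x)
      (C := max L₁ L₂ * ‖y - x‖) (x := x) (y := y)
      (fun z hz ↦ (((h₁ z (hsub (hseg hz))).1.1.hasFDerivAt).sub
        (fderiv ℝ B x).hasFDerivAt).hasFDerivWithinAt)
      (fun z hz ↦ by
        have h3 := hl₂.norm_sub_le (h₁ z (hsub (hseg hz))).2.2 (h₁ x (hsub hx)).2.2
        refine h3.trans ?_
        gcongr
        · exact le_max_right _ _
        · exact norm_sub_le_of_mem_segment hz)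
      (left_mem_segment ℝ x y) (right_mem_segment ℝ x y)
    have e : B y - B x - fderiv ℝ B x (y - x) =
        (B y - fderiv ℝ B x y) - (B x - fderiv ℝ B x x) := by
      rw [map_sub]; abel
    rw [e]
    exact this.trans (le_of_eq (by push_cast; ring))

/-- An integrable linear total differential equation has local solutions. -/
theorem exists_flatSolution [CompleteSpace V] {B : E → E →L[ℝ] V →L[ℝ] V} {x₀ : E}
    (hB : ContDiffAt ℝ 2 B x₀)
    (hflat : ∀ᶠ x in 𝓝 x₀, ∀ u w v,
      fderiv ℝ B x u w v + B x w (B x u v) = fderiv ℝ B x w u v + B x u (B x w v)) (v₀ : V) :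
    ∃ F : E → V, F x₀ = v₀ ∧ ∀ᶠ x in 𝓝 x₀, HasFDerivAt F ((B x).flip (F x)) x := by
  obtain ⟨K, L, r₁, hK, hL, hr₁, h₁⟩ := exists_ball_taylor_bounds hB
  obtain ⟨r₂, hr₂, h₂⟩ := Metric.eventually_nhds_iff_ball.1 hflat
  let r := min (min r₁ r₂) (1 / (2 * K))
  have hr : 0 < r := lt_min (lt_min hr₁ hr₂) (by positivity)
  obtain ⟨hd, hb, hl, ht⟩ := h₁ r ((min_le_left _ _).trans (min_le_left _ _))
  have hKr : K * r ≤ 1 / 2 := by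
    calc K * r ≤ K * (1 / (2 * K)) := by gcongr; exact min_le_right _ _
      _ = 1 / 2 := by field_simp
  obtain ⟨F, hF0, hF⟩ := exists_isFlatSolution_ball hr hL hKr hd hb hl ht
    (fun x hx ↦ h₂ x (Metric.ball_subset_ball ((min_le_left _ _).trans (min_le_right _ _)) hx)) v₀
  exact ⟨F, hF0, Metric.eventually_nhds_iff_ball.2 ⟨r, hr, hF⟩⟩

/-- A solution of a smooth total differential equation is smooth. -/
theorem contDiffOn_of_flatSolution {B : E → E →L[ℝ] V →L[ℝ] V} {F : E → V} {U : Set E}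
    (hU : IsOpen U) (hB : ContDiffOn ℝ ∞ B U)
    (hF : ∀ x ∈ U, HasFDerivAt F ((B x).flip (F x)) x) : ContDiffOn ℝ ∞ F U := by
  rw [contDiffOn_infty]
  intro k
  induction k with
  | zero =>
    rw [Nat.cast_zero, contDiffOn_zero]
    exact fun x hx ↦ (hF x hx).continuousAt.continuousWithinAt
  | succ k ih =>
    rw [Nat.cast_succ, contDiffOn_succ_iff_fderiv_of_isOpen hU]
    refine ⟨fun x hx ↦ (hF x hx).differentiableAt.differentiableWithinAt, by simp, ?_⟩
    -- Bootstrapping: the equation expresses the derivative of `F` through `F`, so each order of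
    -- regularity yields the next.
    have h1 : ContDiffOn ℝ k (fun x ↦ (B x).flip (F x)) U := by
      have h3 : ContDiff ℝ k (ContinuousLinearMap.flipₗᵢ ℝ E V V) :=
        LinearIsometryEquiv.contDiff _
      have h2 : ContDiffOn ℝ k (fun x ↦ (B x).flip) U :=
        ContDiff.comp_contDiffOn h3 (hB.of_le (WithTop.coe_le_coe.2 le_top))
      exact h2.clm_apply ih
    exact h1.congr fun x hx ↦ (hF x hx).fderiv

end FlatSystem

/-! ### Affine coordinates of a flat symmetric connection on a Banach space -/

section FlatCoordinates

set_option maxSynthPendingDepth 3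

variable {E : Type*} [NormedAddCommGroup E] [NormedSpace ℝ E]

/-- The total differential equation `dφ = α`, `dα = α ∘ Γ` for the differential of an affine
coordinate system of the connection with Christoffel symbols `Γ`. -/
def coordSystem (Γ : E →L[ℝ] E →L[ℝ] E) :
    E →L[ℝ] (E × (E →L[ℝ] E)) →L[ℝ] (E × (E →L[ℝ] E)) :=
  (ContinuousLinearMap.compL ℝ (E × (E →L[ℝ] E)) E (E × (E →L[ℝ] E))
      (ContinuousLinearMap.inl ℝ E (E →L[ℝ] E))) ∘L
    ((ContinuousLinearMap.compL ℝ (E × (E →L[ℝ] E)) (E →L[ℝ] E) E).flip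
      (ContinuousLinearMap.snd ℝ E (E →L[ℝ] E))) ∘L (ContinuousLinearMap.apply ℝ E) +
  ((ContinuousLinearMap.compL ℝ (E × (E →L[ℝ] E)) (E →L[ℝ] E) (E × (E →L[ℝ] E))
      (ContinuousLinearMap.inr ℝ E (E →L[ℝ] E))) ∘L
    ((ContinuousLinearMap.compL ℝ (E × (E →L[ℝ] E)) (E →L[ℝ] E) (E →L[ℝ] E)).flip
      (ContinuousLinearMap.snd ℝ E (E →L[ℝ] E))) ∘L
    (ContinuousLinearMap.compL ℝ E E E).flip) ∘L Γ

@[simp]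
theorem coordSystem_apply (Γ : E →L[ℝ] E →L[ℝ] E) (u : E) (p : E × (E →L[ℝ] E)) :
    coordSystem Γ u p = (p.2 u, p.2 ∘L Γ u) := by
  simp [coordSystem]

theorem contDiff_coordSystem {k : ℕ∞ω} : ContDiff ℝ k (coordSystem (E := E)) := by
  unfold coordSystem
  fun_prop

theorem fderiv_coordSystem_comp {Γ : E → E →L[ℝ] E →L[ℝ] E} {x : E} (hΓ : DifferentiableAt ℝ Γ x)
    (u w : E) (p : E × (E →L[ℝ] E)) :
    fderiv ℝ (fun y ↦ coordSystem (Γ y)) x u w p = (0, p.2 ∘L (fderiv ℝ Γ x u w)) := by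
  have h1 : HasFDerivAt (fun y ↦ coordSystem (Γ y) w p)
      (((ContinuousLinearMap.apply ℝ _ p) ∘L (ContinuousLinearMap.apply ℝ _ w)) ∘L
        fderiv ℝ (fun y ↦ coordSystem (Γ y)) x) x := by
    have hd : DifferentiableAt ℝ (fun y ↦ coordSystem (Γ y)) x :=
      ((contDiff_coordSystem (E := E) (k := 1)).differentiable one_ne_zero).differentiableAt.comp x hΓ
    exact ((ContinuousLinearMap.apply ℝ _ p) ∘L (ContinuousLinearMap.apply ℝ _ w)).hasFDerivAt.comp x
      hd.hasFDerivAt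
  have h2 : HasFDerivAt (fun y ↦ (p.2 w, p.2 ∘L Γ y w))
      ((0 : E →L[ℝ] E).prod ((ContinuousLinearMap.compL ℝ E E E p.2) ∘L
        (ContinuousLinearMap.apply ℝ _ w) ∘L fderiv ℝ Γ x)) x :=
    (hasFDerivAt_const _ _).prodMk
      (((ContinuousLinearMap.compL ℝ E E E p.2) ∘L
        (ContinuousLinearMap.apply ℝ _ w)).hasFDerivAt.comp x hΓ.hasFDerivAt)
  simp only [coordSystem_apply] at h1
  simpa using DFunLike.congr_fun (h1.unique h2) u

/-- A smooth symmetric flat connection on an open set of a Banach space has local affine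
coordinates. -/
theorem exists_flat_coordinates [CompleteSpace E] {Γ : E → E →L[ℝ] E →L[ℝ] E} {U : Set E}
    (hU : IsOpen U) (hΓ : ContDiffOn ℝ ∞ Γ U) (hsymm : ∀ x ∈ U, ∀ u w, Γ x u w = Γ x w u)
    (hflat : ∀ x ∈ U, ∀ u w v, fderiv ℝ Γ x u w v + Γ x u (Γ x w v) =
      fderiv ℝ Γ x w u v + Γ x w (Γ x u v)) {x₀ : E} (hx₀ : x₀ ∈ U) :
    ∃ (ψ : OpenPartialHomeomorph E E) (α : E → E →L[ℝ] E), x₀ ∈ ψ.source ∧ ψ.source ⊆ U ∧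
      ContDiffOn ℝ ∞ ψ ψ.source ∧ ContDiffOn ℝ ∞ ψ.symm ψ.target ∧
      ∀ x ∈ ψ.source, (α x).IsInvertible ∧ HasFDerivAt ψ (α x) x ∧
        HasFDerivAt α ((ContinuousLinearMap.compL ℝ E E E (α x)) ∘L Γ x) x := by
  have hB : ContDiffOn ℝ ∞ (fun y ↦ coordSystem (Γ y)) U :=
    contDiff_coordSystem.comp_contDiffOn hΓ
  obtain ⟨F, hF0, hF⟩ := exists_flatSolution (x₀ := x₀)
    ((hB.contDiffAt (hU.mem_nhds hx₀)).of_le (WithTop.coe_le_coe.2 le_top))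
    (by
      filter_upwards [hU.mem_nhds hx₀] with x hx u w p
      have hd : DifferentiableAt ℝ Γ x :=
        (hΓ.contDiffAt (hU.mem_nhds hx)).differentiableAt (by simp)
      rw [fderiv_coordSystem_comp hd, fderiv_coordSystem_comp hd]
      simp only [coordSystem_apply, ContinuousLinearMap.comp_apply, Prod.mk_add_mk, zero_add,
        Prod.mk.injEq]
      -- The integrability condition splits: its first component is the symmetry of `Γ` (zero
      -- torsion), its second one is `hflat` (zero curvature).
      refine ⟨by rw [hsymm x hx], ?_⟩
      ext v
      have := congrArg p.2 (hflat x hx u w v)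
      simp only [map_add] at this
      simpa using this) ((0 : E), ContinuousLinearMap.id ℝ E)
  obtain ⟨W, hWsub, hWo, hWx⟩ := eventually_nhds_iff.1 (hF.and (hU.mem_nhds hx₀))
  have hFs : ContDiffOn ℝ ∞ F W :=
    contDiffOn_of_flatSolution hWo (hB.mono fun x hx ↦ (hWsub x hx).2) fun x hx ↦ (hWsub x hx).1
  have hφ : ∀ x ∈ W, HasFDerivAt (fun y ↦ (F y).1) (F x).2 x := fun x hx ↦ by
    have := (ContinuousLinearMap.fst ℝ E (E →L[ℝ] E)).hasFDerivAt.comp x (hWsub x hx).1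
    convert! this using 1
    ext; simp
  have hα : ∀ x ∈ W, HasFDerivAt (fun y ↦ (F y).2)
      ((ContinuousLinearMap.compL ℝ E E E (F x).2) ∘L Γ x) x := fun x hx ↦ by
    have := (ContinuousLinearMap.snd ℝ E (E →L[ℝ] E)).hasFDerivAt.comp x (hWsub x hx).1
    convert! this using 1
    ext; simp
  have hφs : ContDiffOn ℝ ∞ (fun y ↦ (F y).1) W := contDiff_fst.comp_contDiffOn hFs
  have hφ0 : HasFDerivAt (fun y ↦ (F y).1) ((ContinuousLinearEquiv.refl ℝ E : E →L[ℝ] E)) x₀ := by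
    have := hφ x₀ hWx
    rw [hF0] at this
    exact this
  -- The initial value `(0, id)` makes the derivative at `x₀` the identity, so the inverse function
  -- theorem applies.
  let ψ₀ := (hφs.contDiffAt (hWo.mem_nhds hWx)).toOpenPartialHomeomorph _ hφ0 (by simp)
  have hψ₀ : ∀ x, ψ₀ x = (F x).1 := fun x ↦ rfl
  have hinv : ∀ᶠ x in 𝓝 x₀, (F x).2.IsInvertible := by
    have hc : ContinuousAt (fun y ↦ (F y).2) x₀ := (hα x₀ hWx).continuousAt
    refine hc.eventually (p := fun T : E →L[ℝ] E ↦ T.IsInvertible) ?_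
    simp only [hF0]
    exact (ContinuousLinearEquiv.refl ℝ E).nhds
  obtain ⟨W', hW'sub, hW'o, hW'x⟩ := eventually_nhds_iff.1 hinv
  let ψ := ψ₀.restrOpen (W ∩ W') (hWo.inter hW'o)
  have hψs : ψ.source = ψ₀.source ∩ (W ∩ W') := ψ₀.restrOpen_source _ _
  have hψ : ∀ x, ψ x = (F x).1 := fun x ↦ rfl
  have hd : ∀ x ∈ ψ.source, HasFDerivAt ψ (F x).2 x := fun x hx ↦ hφ x (hψs ▸ hx).2.1
  refine ⟨ψ, fun x ↦ (F x).2, ?_, ?_, ?_, ?_, ?_⟩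
  · rw [hψs]
    exact ⟨ContDiffAt.mem_toOpenPartialHomeomorph_source _ hφ0 _, hWx, hW'x⟩
  · rw [hψs]
    exact fun x hx ↦ (hWsub x hx.2.1).2
  · exact hφs.mono fun x hx ↦ (hψs ▸ hx).2.1
  · intro y hy
    have hx := ψ.map_target hy
    obtain ⟨e, he⟩ := hW'sub _ (hψs ▸ hx).2.2
    refine (ψ.contDiffAt_symm (f₀' := e) hy ?_ ?_).contDiffWithinAt
    · rw [he]
      exact hd _ hx
    · exact (hφs.contDiffAt (hWo.mem_nhds (hψs ▸ hx).2.1))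
  · intro x hx
    exact ⟨hW'sub _ (hψs ▸ hx).2.2, hd x hx, hα x (hψs ▸ hx).2.1⟩

end FlatCoordinates

/-! ### Vector fields in charts -/

section ChartFields

variable {n : ℕ} {M : Type*} [TopologicalSpace M] [ChartedSpace (Euc n) M]

/-- The derivative of a chart, with values in the model space. -/
def chartDeriv (φ : OpenPartialHomeomorph M (Euc n)) (x : M) :
    TangentSpace (𝓡 n) x →L[ℝ] Euc n :=
  mfderiv (𝓡 n) 𝓘(ℝ, Euc n) φ x

/-- The vector field with given components in a chart. -/
def fieldOf (φ : OpenPartialHomeomorph M (Euc n)) (s : Euc n → Euc n) (x : M) :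
    TangentSpace (𝓡 n) x :=
  (chartDeriv φ x).inverse (s (φ x))

/-- The components of a vector field in a chart. -/
def fieldIn (φ : OpenPartialHomeomorph M (Euc n)) (σ : Π x : M, TangentSpace (𝓡 n) x)
    (z : Euc n) : Euc n :=
  chartDeriv φ (φ.symm z) (σ (φ.symm z))

theorem fieldOf_eq_mpullback (φ : OpenPartialHomeomorph M (Euc n)) (s : Euc n → Euc n) :
    fieldOf φ s = VectorField.mpullback (𝓡 n) 𝓘(ℝ, Euc n) φ s := rfl

variable {φ : OpenPartialHomeomorph M (Euc n)}

theorem fieldIn_apply_chart {x : M} (hx : x ∈ φ.source) (σ : Π x : M, TangentSpace (𝓡 n) x) :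
    fieldIn φ σ (φ x) = chartDeriv φ x (σ x) := by
  -- The points `φ.symm (φ x)` and `x` are only propositionally equal and their tangent spaces
  -- depend on them, so the equality is generalised before substitution.
  have h : ∀ y, y = x → chartDeriv φ y (σ y) = chartDeriv φ x (σ x) := by rintro y rfl; rfl
  exact h _ (φ.left_inv hx)

theorem contMDiffAt_chart (hφ : φ ∈ IsManifold.maximalAtlas (𝓡 n) ∞ M) {x : M}
    (hx : x ∈ φ.source) : ContMDiffAt (𝓡 n) 𝓘(ℝ, Euc n) ∞ φ x :=
  contMDiffAt_of_mem_maximalAtlas hφ hx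

theorem contMDiffAt_chart_symm (hφ : φ ∈ IsManifold.maximalAtlas (𝓡 n) ∞ M) {z : Euc n}
    (hz : z ∈ φ.target) : ContMDiffAt 𝓘(ℝ, Euc n) (𝓡 n) ∞ φ.symm z :=
  contMDiffAt_symm_of_mem_maximalAtlas hφ hz

theorem mdifferentiable_chart_of_mem (hφ : φ ∈ IsManifold.maximalAtlas (𝓡 n) ∞ M) :
    φ.MDifferentiable (𝓡 n) 𝓘(ℝ, Euc n) :=
  ⟨fun _ hx ↦ ((contMDiffAt_chart hφ hx).mdifferentiableAt (by simp)).mdifferentiableWithinAt,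
    fun _ hx ↦ ((contMDiffAt_chart_symm hφ hx).mdifferentiableAt
      (by simp)).mdifferentiableWithinAt⟩

theorem isInvertible_chartDeriv (hφ : φ ∈ IsManifold.maximalAtlas (𝓡 n) ∞ M) {x : M}
    (hx : x ∈ φ.source) : (chartDeriv φ x).IsInvertible :=
  ⟨(mdifferentiable_chart_of_mem hφ).mfderiv hx, rfl⟩

theorem chartDeriv_bijective (hφ : φ ∈ IsManifold.maximalAtlas (𝓡 n) ∞ M) {x : M}
    (hx : x ∈ φ.source) : Function.Bijective (chartDeriv φ x) :=
  (isInvertible_chartDeriv hφ hx).bijective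

theorem chartDeriv_inverse_apply (hφ : φ ∈ IsManifold.maximalAtlas (𝓡 n) ∞ M) {x : M}
    (hx : x ∈ φ.source) (u : Euc n) : chartDeriv φ x ((chartDeriv φ x).inverse u) = u :=
  (isInvertible_chartDeriv hφ hx).self_apply_inverse u

theorem inverse_chartDeriv_apply (hφ : φ ∈ IsManifold.maximalAtlas (𝓡 n) ∞ M) {x : M}
    (hx : x ∈ φ.source) (v : TangentSpace (𝓡 n) x) :
    (chartDeriv φ x).inverse (chartDeriv φ x v) = v :=
  (isInvertible_chartDeriv hφ hx).inverse_apply_self v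

theorem isInvertible_mfderiv_chart_symm (hφ : φ ∈ IsManifold.maximalAtlas (𝓡 n) ∞ M) {z : Euc n}
    (hz : z ∈ φ.target) : (mfderiv 𝓘(ℝ, Euc n) (𝓡 n) φ.symm z).IsInvertible :=
  ⟨(mdifferentiable_chart_of_mem hφ).symm.mfderiv hz, rfl⟩

theorem chartDeriv_fieldOf (hφ : φ ∈ IsManifold.maximalAtlas (𝓡 n) ∞ M) {x : M}
    (hx : x ∈ φ.source) (s : Euc n → Euc n) : chartDeriv φ x (fieldOf φ s x) = s (φ x) :=
  chartDeriv_inverse_apply hφ hx _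

theorem fieldIn_fieldOf (hφ : φ ∈ IsManifold.maximalAtlas (𝓡 n) ∞ M) {z : Euc n}
    (hz : z ∈ φ.target) (s : Euc n → Euc n) : fieldIn φ (fieldOf φ s) z = s z := by
  rw [fieldIn, chartDeriv_fieldOf hφ (φ.map_target hz), φ.right_inv hz]

/-- Reduces the regularity of components in a chart to that of pullbacks of vector fields. -/
theorem fieldIn_eq_mpullback (hφ : φ ∈ IsManifold.maximalAtlas (𝓡 n) ∞ M) {z : Euc n}
    (hz : z ∈ φ.target) (σ : Π x : M, TangentSpace (𝓡 n) x) :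
    fieldIn φ σ z = VectorField.mpullback 𝓘(ℝ, Euc n) (𝓡 n) φ.symm σ z := by
  have h1 := (mdifferentiable_chart_of_mem hφ).comp_symm_deriv hz
  rw [VectorField.mpullback_apply]
  obtain ⟨w, hw⟩ := (isInvertible_mfderiv_chart_symm hφ hz).bijective.2 (σ (φ.symm z))
  rw [← hw, (isInvertible_mfderiv_chart_symm hφ hz).inverse_apply_self, fieldIn, ← hw]
  exact DFunLike.congr_fun h1 w

variable [IsManifold (𝓡 n) ∞ M]

theorem contMDiffAt_fieldOf (hφ : φ ∈ IsManifold.maximalAtlas (𝓡 n) ∞ M) {x : M}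
    (hx : x ∈ φ.source) {s : Euc n → Euc n} (hs : ContDiffAt ℝ ∞ s (φ x)) :
    ContMDiffAt (𝓡 n) (𝓡 n).tangent ∞ (fun y ↦ (⟨y, fieldOf φ s y⟩ : TangentBundle (𝓡 n) M)) x :=
  ContMDiffAt.mpullback_vectorField_preimage
    (V := s) (contMDiffAt_vectorSpace_iff_contDiffAt.2 hs) (contMDiffAt_chart hφ hx)
    (isInvertible_chartDeriv hφ hx) (by simp)

theorem mdifferentiableAt_fieldOf (hφ : φ ∈ IsManifold.maximalAtlas (𝓡 n) ∞ M) {x : M}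
    (hx : x ∈ φ.source) (w : Euc n) :
    MDifferentiableAt (𝓡 n) (𝓡 n).tangent
      (fun y ↦ (⟨y, fieldOf φ (fun _ ↦ w) y⟩ : TangentBundle (𝓡 n) M)) x :=
  (contMDiffAt_fieldOf hφ hx contDiffAt_const).mdifferentiableAt (by simp)

theorem contDiffAt_fieldIn (hφ : φ ∈ IsManifold.maximalAtlas (𝓡 n) ∞ M) {x : M}
    (hx : x ∈ φ.source) {σ : Π x : M, TangentSpace (𝓡 n) x}
    (hσ : ContMDiffAt (𝓡 n) (𝓡 n).tangent ∞ (fun y ↦ (⟨y, σ y⟩ : TangentBundle (𝓡 n) M)) x) :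
    ContDiffAt ℝ ∞ (fieldIn φ σ) (φ x) := by
  have hz := φ.map_source hx
  have h1 : ContMDiffAt 𝓘(ℝ, Euc n) (𝓘(ℝ, Euc n)).tangent ∞
      (fun z ↦ (⟨z, VectorField.mpullback 𝓘(ℝ, Euc n) (𝓡 n) φ.symm σ z⟩ :
        TangentBundle 𝓘(ℝ, Euc n) (Euc n))) (φ x) :=
    ContMDiffAt.mpullback_vectorField_preimage (by rwa [φ.left_inv hx])
      (contMDiffAt_chart_symm hφ hz) (isInvertible_mfderiv_chart_symm hφ hz) (by simp)
  refine (contMDiffAt_vectorSpace_iff_contDiffAt.1 h1).congr_of_eventuallyEq ?_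
  filter_upwards [φ.open_target.mem_nhds hz] with z hz using fieldIn_eq_mpullback hφ hz σ

theorem differentiableAt_fieldIn (hφ : φ ∈ IsManifold.maximalAtlas (𝓡 n) ∞ M) {x : M}
    (hx : x ∈ φ.source) {σ : Π x : M, TangentSpace (𝓡 n) x}
    (hσ : MDifferentiableAt (𝓡 n) (𝓡 n).tangent
      (fun y ↦ (⟨y, σ y⟩ : TangentBundle (𝓡 n) M)) x) :
    DifferentiableAt ℝ (fieldIn φ σ) (φ x) := by
  have hz := φ.map_source hx
  have h1 : MDifferentiableAt 𝓘(ℝ, Euc n) (𝓘(ℝ, Euc n)).tangent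
      (fun z ↦ (⟨z, VectorField.mpullback 𝓘(ℝ, Euc n) (𝓡 n) φ.symm σ z⟩ :
        TangentBundle 𝓘(ℝ, Euc n) (Euc n))) (φ x) :=
    MDifferentiableAt.mpullback_vectorField (n := ∞) (by rwa [φ.left_inv hx])
      (contMDiffAt_chart_symm hφ hz) (isInvertible_mfderiv_chart_symm hφ hz)
      (WithTop.coe_le_coe.2 le_top)
  have h2 : MDifferentiableAt 𝓘(ℝ, Euc n) 𝓘(ℝ, Euc n)
      (fun z ↦ VectorField.mpullback 𝓘(ℝ, Euc n) (𝓡 n) φ.symm σ z) (φ x) :=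
    ((contMDiff_snd_tangentBundle_modelSpace (n := 1) (Euc n)
      𝓘(ℝ, Euc n)).contMDiffAt.mdifferentiableAt one_ne_zero).comp _ h1
  refine h2.differentiableAt.congr_of_eventuallyEq ?_
  filter_upwards [φ.open_target.mem_nhds hz] with z hz using fieldIn_eq_mpullback hφ hz σ

/-- A vector field with constant components can be modified away from a point to a global smooth
vector field. -/
theorem exists_isSmoothField_eventuallyEq [T2Space M]
    (hφ : φ ∈ IsManifold.maximalAtlas (𝓡 n) ∞ M) {x : M} (hx : x ∈ φ.source) (w : Euc n) :
    ∃ σ : Π x : M, TangentSpace (𝓡 n) x, IsSmoothField σ ∧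
      ∀ᶠ y in 𝓝 x, σ y = fieldOf φ (fun _ ↦ w) y := by
  -- A cutoff supported in the chart makes the field global; `HasZeroCurvature` and `IsAffineDiffeo`
  -- only speak of globally smooth fields.
  obtain ⟨f, -, hf⟩ := (SmoothBumpFunction.nhds_basis_tsupport (I := 𝓡 n) x).mem_iff.1
    (φ.open_source.mem_nhds hx)
  refine ⟨fun y ↦ f y • fieldOf φ (fun _ ↦ w) y, fun y ↦ ?_, ?_⟩
  · by_cases hy : y ∈ tsupport f
    · exact ContMDiffAt.smul_section f.contMDiffAt (contMDiffAt_fieldOf hφ (hf hy) contDiffAt_const)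
    · have h0 : ContMDiffAt (𝓡 n) (𝓡 n).tangent ∞
        (fun y ↦ (⟨y, 0⟩ : TangentBundle (𝓡 n) M)) y := Bundle.contMDiff_zeroSection ℝ _ y
      refine h0.congr_of_eventuallyEq ?_
      filter_upwards [(isClosed_tsupport f).isOpen_compl.mem_nhds hy] with z hz
      rw [image_eq_zero_of_notMem_tsupport hz, zero_smul]
  · filter_upwards [f.eventuallyEq_one] with y hy
    simp [hy]

/-- The bracket is natural under pullback by the chart, and constant fields on `ℝⁿ` commute. -/
theorem mlieBracket_fieldOf (hφ : φ ∈ IsManifold.maximalAtlas (𝓡 n) ∞ M) {x : M}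
    (hx : x ∈ φ.source) (u w : Euc n) :
    VectorField.mlieBracket (𝓡 n) (fieldOf φ fun _ ↦ u) (fieldOf φ fun _ ↦ w) x = 0 := by
  have hc : ∀ c : Euc n, MDifferentiableAt 𝓘(ℝ, Euc n) (𝓘(ℝ, Euc n)).tangent
      (fun z ↦ (⟨z, c⟩ : TangentBundle 𝓘(ℝ, Euc n) (Euc n))) (φ x) := fun c ↦
    ContMDiffAt.mdifferentiableAt (n := ∞)
      (contMDiffAt_vectorSpace_iff_contDiffAt.2 contDiffAt_const) (by simp)
  have : IsManifold (𝓡 n) (minSmoothness ℝ 2) M := by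
    rw [minSmoothness_of_isRCLikeNormedField]; infer_instance
  have := VectorField.mpullback_mlieBracket (I := 𝓡 n) (hc u) (hc w) (contMDiffAt_chart hφ hx)
    (by rw [minSmoothness_of_isRCLikeNormedField]; exact WithTop.coe_le_coe.2 le_top)
  rw [fieldOf_eq_mpullback, fieldOf_eq_mpullback, ← this]
  have h0 : ∀ V W : Π z : Euc n, TangentSpace 𝓘(ℝ, Euc n) z,
      VectorField.mlieBracket 𝓘(ℝ, Euc n) V W = VectorField.lieBracket ℝ V W := fun V W ↦ by
    rw [← VectorField.mlieBracketWithin_univ, VectorField.mlieBracketWithin_eq_lieBracketWithin]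
    exact VectorField.lieBracketWithin_univ
  have h1 : VectorField.lieBracket ℝ (fun _ : Euc n ↦ u) (fun _ ↦ w) (φ x) = 0 := by
    simp [VectorField.lieBracket_eq]
  exact (congrArg _ ((congrFun (h0 _ _) _).trans h1)).trans (map_zero _)

end ChartFields

/-! ### Christoffel symbols -/

section Christoffel

variable {n : ℕ} {M : Type*} [TopologicalSpace M] [ChartedSpace (Euc n) M]
  [IsManifold (𝓡 n) ∞ M] {φ : OpenPartialHomeomorph M (Euc n)}

/-- The covariant derivative of the `i`-th coordinate vector field of a chart, in this chart. -/
def coordFieldDeriv (D : Connection n M) (φ : OpenPartialHomeomorph M (Euc n)) (z : Euc n)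
    (w : Euc n) : Euc n →L[ℝ] Euc n :=
  (chartDeriv φ (φ.symm z)) ∘L (D (fieldOf φ fun _ ↦ w) (φ.symm z)) ∘L
    (chartDeriv φ (φ.symm z)).inverse

/-- The Christoffel symbols of a connection in a chart: `christoffel D φ z u w` is the derivative
in the direction `u` of the vector field with constant components `w`. -/
def christoffel (D : Connection n M) (φ : OpenPartialHomeomorph M (Euc n)) (z : Euc n) :
    Euc n →L[ℝ] Euc n →L[ℝ] Euc n :=
  ∑ i : Fin n, (ContinuousLinearMap.smulRightL ℝ (Euc n) (Euc n) (EuclideanSpace.proj i)) ∘L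
    coordFieldDeriv D φ z (EuclideanSpace.single i 1)

theorem christoffel_apply (D : Connection n M) (φ : OpenPartialHomeomorph M (Euc n))
    (z u w : Euc n) : christoffel D φ z u w =
      ∑ i, w i • coordFieldDeriv D φ z (EuclideanSpace.single i 1) u := by
  simp [christoffel]

theorem connection_congr (D : Connection n M) {σ τ : Π x : M, TangentSpace (𝓡 n) x} {x : M}
    (hσ : MDifferentiableAt (𝓡 n) (𝓡 n).tangent
      (fun y ↦ (⟨y, σ y⟩ : TangentBundle (𝓡 n) M)) x)
    (h : ∀ᶠ y in 𝓝 x, σ y = τ y) : D σ x = D τ x := by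
  have hτ : MDifferentiableAt (𝓡 n) (𝓡 n).tangent
      (fun y ↦ (⟨y, τ y⟩ : TangentBundle (𝓡 n) M)) x :=
    hσ.congr_of_eventuallyEq (h.mono fun y hy ↦ by simp [hy])
  exact D.isCovariantDerivativeOnUniv.congr_of_eventuallyEq hσ hτ Filter.univ_mem h

/-- Differentiability is carried through the induction because additivity of `D` needs it for both
summands. -/
theorem connection_sum (D : Connection n M) {ι : Type*} (s : Finset ι)
    {σ : ι → Π x : M, TangentSpace (𝓡 n) x} {x : M}
    (hσ : ∀ i, MDifferentiableAt (𝓡 n) (𝓡 n).tangent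
      (fun y ↦ (⟨y, σ i y⟩ : TangentBundle (𝓡 n) M)) x) :
    MDifferentiableAt (𝓡 n) (𝓡 n).tangent
      (fun y ↦ (⟨y, ∑ i ∈ s, σ i y⟩ : TangentBundle (𝓡 n) M)) x ∧
    D (fun y ↦ ∑ i ∈ s, σ i y) x = ∑ i ∈ s, D (σ i) x := by
  classical
  induction s using Finset.induction_on with
  | empty =>
    simp only [Finset.sum_empty]
    refine ⟨(Bundle.contMDiff_zeroSection ℝ _ (n := 1) x).mdifferentiableAt one_ne_zero, ?_⟩
    exact congrFun (D.zero) x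
  | insert a s ha ih =>
    simp only [Finset.sum_insert ha]
    refine ⟨mdifferentiableAt_add_section (hσ a) ih.1, ?_⟩
    rw [← ih.2]
    exact D.isCovariantDerivativeOnUniv.add (hσ a) ih.1

/-- The covariant derivative in a chart. -/
theorem chartDeriv_connection (D : Connection n M)
    (hφ : φ ∈ IsManifold.maximalAtlas (𝓡 n) ∞ M) {x : M} (hx : x ∈ φ.source)
    {σ : Π x : M, TangentSpace (𝓡 n) x}
    (hσ : MDifferentiableAt (𝓡 n) (𝓡 n).tangent
      (fun y ↦ (⟨y, σ y⟩ : TangentBundle (𝓡 n) M)) x) (v : TangentSpace (𝓡 n) x) :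
    chartDeriv φ x (D σ x v) = fderiv ℝ (fieldIn φ σ) (φ x) (chartDeriv φ x v) +
      christoffel D φ (φ x) (chartDeriv φ x v) (fieldIn φ σ (φ x)) := by
  let s := fieldIn φ σ
  let X : Fin n → Π x : M, TangentSpace (𝓡 n) x := fun i ↦
    fieldOf φ fun _ ↦ EuclideanSpace.single i 1
  let g : Fin n → M → ℝ := fun i y ↦ s (φ y) i
  have hs : DifferentiableAt ℝ s (φ x) := differentiableAt_fieldIn hφ hx hσ
  have hφd : MDifferentiableAt (𝓡 n) 𝓘(ℝ, Euc n) φ x :=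
    (contMDiffAt_chart hφ hx).mdifferentiableAt (by simp)
  have hg' : ∀ i, HasMFDerivAt (𝓡 n) 𝓘(ℝ, ℝ) (g i) x
      ((EuclideanSpace.proj i ∘L fderiv ℝ s (φ x)) ∘L chartDeriv φ x) := fun i ↦ by
    have h1 : HasFDerivAt (fun z ↦ s z i) (EuclideanSpace.proj i ∘L fderiv ℝ s (φ x)) (φ x) :=
      (EuclideanSpace.proj (𝕜 := ℝ) i).hasFDerivAt.comp (φ x) hs.hasFDerivAt
    exact h1.hasMFDerivAt.comp x hφd.hasMFDerivAt
  have hX : ∀ i, MDifferentiableAt (𝓡 n) (𝓡 n).tangent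
      (fun y ↦ (⟨y, X i y⟩ : TangentBundle (𝓡 n) M)) x := fun i ↦
    mdifferentiableAt_fieldOf hφ hx _
  have hgX : ∀ i, MDifferentiableAt (𝓡 n) (𝓡 n).tangent
      (fun y ↦ (⟨y, (g i • X i) y⟩ : TangentBundle (𝓡 n) M)) x := fun i ↦
    (hg' i).mdifferentiableAt.smul_section (hX i)
  -- Expansion in the coordinate frame. The Leibniz rule then produces the ordinary derivative of
  -- the components and the Christoffel term.
  have heq : ∀ᶠ y in 𝓝 x, σ y = ∑ i, (g i • X i) y := by
    filter_upwards [φ.open_source.mem_nhds hx] with y hy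
    apply (chartDeriv_bijective hφ hy).1
    rw [map_sum]
    have h1 : ∀ i, chartDeriv φ y ((g i • X i) y) = s (φ y) i • EuclideanSpace.single i (1 : ℝ) :=
      fun i ↦ by
        rw [← chartDeriv_fieldOf hφ hy (fun _ ↦ EuclideanSpace.single i (1 : ℝ)), ← map_smul]
        rfl
    simp only [h1, s, fieldIn_apply_chart hy]
    ext j
    simp [Pi.single_apply]
  rw [connection_congr D hσ heq, (connection_sum D Finset.univ hgX).2]
  have hl : ∀ i, D (g i • X i) x = g i x • D (X i) x +
      (mvfderiv (𝓡 n) (g i) x).smulRight (X i x) := fun i ↦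
    D.isCovariantDerivativeOnUniv.leibniz (hX i) (hg' i).mdifferentiableAt
  have hd : ∀ i, mvfderiv (𝓡 n) (g i) x v = fderiv ℝ s (φ x) (chartDeriv φ x v) i := fun i ↦ by
    rw [mvfderiv, (hg' i).mfderiv]
    rfl
  have hi : ∀ i, chartDeriv φ x (D (g i • X i) x v) =
      s (φ x) i • coordFieldDeriv D φ (φ x) (EuclideanSpace.single i 1) (chartDeriv φ x v) +
      fderiv ℝ s (φ x) (chartDeriv φ x v) i • EuclideanSpace.single i (1 : ℝ) := fun i ↦ by
    have hC : coordFieldDeriv D φ (φ x) (EuclideanSpace.single i 1) (chartDeriv φ x v) =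
        chartDeriv φ x (D (X i) x v) := by
      have h : ∀ y, y = x → ((chartDeriv φ y) ∘L (D (X i) y) ∘L (chartDeriv φ y).inverse)
          (chartDeriv φ x v) = chartDeriv φ x (D (X i) x v) := by
        rintro y rfl
        simp only [ContinuousLinearMap.comp_apply, inverse_chartDeriv_apply hφ hx]
      exact h _ (φ.left_inv hx)
    have hl' : D (g i • X i) x v = g i x • D (X i) x v + mvfderiv (𝓡 n) (g i) x v • X i x :=
      congrArg (fun T ↦ T v) (hl i)
    rw [hl', map_add, map_smul, map_smul, hC, hd, chartDeriv_fieldOf hφ hx]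
  have hsum : (∑ i, D (g i • X i) x) v = ∑ i, D (g i • X i) x v := by simp
  rw [hsum, map_sum]
  simp only [hi, Finset.sum_add_distrib]
  rw [christoffel_apply, add_comm]
  congr 1
  ext j
  simp [Pi.single_apply, s]

theorem christoffel_eq_coordFieldDeriv (D : Connection n M)
    (hφ : φ ∈ IsManifold.maximalAtlas (𝓡 n) ∞ M) {x : M} (hx : x ∈ φ.source)
    (v : TangentSpace (𝓡 n) x) (w : Euc n) :
    chartDeriv φ x (D (fieldOf φ fun _ ↦ w) x v) =
      christoffel D φ (φ x) (chartDeriv φ x v) w := by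
  have hz := φ.map_source hx
  have h : fieldIn φ (fieldOf φ fun _ ↦ w) =ᶠ[𝓝 (φ x)] fun _ ↦ w := by
    filter_upwards [φ.open_target.mem_nhds hz] with z hz using fieldIn_fieldOf hφ hz _
  rw [chartDeriv_connection D hφ hx (mdifferentiableAt_fieldOf hφ hx w), h.fderiv_eq,
    h.self_of_nhds]
  simp

theorem isAffineChart_iff (D : Connection n M) : IsAffineChart D φ ↔
    φ ∈ IsManifold.maximalAtlas (𝓡 n) ∞ M ∧ ∀ z ∈ φ.target, christoffel D φ z = 0 := by
  refine and_congr_right fun hφ ↦ ⟨fun h z hz ↦ ?_, fun h x hx w ↦ ?_⟩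
  · ext1 u
    ext1 w
    have hx := φ.map_target hz
    have h1 := christoffel_eq_coordFieldDeriv D hφ hx ((chartDeriv φ (φ.symm z)).inverse u) w
    have h2 : D (fieldOf φ fun _ ↦ w) (φ.symm z) = 0 := h _ hx w
    rw [h2, chartDeriv_inverse_apply hφ hx, φ.right_inv hz] at h1
    simpa using h1.symm
  · change D (fieldOf φ fun _ ↦ w) x = 0
    ext1 v
    apply (chartDeriv_bijective hφ hx).1
    rw [christoffel_eq_coordFieldDeriv D hφ hx, h _ (φ.map_source hx)]
    simp

theorem isSmoothField_connection {D : Connection n M}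
    (hD : CovariantDerivative.ContMDiffCovariantDerivative D ∞)
    {X Z : Π x : M, TangentSpace (𝓡 n) x} (hX : IsSmoothField X) (hZ : IsSmoothField Z) :
    IsSmoothField fun y ↦ D Z y (X y) := by
  have h1 := hD.contMDiff.contMDiff (σ := Z) hZ.contMDiffOn
  intro x
  exact ContMDiffAt.clm_bundle_apply (h1.contMDiffAt Filter.univ_mem) (hX x)

theorem mdifferentiableAt_of_isSmoothField {X : Π x : M, TangentSpace (𝓡 n) x}
    (hX : IsSmoothField X) (x : M) : MDifferentiableAt (𝓡 n) (𝓡 n).tangent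
      (fun y ↦ (⟨y, X y⟩ : TangentBundle (𝓡 n) M)) x :=
  (hX x).mdifferentiableAt (by simp)

/-- The derivative of a field which is locally a coordinate field, in the direction of another
one, read in the chart. -/
theorem fieldIn_connection_eventuallyEq (D : Connection n M)
    (hφ : φ ∈ IsManifold.maximalAtlas (𝓡 n) ∞ M) {x : M} (hx : x ∈ φ.source)
    {X Z : Π x : M, TangentSpace (𝓡 n) x} (hZ : IsSmoothField Z) {u w : Euc n}
    (hXu : ∀ᶠ y in 𝓝 x, X y = fieldOf φ (fun _ ↦ u) y)
    (hZw : ∀ᶠ y in 𝓝 x, Z y = fieldOf φ (fun _ ↦ w) y) :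
    fieldIn φ (fun y ↦ D Z y (X y)) =ᶠ[𝓝 (φ x)] fun z ↦ christoffel D φ z u w := by
  have hc : ContinuousAt φ.symm (φ x) := φ.continuousAt_symm (φ.map_source hx)
  have hev : ∀ᶠ y in 𝓝 (φ.symm (φ x)), X y = fieldOf φ (fun _ ↦ u) y ∧
      ∀ᶠ y' in 𝓝 y, Z y' = fieldOf φ (fun _ ↦ w) y' := by
    rw [φ.left_inv hx]
    exact hXu.and hZw.eventually_nhds
  filter_upwards [hc.eventually hev, φ.open_target.mem_nhds (φ.map_source hx)] with z hz hzt
  have hy := φ.map_target hzt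
  rw [fieldIn, hz.1, connection_congr D (mdifferentiableAt_of_isSmoothField hZ _) hz.2,
    christoffel_eq_coordFieldDeriv D hφ hy, chartDeriv_fieldOf hφ hy, φ.right_inv hzt]

/-- Locally these are the components of `D Z X` for global smooth fields extending the coordinate
fields. -/
theorem contDiffAt_christoffel_apply [T2Space M] {D : Connection n M}
    (hD : CovariantDerivative.ContMDiffCovariantDerivative D ∞)
    (hφ : φ ∈ IsManifold.maximalAtlas (𝓡 n) ∞ M) {z : Euc n} (hz : z ∈ φ.target) (u w : Euc n) :
    ContDiffAt ℝ ∞ (fun z ↦ christoffel D φ z u w) z := by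
  have hx := φ.map_target hz
  obtain ⟨X, hX, hXu⟩ := exists_isSmoothField_eventuallyEq hφ hx u
  obtain ⟨Z, hZ, hZw⟩ := exists_isSmoothField_eventuallyEq hφ hx w
  have h1 := contDiffAt_fieldIn hφ hx (isSmoothField_connection hD hX hZ (φ.symm z))
  have h2 := h1.congr_of_eventuallyEq (fieldIn_connection_eventuallyEq D hφ hx hZ hXu hZw).symm
  rwa [φ.right_inv hz] at h2

theorem contDiffOn_christoffel [T2Space M] {D : Connection n M}
    (hD : CovariantDerivative.ContMDiffCovariantDerivative D ∞)
    (hφ : φ ∈ IsManifold.maximalAtlas (𝓡 n) ∞ M) :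
    ContDiffOn ℝ ∞ (christoffel D φ) φ.target := by
  rw [contDiffOn_clm_apply]
  intro u
  rw [contDiffOn_clm_apply]
  exact fun w z hz ↦ (contDiffAt_christoffel_apply hD hφ hz u w).contDiffWithinAt

/-- Zero torsion, evaluated on commuting coordinate fields. -/
theorem christoffel_symm {D : Connection n M} (hD : D.torsion = 0)
    (hφ : φ ∈ IsManifold.maximalAtlas (𝓡 n) ∞ M) {z : Euc n} (hz : z ∈ φ.target) (u w : Euc n) :
    christoffel D φ z u w = christoffel D φ z w u := by
  have hx := φ.map_target hz
  have h1 := D.torsion_eq_zero_iff.1 hD (mdifferentiableAt_fieldOf hφ hx u)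
    (mdifferentiableAt_fieldOf hφ hx w)
  rw [mlieBracket_fieldOf hφ hx, sub_eq_zero] at h1
  have h2 := congrArg (chartDeriv φ (φ.symm z)) h1
  rwa [christoffel_eq_coordFieldDeriv D hφ hx, christoffel_eq_coordFieldDeriv D hφ hx,
    chartDeriv_fieldOf hφ hx, chartDeriv_fieldOf hφ hx, φ.right_inv hz] at h2

/-- Zero curvature, evaluated on fields that are coordinate fields near the point, where the bracket
term vanishes. -/
theorem christoffel_flat [T2Space M] {D : Connection n M} (hD : IsAffineStructure D)
    (hφ : φ ∈ IsManifold.maximalAtlas (𝓡 n) ∞ M) {z : Euc n} (hz : z ∈ φ.target)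
    (u w v : Euc n) :
    fderiv ℝ (christoffel D φ) z u w v + christoffel D φ z u (christoffel D φ z w v) =
      fderiv ℝ (christoffel D φ) z w u v + christoffel D φ z w (christoffel D φ z u v) := by
  have hx := φ.map_target hz
  obtain ⟨X, hX, hXu⟩ := exists_isSmoothField_eventuallyEq hφ hx u
  obtain ⟨Y, hY, hYw⟩ := exists_isSmoothField_eventuallyEq hφ hx w
  obtain ⟨Z, hZ, hZv⟩ := exists_isSmoothField_eventuallyEq hφ hx v
  have hdΓ : DifferentiableAt ℝ (christoffel D φ) z :=
    ((contDiffOn_christoffel hD.smooth hφ).contDiffAt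
      (φ.open_target.mem_nhds hz)).differentiableAt (by simp)
  -- The inner derivative has components `christoffel D φ · b v`; the outer one differentiates them
  -- and adds one Christoffel term. It is used for both orders of the two directions.
  have key : ∀ (A B : Π x : M, TangentSpace (𝓡 n) x) (a b : Euc n), IsSmoothField A →
      IsSmoothField B → (∀ᶠ y in 𝓝 (φ.symm z), A y = fieldOf φ (fun _ ↦ a) y) →
      (∀ᶠ y in 𝓝 (φ.symm z), B y = fieldOf φ (fun _ ↦ b) y) →
      chartDeriv φ (φ.symm z) (D (fun y ↦ D Z y (B y)) (φ.symm z) (A (φ.symm z))) =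
        fderiv ℝ (christoffel D φ) z a b v + christoffel D φ z a (christoffel D φ z b v) := by
    intro A B a b hA hB hAa hBb
    have h1 := fieldIn_connection_eventuallyEq D hφ hx hZ hBb hZv
    rw [chartDeriv_connection D hφ hx
      (mdifferentiableAt_of_isSmoothField (isSmoothField_connection hD.smooth hB hZ) _),
      hAa.self_of_nhds, chartDeriv_fieldOf hφ hx, h1.fderiv_eq, h1.self_of_nhds, φ.right_inv hz]
    congr 1
    have h2 := (hdΓ.hasFDerivAt.clm_apply (hasFDerivAt_const b z)).clm_apply (hasFDerivAt_const v z)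
    rw [h2.fderiv]
    simp
  have hbr : VectorField.mlieBracket (𝓡 n) X Y (φ.symm z) = 0 := by
    rw [Filter.EventuallyEq.mlieBracket_vectorField_eq hXu hYw, mlieBracket_fieldOf hφ hx]
  have h0 := hD.curvature X Y Z hX hY hZ (φ.symm z)
  rw [hbr, map_zero, sub_zero, sub_eq_zero] at h0
  rw [← key X Y u w hX hY hXu hYw, ← key Y X w u hY hX hYw hXu, h0]

end Christoffel

/-! ### Affine charts and affine diffeomorphisms -/

section AffineCharts

variable {n : ℕ} {M : Type*} [TopologicalSpace M] [ChartedSpace (Euc n) M]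
  {φ : OpenPartialHomeomorph M (Euc n)}

theorem chartDeriv_trans (hφ : φ ∈ IsManifold.maximalAtlas (𝓡 n) ∞ M)
    {ψ : OpenPartialHomeomorph (Euc n) (Euc n)} {x : M} (hx : x ∈ φ.source)
    {A : Euc n →L[ℝ] Euc n} (hA : HasFDerivAt ψ A (φ x)) :
    chartDeriv (φ.trans ψ) x = A ∘L chartDeriv φ x :=
  (hA.hasMFDerivAt.comp x
    ((contMDiffAt_chart hφ hx).mdifferentiableAt (by simp)).hasMFDerivAt).mfderiv

theorem mfderiv_diffeo_bijective (f : M ≃ₘ^∞⟮𝓡 n, 𝓡 n⟯ M) (x : M) :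
    Function.Bijective (mfderiv (𝓡 n) (𝓡 n) f x) :=
  (f.mfderivToContinuousLinearEquiv (by simp) x).bijective

theorem isInvertible_mfderiv_diffeo (f : M ≃ₘ^∞⟮𝓡 n, 𝓡 n⟯ M) (x : M) :
    (mfderiv (𝓡 n) (𝓡 n) f x).IsInvertible :=
  ⟨f.mfderivToContinuousLinearEquiv (by simp) x, rfl⟩

variable [IsManifold (𝓡 n) ∞ M]

/-- Composing a smooth chart with a local diffeomorphism of the model space gives a smooth chart. -/
theorem trans_mem_maximalAtlas (hφ : φ ∈ IsManifold.maximalAtlas (𝓡 n) ∞ M)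
    {ψ : OpenPartialHomeomorph (Euc n) (Euc n)} (hψ : ContDiffOn ℝ ∞ ψ ψ.source)
    (hψ' : ContDiffOn ℝ ∞ ψ.symm ψ.target) :
    φ.trans ψ ∈ IsManifold.maximalAtlas (𝓡 n) ∞ M := by
  apply OpenPartialHomeomorph.mem_maximalAtlas_of_contMDiffOn
  · intro x hx
    rw [OpenPartialHomeomorph.trans_source] at hx
    exact (((hψ.contDiffAt (ψ.open_source.mem_nhds hx.2)).contMDiffAt).comp x
      (contMDiffAt_chart hφ hx.1)).contMDiffWithinAt
  · intro z hz
    rw [OpenPartialHomeomorph.trans_target] at hz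
    exact (ContMDiffAt.comp z (contMDiffAt_chart_symm hφ hz.2)
      ((hψ'.contDiffAt (ψ.open_target.mem_nhds hz.1)).contMDiffAt)).contMDiffWithinAt

/-- A torsion free flat connection has affine charts around each point. -/
theorem exists_isAffineChart [T2Space M] {D : Connection n M} (hD : IsAffineStructure D) (x : M) :
    ∃ φ, IsAffineChart D φ ∧ x ∈ φ.source := by
  let φ := chartAt (Euc n) x
  have hφ : φ ∈ IsManifold.maximalAtlas (𝓡 n) ∞ M := IsManifold.chart_mem_maximalAtlas x
  have hx : x ∈ φ.source := mem_chart_source _ x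
  obtain ⟨ψ, α, hxψ, hψU, hψs, hψs', hα⟩ := exists_flat_coordinates φ.open_target
    (contDiffOn_christoffel hD.smooth hφ)
    (fun z hz ↦ christoffel_symm hD.torsion hφ hz) (fun z hz ↦ christoffel_flat hD hφ hz)
    (φ.map_source hx)
  have htr := trans_mem_maximalAtlas hφ hψs hψs'
  refine ⟨φ.trans ψ, ⟨htr, fun y hy w ↦ ?_⟩, ?_⟩
  · change D (fieldOf (φ.trans ψ) fun _ ↦ w) y = 0
    have hy' := hy
    rw [OpenPartialHomeomorph.trans_source] at hy'
    obtain ⟨hy1, hy2⟩ := hy'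
    have hdiff := mdifferentiableAt_fieldOf htr hy w
    ext1 v
    apply (chartDeriv_bijective hφ hy1).1
    rw [chartDeriv_connection D hφ hy1 hdiff]
    let Y := fieldIn φ (fieldOf (φ.trans ψ) fun _ ↦ w)
    have hY : DifferentiableAt ℝ Y (φ y) := differentiableAt_fieldIn hφ hy1 hdiff
    -- In the chart `φ` the coordinate field `Y` of the new chart is characterised by `α Y = w`.
    -- Differentiating with `dα = α ∘ Γ` gives `α (dY + Γ Y) = 0`; as `α` is injective, `Y` is
    -- parallel.
    have hαY : ∀ᶠ z in 𝓝 (φ y), α z (Y z) = w := by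
      filter_upwards [φ.open_target.mem_nhds (φ.map_source hy1), ψ.open_source.mem_nhds hy2]
        with z hz1 hz2
      have hz1' := φ.map_target hz1
      have hz2' : φ.symm z ∈ (φ.trans ψ).source := by
        rw [OpenPartialHomeomorph.trans_source]
        exact ⟨hz1', by simpa [φ.right_inv hz1] using hz2⟩
      have h1 := chartDeriv_trans hφ hz1' (A := α z)
        (by rw [φ.right_inv hz1]; exact (hα z hz2).2.1)
      have h2 := chartDeriv_fieldOf htr hz2' fun _ ↦ w
      rw [h1] at h2
      exact h2
    have h3 := ((hα _ hy2).2.2.clm_apply hY.hasFDerivAt).fderiv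
    rw [Filter.EventuallyEq.fderiv_eq (f := fun _ ↦ w) hαY] at h3
    have h4 := DFunLike.congr_fun h3 (chartDeriv φ y v)
    simp only [fderiv_fun_const, Pi.zero_apply, zero_apply] at h4
    have hinj : Function.Injective (α (φ y)) := (hα _ hy2).1.bijective.1
    rw [zero_apply, map_zero]
    apply hinj
    simp at h4
    rw [map_zero, map_add]
    exact h4.symm
  · rw [OpenPartialHomeomorph.trans_source]
    exact ⟨hx, hxψ⟩

/-- The covariant derivative in an affine chart. -/
theorem IsAffineChart.chartDeriv_connection {D : Connection n M} (hφ : IsAffineChart D φ) {x : M}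
    (hx : x ∈ φ.source) {σ : Π x : M, TangentSpace (𝓡 n) x}
    (hσ : MDifferentiableAt (𝓡 n) (𝓡 n).tangent
      (fun y ↦ (⟨y, σ y⟩ : TangentBundle (𝓡 n) M)) x) (v : TangentSpace (𝓡 n) x) :
    chartDeriv φ x (D σ x v) = fderiv ℝ (fieldIn φ σ) (φ x) (chartDeriv φ x v) := by
  rw [AffineAnosov.chartDeriv_connection D hφ.1 hx hσ,
    ((isAffineChart_iff D).1 hφ).2 _ (φ.map_source hx)]
  simp

/-- An affine diffeomorphism is affine in affine charts. -/
theorem IsAffineDiffeo.affine_in_charts [T2Space M] {D : Connection n M}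
    {f : M ≃ₘ^∞⟮𝓡 n, 𝓡 n⟯ M} (hf : IsAffineDiffeo D f) {ψ : OpenPartialHomeomorph M (Euc n)}
    (hφ : IsAffineChart D φ) (hψ : IsAffineChart D ψ) {B : Set (Euc n)} (hB : IsOpen B)
    (hBc : Convex ℝ B) (hBφ : B ⊆ φ.target) (hBψ : ∀ z ∈ B, f (φ.symm z) ∈ ψ.source) :
    ∃ A : Euc n →L[ℝ] Euc n, Function.Injective A ∧
      (∀ z ∈ B, ∀ v : TangentSpace (𝓡 n) (φ.symm z),
        chartDeriv ψ (f (φ.symm z)) (mfderiv (𝓡 n) (𝓡 n) f (φ.symm z) v) =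
          A (chartDeriv φ (φ.symm z) v)) ∧
      ∀ z ∈ B, ∀ z' ∈ B, ψ (f (φ.symm z')) - ψ (f (φ.symm z)) = A (z' - z) := by
  rcases B.eq_empty_or_nonempty with rfl | ⟨z₀, hz₀⟩
  · exact ⟨ContinuousLinearMap.id ℝ _, Function.injective_id, by simp, by simp⟩
  -- `H w` reads in `φ` the pullback by `f` of the constant field `w` of `ψ`. The pullback of a
  -- parallel field is parallel, so `H w` has zero derivative and is constant on the connected set
  -- `B`.
  let H : Euc n → Euc n → Euc n := fun w ↦
    fieldIn φ (VectorField.mpullback (𝓡 n) (𝓡 n) f (fieldOf ψ fun _ ↦ w))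
  have hH : ∀ w, ∀ z ∈ B, HasFDerivAt (H w) (0 : Euc n →L[ℝ] Euc n) z := by
    intro w z hz
    have hy := φ.map_target (hBφ hz)
    have hfy := hBψ z hz
    obtain ⟨σ, hσ, hσw⟩ := exists_isSmoothField_eventuallyEq hψ.1 hfy w
    have hpull := MDifferentiableAt.mpullback_vectorField (n := ∞)
      (mdifferentiableAt_of_isSmoothField hσ (f (φ.symm z))) f.contMDiff.contMDiffAt
      (isInvertible_mfderiv_diffeo f (φ.symm z)) (WithTop.coe_le_coe.2 le_top)
    have h0 : D (VectorField.mpullback (𝓡 n) (𝓡 n) f σ) (φ.symm z) = 0 := by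
      ext1 v
      apply (mfderiv_diffeo_bijective f (φ.symm z)).1
      rw [hf σ hσ, connection_congr D (mdifferentiableAt_of_isSmoothField hσ _) hσw]
      have : D (fieldOf ψ fun _ ↦ w) (f (φ.symm z)) = 0 := hψ.2 _ hfy w
      rw [this, zero_apply, zero_apply, map_zero]
    have hev : H w =ᶠ[𝓝 z] fieldIn φ (VectorField.mpullback (𝓡 n) (𝓡 n) f σ) := by
      have hc : ContinuousAt (fun z ↦ f (φ.symm z)) z :=
        f.continuous.continuousAt.comp (φ.continuousAt_symm (hBφ hz))
      filter_upwards [hc.eventually hσw] with z' hz'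
      simp only [H, fieldIn, VectorField.mpullback_apply, hz']
    have hd := differentiableAt_fieldIn hφ.1 hy hpull
    rw [φ.right_inv (hBφ hz)] at hd
    have h1 : fderiv ℝ (H w) z = 0 := by
      ext1 u
      obtain ⟨v, rfl⟩ := (chartDeriv_bijective hφ.1 hy).2 u
      have h2 := hφ.chartDeriv_connection hy hpull v
      rw [h0, φ.right_inv (hBφ hz)] at h2
      rw [hev.fderiv_eq, ← h2, zero_apply, zero_apply, map_zero]
    rw [← h1]
    exact (hd.congr_of_eventuallyEq hev).hasFDerivAt
  have hHc : ∀ w, ∀ z ∈ B, H w z = H w z₀ := fun w z hz ↦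
    hB.is_const_of_fderiv_eq_zero hBc.isPreconnected
      (fun y hy ↦ (hH w y hy).differentiableAt.differentiableWithinAt)
      (fun y hy ↦ (hH w y hy).fderiv) hz hz₀
  have hinv : ∀ z ∈ B, ∀ v : TangentSpace (𝓡 n) (φ.symm z),
      H (chartDeriv ψ (f (φ.symm z)) (mfderiv (𝓡 n) (𝓡 n) f (φ.symm z) v)) z =
        chartDeriv φ (φ.symm z) v := by
    intro z hz v
    simp only [H, fieldIn, VectorField.mpullback_apply, fieldOf]
    rw [inverse_chartDeriv_apply hψ.1 (hBψ z hz),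
      (isInvertible_mfderiv_diffeo f (φ.symm z)).inverse_apply_self]
  -- The derivative of `f` in the charts. At each point it is inverse to `w ↦ H w z`, hence it is
  -- constant too, and `f` minus this linear map is constant on `B`.
  let G : Euc n → Euc n →L[ℝ] Euc n := fun z ↦
    (chartDeriv ψ (f (φ.symm z)) ∘L mfderiv (𝓡 n) (𝓡 n) f (φ.symm z)) ∘L
      (chartDeriv φ (φ.symm z)).inverse
  have hG : ∀ z ∈ B, ∀ v : TangentSpace (𝓡 n) (φ.symm z),
      G z (chartDeriv φ (φ.symm z) v) =
        chartDeriv ψ (f (φ.symm z)) (mfderiv (𝓡 n) (𝓡 n) f (φ.symm z) v) := by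
    intro z hz v
    simp only [G, ContinuousLinearMap.comp_apply]
    rw [inverse_chartDeriv_apply hφ.1 (φ.map_target (hBφ hz))]
  have hHG : ∀ z ∈ B, ∀ u, H (G z u) z = u := by
    intro z hz u
    obtain ⟨v, rfl⟩ := (chartDeriv_bijective hφ.1 (φ.map_target (hBφ hz))).2 u
    rw [hG z hz, hinv z hz]
  have hGH : ∀ z ∈ B, ∀ w, G z (H w z) = w := by
    intro z hz w
    obtain ⟨v, rfl⟩ := (chartDeriv_bijective hψ.1 (hBψ z hz)).2 w
    obtain ⟨v, rfl⟩ := (mfderiv_diffeo_bijective f (φ.symm z)).2 v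
    rw [hinv z hz, hG z hz]
  have hGc : ∀ z ∈ B, G z = G z₀ := by
    intro z hz
    ext1 u
    rw [← hGH z₀ hz₀ (G z u), ← hHc _ z hz, hHG z hz]
  have hg : ∀ z ∈ B, HasFDerivAt (fun z ↦ ψ (f (φ.symm z))) (G z₀) z := by
    intro z hz
    have hy := φ.map_target (hBφ hz)
    have h1 : HasMFDerivAt 𝓘(ℝ, Euc n) (𝓡 n) φ.symm z (mfderiv 𝓘(ℝ, Euc n) (𝓡 n) φ.symm z) :=
      ((contMDiffAt_chart_symm hφ.1 (hBφ hz)).mdifferentiableAt (by simp)).hasMFDerivAt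
    have h2 : HasMFDerivAt (𝓡 n) (𝓡 n) f (φ.symm z) (mfderiv (𝓡 n) (𝓡 n) f (φ.symm z)) :=
      (f.contMDiff.contMDiffAt.mdifferentiableAt (by simp)).hasMFDerivAt
    have h3 : HasMFDerivAt (𝓡 n) 𝓘(ℝ, Euc n) ψ (f (φ.symm z)) (chartDeriv ψ (f (φ.symm z))) :=
      ((contMDiffAt_chart hψ.1 (hBψ z hz)).mdifferentiableAt (by simp)).hasMFDerivAt
    have h4 := (h3.comp z (h2.comp z h1)).hasFDerivAt
    refine h4.congr_fderiv ?_
    rw [← hGc z hz]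
    ext1 u
    have h5 : chartDeriv φ (φ.symm z) (mfderiv 𝓘(ℝ, Euc n) (𝓡 n) φ.symm z u) = u :=
      DFunLike.congr_fun ((mdifferentiable_chart_of_mem hφ.1).comp_symm_deriv (hBφ hz)) u
    conv_rhs => rw [← h5]
    exact (hG z hz _).symm
  refine ⟨G z₀, fun u u' huu ↦ ?_, fun z hz v ↦ ?_, fun z hz z' hz' ↦ ?_⟩
  · rw [← hHG z₀ hz₀ u, huu, hHG z₀ hz₀]
  · rw [← hGc z hz, hG z hz]
  · have h1 : ∀ y ∈ B, HasFDerivAt (fun z ↦ ψ (f (φ.symm z)) - G z₀ z) 0 y := fun y hy ↦ 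
      ((hg y hy).sub (G z₀).hasFDerivAt).congr_fderiv (sub_self _)
    have := hB.is_const_of_fderiv_eq_zero hBc.isPreconnected
      (fun y hy ↦ (h1 y hy).differentiableAt.differentiableWithinAt)
      (fun y hy ↦ (h1 y hy).fderiv) hz' hz
    rw [map_sub, sub_eq_sub_iff_sub_eq_sub]
    exact this

theorem isAffineDiffeo_refl (D : Connection n M) :
    IsAffineDiffeo D (Diffeomorph.refl (𝓡 n) M ∞) := by
  intro σ _ x v
  have h : VectorField.mpullback (𝓡 n) (𝓡 n) (Diffeomorph.refl (𝓡 n) M ∞) σ = σ :=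
    VectorField.mpullback_id
  have h' : mfderiv (𝓡 n) (𝓡 n) (Diffeomorph.refl (𝓡 n) M ∞) x =
    ContinuousLinearMap.id ℝ _ := mfderiv_id
  rw [h, h']
  rfl

/-- Changes of affine charts are affine. -/
theorem IsAffineChart.affine_transition [T2Space M] {D : Connection n M}
    {ψ : OpenPartialHomeomorph M (Euc n)}
    (hφ : IsAffineChart D φ) (hψ : IsAffineChart D ψ) {B : Set (Euc n)} (hB : IsOpen B)
    (hBc : Convex ℝ B) (hBφ : B ⊆ φ.target) (hBψ : ∀ z ∈ B, φ.symm z ∈ ψ.source) :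
    ∃ A : Euc n →L[ℝ] Euc n, Function.Injective A ∧
      (∀ z ∈ B, ∀ v : TangentSpace (𝓡 n) (φ.symm z),
        chartDeriv ψ (φ.symm z) v = A (chartDeriv φ (φ.symm z) v)) ∧
      ∀ z ∈ B, ∀ z' ∈ B, ψ (φ.symm z') - ψ (φ.symm z) = A (z' - z) := by
  obtain ⟨A, hA1, hA2, hA3⟩ := (isAffineDiffeo_refl D).affine_in_charts hφ hψ hB hBc hBφ hBψ
  refine ⟨A, hA1, fun z hz v ↦ ?_, hA3⟩
  have h := hA2 z hz v
  have h' : mfderiv (𝓡 n) (𝓡 n) (Diffeomorph.refl (𝓡 n) M ∞) (φ.symm z) =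
    ContinuousLinearMap.id ℝ _ := mfderiv_id
  rw [h'] at h
  exact h

end AffineCharts

/-! ### Comparison of the Riemannian norm with chart norms -/

section MetricComparison

variable {n : ℕ} {M : Type*} [TopologicalSpace M] [ChartedSpace (Euc n) M]
  [IsManifold (𝓡 n) ∞ M] {φ : OpenPartialHomeomorph M (Euc n)}
  (g : Bundle.ContMDiffRiemannianMetric (𝓡 n) ∞ (Euc n) (TangentSpace (𝓡 n) : M → Type _))

theorem gnorm_nonneg {x : M} (v : TangentSpace (𝓡 n) x) : 0 ≤ gnorm g v := Real.sqrt_nonneg _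

theorem inner_self_nonneg {x : M} (v : TangentSpace (𝓡 n) x) : 0 ≤ g.inner x v v := by
  rcases eq_or_ne v 0 with rfl | hv
  · simp
  · exact (g.pos x v hv).le

theorem gnorm_sq {x : M} (v : TangentSpace (𝓡 n) x) : gnorm g v ^ 2 = g.inner x v v :=
  Real.sq_sqrt (inner_self_nonneg g v)

/-- Positivity of the form at `v + w` already gives `‖v - w‖² ≤ 2‖v‖² + 2‖w‖²`. The lossy factor 2
is harmless for asymptotic arguments. -/
theorem gnorm_sub_le {x : M} (v w : TangentSpace (𝓡 n) x) :
    gnorm g (v - w) ≤ 2 * (gnorm g v + gnorm g w) := by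
  have h1 := inner_self_nonneg g (v + w)
  have h2 := gnorm_sq g (v - w)
  have h3 := gnorm_sq g v
  have h4 := gnorm_sq g w
  simp only [map_add, map_sub, add_apply, sub_apply] at h1 h2
  have hv := gnorm_nonneg g v
  have hw := gnorm_nonneg g w
  apply abs_le_of_sq_le_sq' _ (by positivity) |>.2
  nlinarith [mul_nonneg hv hw]

theorem gnorm_smul {x : M} (t : ℝ) (v : TangentSpace (𝓡 n) x) :
    gnorm g (t • v) = |t| * gnorm g v := by
  rw [gnorm, gnorm]
  simp only [map_smul, smul_apply, smul_eq_mul]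
  rw [← mul_assoc, ← sq, Real.sqrt_mul (sq_nonneg t), Real.sqrt_sq_eq_abs]

theorem gnorm_pos {x : M} {v : TangentSpace (𝓡 n) x} (hv : v ≠ 0) : 0 < gnorm g v :=
  Real.sqrt_pos.2 (g.pos x v hv)

theorem continuousAt_inner {x : M} {X Y : Π x : M, TangentSpace (𝓡 n) x}
    (hX : ContMDiffAt (𝓡 n) (𝓡 n).tangent ∞ (fun y ↦ (⟨y, X y⟩ : TangentBundle (𝓡 n) M)) x)
    (hY : ContMDiffAt (𝓡 n) (𝓡 n).tangent ∞ (fun y ↦ (⟨y, Y y⟩ : TangentBundle (𝓡 n) M)) x) :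
    ContinuousAt (fun y ↦ g.inner y (X y) (Y y)) x := by
  have : ContMDiffAt (𝓡 n) ((𝓡 n).prod 𝓘(ℝ)) ∞
      (fun m ↦ Bundle.TotalSpace.mk' ℝ (E := Bundle.Trivial M ℝ) m (g.inner m (X m) (Y m))) x := by
    apply ContMDiffAt.clm_bundle_apply₂ (F₁ := Euc n) (F₂ := Euc n)
    · exact g.contMDiff x
    · exact hX
    · exact hY
  rw [Bundle.contMDiffAt_totalSpace] at this
  exact this.2.continuousAt

/-- The square of the metric norm in a chart. -/
def chartInner (φ : OpenPartialHomeomorph M (Euc n)) (p : Euc n × Euc n) : ℝ :=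
  g.inner (φ.symm p.1) ((chartDeriv φ (φ.symm p.1)).inverse p.2)
    ((chartDeriv φ (φ.symm p.1)).inverse p.2)

/-- In the coordinate frame the form is a finite sum of continuous coefficients times products of
components. -/
theorem continuousOn_chartInner (hφ : φ ∈ IsManifold.maximalAtlas (𝓡 n) ∞ M) :
    ContinuousOn (chartInner g φ) (φ.target ×ˢ univ) := by
  let X : Fin n → Π x : M, TangentSpace (𝓡 n) x := fun i ↦
    fieldOf φ fun _ ↦ EuclideanSpace.single i 1
  have h : ∀ p : Euc n × Euc n, chartInner g φ p =
      ∑ i, ∑ j, p.2 i * (p.2 j * g.inner (φ.symm p.1) (X i (φ.symm p.1)) (X j (φ.symm p.1))) := by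
    intro p
    have hp : (chartDeriv φ (φ.symm p.1)).inverse p.2 = ∑ i, p.2 i • X i (φ.symm p.1) := by
      simp only [X, fieldOf, ← map_smul, ← map_sum]
      congr 1
      ext j
      simp [Pi.single_apply]
    rw [chartInner, hp]
    simp only [map_sum, map_smul, sum_apply, smul_apply, smul_eq_mul, Finset.mul_sum]
    refine Finset.sum_congr rfl fun i _ ↦ Finset.sum_congr rfl fun j _ ↦ ?_
    rw [g.symm]
  rw [funext h]
  intro p hp
  apply ContinuousAt.continuousWithinAt
  have h1 : ∀ i, ContinuousAt (fun p : Euc n × Euc n ↦ p.2 i) p := fun i ↦ by fun_prop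
  refine tendsto_finsetSum _ fun i _ ↦ tendsto_finsetSum _ fun j _ ↦
    (h1 i).mul ((h1 j).mul ?_)
  have hx := φ.map_target hp.1
  have h2 := continuousAt_inner g
    (contMDiffAt_fieldOf hφ hx (s := fun _ ↦ EuclideanSpace.single i 1) contDiffAt_const)
    (contMDiffAt_fieldOf hφ hx (s := fun _ ↦ EuclideanSpace.single j 1) contDiffAt_const)
  exact ContinuousAt.comp (f := fun p : Euc n × Euc n ↦ φ.symm p.1) h2
    (ContinuousAt.comp (φ.continuousAt_symm hp.1) continuousAt_fst)

/-- On compact parts of a chart, the norm of the metric is comparable with the norm of the model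
space. -/
theorem exists_gnorm_comparison (hφ : φ ∈ IsManifold.maximalAtlas (𝓡 n) ∞ M) {K : Set (Euc n)}
    (hK : IsCompact K) (hKφ : K ⊆ φ.target) :
    ∃ C : ℝ, 0 < C ∧ ∀ z ∈ K, ∀ v : TangentSpace (𝓡 n) (φ.symm z),
      ‖chartDeriv φ (φ.symm z) v‖ ≤ C * gnorm g v ∧
      gnorm g v ≤ C * ‖chartDeriv φ (φ.symm z) v‖ := by
  -- By homogeneity unit vectors suffice. On this compact set the metric norm is continuous and
  -- positive, so both it and its inverse are bounded.
  have hc : IsCompact (K ×ˢ Metric.sphere (0 : Euc n) 1) := hK.prod (isCompact_sphere 0 1)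
  have hcont : ContinuousOn (fun p ↦ Real.sqrt (chartInner g φ p))
      (K ×ˢ Metric.sphere (0 : Euc n) 1) :=
    ((continuousOn_chartInner g hφ).mono (prod_mono hKφ (subset_univ _))).sqrt
  have hpos : ∀ p ∈ K ×ˢ Metric.sphere (0 : Euc n) 1, 0 < Real.sqrt (chartInner g φ p) := by
    intro p hp
    apply gnorm_pos
    intro h0
    have h1 := chartDeriv_inverse_apply hφ (φ.map_target (hKφ hp.1)) p.2
    rw [h0, map_zero] at h1
    have := mem_sphere_zero_iff_norm.1 hp.2
    rw [← h1, norm_zero] at this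
    exact zero_ne_one this
  obtain ⟨C₁, hC₁⟩ := hc.exists_bound_of_continuousOn hcont
  obtain ⟨C₂, hC₂⟩ := hc.exists_bound_of_continuousOn (hcont.inv₀ fun p hp ↦ (hpos p hp).ne')
  refine ⟨max 1 (max C₁ C₂), by positivity, fun z hz v ↦ ?_⟩
  rcases eq_or_ne v 0 with rfl | hv
  · simp [gnorm]
  set u := chartDeriv φ (φ.symm z) v with hu
  have hbij := chartDeriv_bijective hφ (φ.map_target (hKφ hz))
  have hu0 : u ≠ 0 := fun h ↦ hv (hbij.1 (by rw [← hu, h, map_zero]))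
  have hun : 0 < ‖u‖ := norm_pos_iff.2 hu0
  have hmem : (z, ‖u‖⁻¹ • u) ∈ K ×ˢ Metric.sphere (0 : Euc n) 1 := by
    refine ⟨hz, ?_⟩
    rw [mem_sphere_zero_iff_norm, norm_smul, norm_inv, norm_norm, inv_mul_cancel₀ hun.ne']
  have hval : Real.sqrt (chartInner g φ (z, ‖u‖⁻¹ • u)) = ‖u‖⁻¹ * gnorm g v := by
    have h1 : (chartDeriv φ (φ.symm z)).inverse (‖u‖⁻¹ • u) = ‖u‖⁻¹ • v := by
      rw [map_smul, hu, inverse_chartDeriv_apply hφ (φ.map_target (hKφ hz))]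
    have h2 : Real.sqrt (chartInner g φ (z, ‖u‖⁻¹ • u)) = gnorm g (‖u‖⁻¹ • v) := by
      rw [← h1]; rfl
    rw [h2, gnorm_smul, abs_of_pos (inv_pos.2 hun)]
  have b1 := hC₁ _ hmem
  have b2 := hC₂ _ hmem
  have hgp := gnorm_pos g hv
  rw [Pi.inv_apply] at b2
  rw [hval, Real.norm_of_nonneg (by positivity)] at b1 b2
  constructor
  · rw [mul_inv, inv_inv, ← div_eq_mul_inv, div_le_iff₀ hgp] at b2
    refine b2.trans ?_
    gcongr
    exact (le_max_right _ _).trans (le_max_right _ _)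
  · rw [inv_mul_le_iff₀ hun, mul_comm] at b1
    refine b1.trans ?_
    gcongr
    exact (le_max_left _ _).trans (le_max_right _ _)

end MetricComparison

/-! ### Distributions in charts and iterates -/

section Charts

variable {n : ℕ} {M : Type*} [TopologicalSpace M] [ChartedSpace (Euc n) M]

/-- A distribution, read in a chart. -/
def distIn (φ : OpenPartialHomeomorph M (Euc n)) (E : Distribution n M) (z : Euc n) :
    Submodule ℝ (Euc n) :=
  (E (φ.symm z)).map (chartDeriv φ (φ.symm z)).toLinearMap

theorem mem_distIn {φ : OpenPartialHomeomorph M (Euc n)} {E : Distribution n M} {z u : Euc n} :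
    u ∈ distIn φ E z ↔ ∃ v ∈ E (φ.symm z), chartDeriv φ (φ.symm z) v = u :=
  Submodule.mem_map

theorem finrank_distIn {φ : OpenPartialHomeomorph M (Euc n)}
    (hφ : φ ∈ IsManifold.maximalAtlas (𝓡 n) ∞ M) (E : Distribution n M) {z : Euc n}
    (hz : z ∈ φ.target) : Module.finrank ℝ (distIn φ E z) = Module.finrank ℝ (E (φ.symm z)) :=
  (LinearEquiv.finrank_eq (Submodule.equivMapOfInjective _
    (chartDeriv_bijective hφ (φ.map_target hz)).1 _)).symm

theorem contMDiff_iterate (f : M ≃ₘ^∞⟮𝓡 n, 𝓡 n⟯ M) (m : ℕ) :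
    ContMDiff (𝓡 n) (𝓡 n) ∞ f^[m] := by
  induction m with
  | zero => exact contMDiff_id
  | succ m ih => rw [Function.iterate_succ']; exact f.contMDiff.comp ih

theorem mfderiv_iterate_succ (f : M ≃ₘ^∞⟮𝓡 n, 𝓡 n⟯ M) (m : ℕ) (x : M) :
    mfderiv (𝓡 n) (𝓡 n) (f ∘ f^[m]) x =
      (mfderiv (𝓡 n) (𝓡 n) f (f^[m] x)) ∘L (mfderiv (𝓡 n) (𝓡 n) f^[m] x) := by
  exact mfderiv_comp x (f.contMDiff.mdifferentiable (by simp) _)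
    ((contMDiff_iterate f m).mdifferentiable (by simp) _)

variable [IsManifold (𝓡 n) ∞ M]

/-- The distribution is integrable with affine integral manifolds: near each point, it is constant
along its integral affine subspaces in some affine chart. -/
def IsAffinelyIntegrable (D : Connection n M) (E : Distribution n M) : Prop :=
  ∀ x : M, ∃ φ, IsAffineChart D φ ∧ x ∈ φ.source ∧ ∃ ρ > 0,
    Metric.ball (φ x) ρ ⊆ φ.target ∧ ∀ z ∈ Metric.ball (φ x) ρ, ∀ u ∈ distIn φ E z,
      z + u ∈ Metric.ball (φ x) ρ → distIn φ E (z + u) = distIn φ E z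

theorem IsContinuousSubbundle.eventually_finrank {E : Distribution n M}
    (hE : IsContinuousSubbundle E) (x : M) :
    ∀ᶠ y in 𝓝 x, Module.finrank ℝ (E y) = Module.finrank ℝ (E x) := by
  obtain ⟨U, hU, k, σ, -, hσ⟩ := hE x
  have h : ∀ y ∈ U, Module.finrank ℝ (E y) = k := fun y hy ↦ by
    obtain ⟨h1, h2⟩ := hσ y hy
    rw [← h2, finrank_span_eq_card h1, Fintype.card_fin]
  filter_upwards [hU] with y hy
  rw [h y hy, h x (mem_of_mem_nhds hU)]

end Charts

/-! ### A uniform scale for a finite family of charts -/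

section UniformRadius

variable {n : ℕ} {M : Type*} [TopologicalSpace M] [T2Space M] [ChartedSpace (Euc n) M]

/-- A uniform radius on which an affine diffeomorphism is affine in charts. -/
theorem exists_uniform_radius (f : M ≃ₘ^∞⟮𝓡 n, 𝓡 n⟯ M)
    (φ : M → OpenPartialHomeomorph M (Euc n)) (K : M → Set M) (t : Finset M)
    (hK : ∀ i, IsCompact (K i)) (hKφ : ∀ i, K i ⊆ (φ i).source) :
    ∃ δ : ℝ, 0 < δ ∧ (∀ i ∈ t, Metric.cthickening δ (φ i '' K i) ⊆ (φ i).target) ∧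
      ∀ i ∈ t, ∀ j ∈ t, ∀ x ∈ K i, f x ∈ K j → ∀ z ∈ Metric.ball (φ i x) δ,
        f ((φ i).symm z) ∈ (φ j).source := by
  have h1 : ∀ i, ∃ δ : ℝ, 0 < δ ∧ Metric.cthickening δ (φ i '' K i) ⊆ (φ i).target := fun i ↦
    ((hK i).image_of_continuousOn ((φ i).continuousOn.mono (hKφ i))).exists_cthickening_subset_open
      (φ i).open_target ((φ i).mapsTo.mono_left (hKφ i)).image_subset
  -- The points of `K i` sent by `f` into `K j` form a compact set, which has a thickening inside
  -- the open set of points sent into the chart `j`.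
  have h2 : ∀ i j, ∃ δ : ℝ, 0 < δ ∧ Metric.cthickening δ (φ i '' (K i ∩ f ⁻¹' K j)) ⊆
      (φ i).target ∩ (φ i).symm ⁻¹' (f ⁻¹' (φ j).source) := fun i j ↦ by
    have hc : IsCompact (K i ∩ f ⁻¹' K j) :=
      (hK i).inter_right ((hK j).isClosed.preimage f.continuous)
    refine (hc.image_of_continuousOn ((φ i).continuousOn.mono
      (inter_subset_left.trans (hKφ i)))).exists_cthickening_subset_open
      ((φ i).isOpen_inter_preimage_symm ((φ j).open_source.preimage f.continuous)) ?_
    rintro _ ⟨x, hx, rfl⟩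
    refine ⟨(φ i).map_source (hKφ i hx.1), ?_⟩
    rw [mem_preimage, (φ i).left_inv (hKφ i hx.1)]
    exact hKφ j hx.2
  choose δ₁ hδ₁ hsub₁ using h1
  choose δ₂ hδ₂ hsub₂ using h2
  obtain ⟨δ, hδ, hle⟩ : ∃ δ : ℝ, 0 < δ ∧ (∀ i ∈ t, δ ≤ δ₁ i) ∧ ∀ i ∈ t, ∀ j ∈ t, δ ≤ δ₂ i j := by
    have e1 : ∀ᶠ δ in 𝓝[>] (0 : ℝ), ∀ i ∈ t, δ ≤ δ₁ i :=
      (Finset.eventually_all t).2 fun i _ ↦ nhdsWithin_le_nhds (eventually_le_nhds (hδ₁ i))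
    have e2 : ∀ᶠ δ in 𝓝[>] (0 : ℝ), ∀ i ∈ t, ∀ j ∈ t, δ ≤ δ₂ i j :=
      (Finset.eventually_all t).2 fun i _ ↦ (Finset.eventually_all t).2 fun j _ ↦
        nhdsWithin_le_nhds (eventually_le_nhds (hδ₂ i j))
    obtain ⟨δ, h, h'⟩ := ((e1.and e2).and self_mem_nhdsWithin).exists
    exact ⟨δ, h', h⟩
  refine ⟨δ, hδ, fun i hi ↦ (Metric.cthickening_mono (hle.1 i hi) _).trans (hsub₁ i),
    fun i hi j hj x hx hfx z hz ↦ ?_⟩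
  refine (hsub₂ i j (Metric.cthickening_mono (hle.2 i hi j hj) _ ?_)).2
  exact Metric.mem_cthickening_of_dist_le z (φ i x) δ _ ⟨x, ⟨hx, hfx⟩, rfl⟩
    (Metric.mem_ball.1 hz).le

end UniformRadius

/-! ### Contraction forces affine integrability -/

section Dynamics

variable {n : ℕ} {M : Type*} [TopologicalSpace M] [T2Space M] [CompactSpace M]
  [ChartedSpace (Euc n) M] [IsManifold (𝓡 n) ∞ M]

/-- A finite family of affine charts, with a compact cover of the manifold. -/
theorem exists_finite_affine_cover {D : Connection n M} (hD : IsAffineStructure D) :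
    ∃ (φ : M → OpenPartialHomeomorph M (Euc n)) (K : M → Set M) (t : Finset M),
      (∀ i, IsAffineChart D (φ i)) ∧ (∀ i, IsCompact (K i)) ∧ (∀ i, K i ⊆ (φ i).source) ∧
      ∀ x, ∃ i ∈ t, x ∈ interior (K i) := by
  choose φ hφ hxφ using exists_isAffineChart hD
  have hK : ∀ x, ∃ K : Set M, IsCompact K ∧ x ∈ interior K ∧ K ⊆ (φ x).source := fun x ↦
    exists_compact_subset (φ x).open_source (hxφ x)
  choose K hK hxK hKφ using hK
  obtain ⟨t, ht⟩ := isCompact_univ.elim_finite_subcover (fun x ↦ interior (K x))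
    (fun x ↦ isOpen_interior) (fun x _ ↦ mem_iUnion.2 ⟨x, hxK x⟩)
  refine ⟨φ, K, t, hφ, hK, hKφ, fun x ↦ ?_⟩
  simpa using ht (mem_univ x)

/-- A distribution which consists of the vectors contracted by an affine diffeomorphism is constant
along its affine integral subspaces, in affine charts. -/
theorem isAffinelyIntegrable_of_contracted {D : Connection n M} (hD : IsAffineStructure D)
    {f : M ≃ₘ^∞⟮𝓡 n, 𝓡 n⟯ M} (hf : IsAffineDiffeo D f) {E : Distribution n M}
    (hE : IsContinuousSubbundle E)
    (g : Bundle.ContMDiffRiemannianMetric (𝓡 n) ∞ (Euc n) (TangentSpace (𝓡 n) : M → Type _))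
    {c lam : ℝ} (hc : 0 < c) (hlam : 0 < lam) (hlam1 : lam < 1)
    (hcontr : ∀ (m : ℕ) (x : M), ∀ v ∈ E x,
      gnorm g (mfderiv (𝓡 n) (𝓡 n) (⇑f)^[m] x v) ≤ c * lam ^ m * gnorm g v)
    (hdetect : ∀ (x : M) (v : TangentSpace (𝓡 n) x),
      Tendsto (fun m : ℕ ↦ gnorm g (mfderiv (𝓡 n) (𝓡 n) (⇑f)^[m] x v)) atTop (𝓝 0) → v ∈ E x) :
    IsAffinelyIntegrable D E := by
  obtain ⟨φ, K, t, hφ, hK, hKφ, hcov⟩ := exists_finite_affine_cover hD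
  obtain ⟨δ, hδ, hδt, hδf⟩ := exists_uniform_radius f φ K t hK hKφ
  obtain ⟨C, hC, hCg⟩ : ∃ C : ℝ, 0 < C ∧ ∀ i ∈ t, ∀ z ∈ Metric.cthickening δ (φ i '' K i),
      ∀ v : TangentSpace (𝓡 n) ((φ i).symm z),
        ‖chartDeriv (φ i) ((φ i).symm z) v‖ ≤ C * gnorm g v ∧
        gnorm g v ≤ C * ‖chartDeriv (φ i) ((φ i).symm z) v‖ := by
    have h : ∀ i, ∃ C : ℝ, 0 < C ∧ (i ∈ t → ∀ z ∈ Metric.cthickening δ (φ i '' K i),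
      ∀ v : TangentSpace (𝓡 n) ((φ i).symm z),
        ‖chartDeriv (φ i) ((φ i).symm z) v‖ ≤ C * gnorm g v ∧
        gnorm g v ≤ C * ‖chartDeriv (φ i) ((φ i).symm z) v‖) := fun i ↦ by
      by_cases hi : i ∈ t
      · have hc := ((hK i).image_of_continuousOn ((φ i).continuousOn.mono (hKφ i))).cthickening
          (r := δ)
        obtain ⟨C, hC, h⟩ := exists_gnorm_comparison g (hφ i).1 hc (hδt i hi)
        exact ⟨C, hC, fun _ ↦ h⟩
      · exact ⟨1, one_pos, fun h ↦ absurd h hi⟩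
    choose C hC h using h
    -- The sum dominates every `C i`; adding 1 keeps it positive when `t` is empty.
    refine ⟨∑ i ∈ t, C i + 1, by have := Finset.sum_nonneg fun i (_ : i ∈ t) ↦ (hC i).le; positivity,
      fun i hi z hz v ↦ ?_⟩
    have hle : C i ≤ ∑ i ∈ t, C i + 1 := by
      have := Finset.single_le_sum (fun i _ ↦ (hC i).le) hi
      linarith
    obtain ⟨h1, h2⟩ := h i hi z hz v
    exact ⟨h1.trans (mul_le_mul_of_nonneg_right hle (gnorm_nonneg g _)),
      h2.trans (mul_le_mul_of_nonneg_right hle (norm_nonneg _))⟩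
  -- the comparison, at points of the charts
  have hCg' : ∀ i ∈ t, ∀ x ∈ K i, ∀ y ∈ (φ i).source, φ i y ∈ Metric.ball (φ i x) δ →
      ∀ v : TangentSpace (𝓡 n) y, ‖chartDeriv (φ i) y v‖ ≤ C * gnorm g v ∧
        gnorm g v ≤ C * ‖chartDeriv (φ i) y v‖ := by
    intro i hi x hx y hy hyb
    have h := hCg i hi (φ i y) (Metric.mem_cthickening_of_dist_le _ _ _ _
      ⟨x, hx, rfl⟩ (Metric.mem_ball.1 hyb).le)
    rwa [(φ i).left_inv hy] at h
  -- the iterates are affine along the orbit of a small vector of `E`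
  have track : ∀ (x y : M) (idx : ℕ → M), (∀ m, idx m ∈ t) → (∀ m, f^[m] x ∈ K (idx m)) →
      y ∈ (φ (idx 0)).source → ∀ v ∈ E x, C * (c * gnorm g v) < δ →
      φ (idx 0) y = φ (idx 0) x + chartDeriv (φ (idx 0)) x v → ∀ m : ℕ,
      ∃ L : Euc n →L[ℝ] Euc n,
        (∀ w : TangentSpace (𝓡 n) x, chartDeriv (φ (idx m)) (f^[m] x)
          (mfderiv (𝓡 n) (𝓡 n) f^[m] x w) = L (chartDeriv (φ (idx 0)) x w)) ∧
        (∀ w : TangentSpace (𝓡 n) y, chartDeriv (φ (idx m)) (f^[m] y)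
          (mfderiv (𝓡 n) (𝓡 n) f^[m] y w) = L (chartDeriv (φ (idx 0)) y w)) ∧
        f^[m] y ∈ (φ (idx m)).source ∧ φ (idx m) (f^[m] y) ∈ Metric.ball (φ (idx m) (f^[m] x)) δ ∧
        φ (idx m) (f^[m] y) = φ (idx m) (f^[m] x) + L (chartDeriv (φ (idx 0)) x v) := by
    intro x y idx hidx hxK hy v hv hsmall hyx m
    -- The displacement at time `m` is the image of `v`, of metric norm at most `c * lam ^ m * gnorm
    -- g v`, so the smallness of `v` keeps both orbits within distance `δ` in the chart.
    have hball : ∀ m (L : Euc n →L[ℝ] Euc n), (∀ w : TangentSpace (𝓡 n) x,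
        chartDeriv (φ (idx m)) (f^[m] x) (mfderiv (𝓡 n) (𝓡 n) f^[m] x w) =
          L (chartDeriv (φ (idx 0)) x w)) →
        φ (idx m) (f^[m] y) = φ (idx m) (f^[m] x) + L (chartDeriv (φ (idx 0)) x v) →
        φ (idx m) (f^[m] y) ∈ Metric.ball (φ (idx m) (f^[m] x)) δ := by
      intro m L hL hLy
      rw [hLy, mem_ball_iff_norm, add_sub_cancel_left, ← hL]
      have h1 := (hCg' (idx m) (hidx m) _ (hxK m) _ (hKφ _ (hxK m)) (Metric.mem_ball_self hδ)
        (mfderiv (𝓡 n) (𝓡 n) f^[m] x v)).1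
      refine h1.trans_lt (lt_of_le_of_lt ?_ hsmall)
      gcongr
      refine (hcontr m x v hv).trans ?_
      rw [mul_right_comm]
      exact mul_le_of_le_one_right (mul_nonneg hc.le (gnorm_nonneg g v))
        (pow_le_one₀ hlam.le hlam1.le)
    induction m with
    | zero =>
      have h0 : ∀ (p : M), mfderiv (𝓡 n) (𝓡 n) f^[0] p = ContinuousLinearMap.id ℝ _ := fun p ↦
        mfderiv_id
      have h1 : ∀ w : TangentSpace (𝓡 n) x, chartDeriv (φ (idx 0)) (f^[0] x)
          (mfderiv (𝓡 n) (𝓡 n) f^[0] x w) =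
            ContinuousLinearMap.id ℝ (Euc n) (chartDeriv (φ (idx 0)) x w) := fun w ↦ by
        rw [h0]; rfl
      exact ⟨ContinuousLinearMap.id ℝ _, h1, fun w ↦ by rw [h0]; rfl, hy, hball 0 _ h1 hyx, hyx⟩
    | succ m ih =>
      obtain ⟨L, hLx, hLy, hys, hyb, hyL⟩ := ih
      have hx1 := hxK (m + 1)
      rw [Function.iterate_succ_apply'] at hx1
      set i := idx m
      set j := idx (m + 1)
      have hxs := hKφ i (hxK m)
      have hzt : ∀ z ∈ Metric.ball (φ i (f^[m] x)) δ, z ∈ (φ i).target := fun z hz ↦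
        hδt i (hidx m) (Metric.mem_cthickening_of_dist_le z _ δ _ ⟨_, hxK m, rfl⟩
          (Metric.mem_ball.1 hz).le)
      have hfz := hδf i (hidx m) j (hidx (m + 1)) _ (hxK m) hx1
      -- Both `f^[m] x` and `f^[m] y` lie in a ball on which `f` has one linear part `A`, which
      -- extends `L` to the next iterate at both points.
      obtain ⟨A, -, hA2, hA3⟩ := hf.affine_in_charts (hφ i) (hφ j) Metric.isOpen_ball
        (convex_ball _ _) hzt hfz
      have hA2' : ∀ p ∈ (φ i).source, φ i p ∈ Metric.ball (φ i (f^[m] x)) δ →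
          ∀ w : TangentSpace (𝓡 n) p, chartDeriv (φ j) (f p) (mfderiv (𝓡 n) (𝓡 n) f p w) =
            A (chartDeriv (φ i) p w) := fun p hp hpb ↦ by
        have := hA2 (φ i p) hpb
        rwa [(φ i).left_inv hp] at this
      have hself := Metric.mem_ball_self (x := φ i (f^[m] x)) hδ
      have e1 : ∀ w : TangentSpace (𝓡 n) x, chartDeriv (φ j) (f^[m + 1] x)
          (mfderiv (𝓡 n) (𝓡 n) f^[m + 1] x w) = (A ∘L L) (chartDeriv (φ (idx 0)) x w) := fun w ↦ by
        rw [Function.iterate_succ', mfderiv_iterate_succ, ContinuousLinearMap.comp_apply,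
          ContinuousLinearMap.comp_apply, ← hLx]
        exact hA2' _ hxs hself _
      have e2 : φ j (f^[m + 1] y) = φ j (f^[m + 1] x) + (A ∘L L) (chartDeriv (φ (idx 0)) x v) := by
        have h := hA3 _ hself _ hyb
        rw [(φ i).left_inv hxs, (φ i).left_inv hys, hyL, add_sub_cancel_left] at h
        rw [Function.iterate_succ_apply', Function.iterate_succ_apply',
          ContinuousLinearMap.comp_apply, ← h]
        abel
      refine ⟨A ∘L L, e1, fun w ↦ ?_, ?_, hball (m + 1) _ e1 e2, e2⟩
      · rw [Function.iterate_succ', mfderiv_iterate_succ, ContinuousLinearMap.comp_apply,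
          ContinuousLinearMap.comp_apply, ← hLy]
        exact hA2' _ hys hyb _
      · have := hfz _ hyb
        rwa [(φ i).left_inv hys, ← Function.iterate_succ_apply' f m y] at this
  intro x₀
  obtain ⟨i, hi, hxi⟩ := hcov x₀
  have hx₀ : x₀ ∈ (φ i).source := hKφ i (interior_subset hxi)
  obtain ⟨ρ₁, hρ₁, hball₁⟩ := Metric.isOpen_iff.1
    ((φ i).isOpen_image_of_subset_source isOpen_interior (interior_subset.trans (hKφ i)))
    (φ i x₀) ⟨x₀, hxi, rfl⟩
  obtain ⟨ρ₂, hρ₂, hball₂⟩ := Metric.eventually_nhds_iff_ball.1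
    (((φ i).continuousAt_symm ((φ i).map_source hx₀)).eventually
      (by rw [(φ i).left_inv hx₀]; exact hE.eventually_finrank x₀))
  -- `ρ₁` keeps base points in `K i`, and `ρ₂` keeps the rank constant. Points of the ball differ by
  -- less than `2 * ρ`, so the metric norm of the displacement is at most `2 * C * ρ`, and the third
  -- bound makes it small enough for `track`.
  let ρ := min (min ρ₁ ρ₂) (δ / (2 * (C * (c * C) + 1)))
  have hρ : 0 < ρ := by positivity
  have hρt : Metric.ball (φ i x₀) ρ ⊆ φ i '' interior (K i) :=
    (Metric.ball_subset_ball ((min_le_left _ _).trans (min_le_left _ _))).trans hball₁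
  have hρt' : Metric.ball (φ i x₀) ρ ⊆ (φ i).target := fun z hz ↦ by
    obtain ⟨x, hx, rfl⟩ := hρt hz
    exact (φ i).map_source (hKφ i (interior_subset hx))
  refine ⟨φ i, hφ i, hx₀, ρ, hρ, hρt', fun z hz u hu hzu ↦ ?_⟩
  have hdim : Module.finrank ℝ (distIn (φ i) E (z + u)) = Module.finrank ℝ (distIn (φ i) E z) := by
    have hsub : Metric.ball (φ i x₀) ρ ⊆ Metric.ball (φ i x₀) ρ₂ :=
      Metric.ball_subset_ball ((min_le_left _ _).trans (min_le_right _ _))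
    rw [finrank_distIn (hφ i).1 E (hρt' hzu), finrank_distIn (hφ i).1 E (hρt' hz),
      hball₂ _ (hsub hzu), hball₂ _ (hsub hz)]
  -- Since the ranks agree, it suffices that every vector of `E` at the first point, with the same
  -- components at the second, lies in `E` there.
  symm
  apply Submodule.eq_of_le_of_finrank_eq _ hdim.symm
  intro a ha
  obtain ⟨x, hxK', rfl⟩ := hρt hz
  have hxK := interior_subset hxK'
  have hxs := hKφ i hxK
  rw [mem_distIn, (φ i).left_inv hxs] at hu ha
  obtain ⟨v, hv, rfl⟩ := hu
  obtain ⟨w, hw, rfl⟩ := ha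
  have hys := (φ i).map_target (hρt' hzu)
  have hyv := (φ i).right_inv (hρt' hzu)
  set y := (φ i).symm (φ i x + chartDeriv (φ i) x v)
  obtain ⟨w', hw'⟩ := (chartDeriv_bijective (hφ i).1 hys).2 (chartDeriv (φ i) x w)
  rw [mem_distIn]
  refine ⟨w', hdetect y w' ?_, hw'⟩
  choose ind hind hxind using hcov
  -- An itinerary of the orbit of `x` through the charts. At time 0 it must be the chart `i`, in
  -- which `x` and `y` are compared.
  let idx : ℕ → M := fun m ↦ if m = 0 then i else ind (f^[m] x)
  have hidx : ∀ m, idx m ∈ t := fun m ↦ by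
    by_cases hm : m = 0 <;> simp [idx, hm, hi, hind]
  have hidxK : ∀ m, f^[m] x ∈ K (idx m) := fun m ↦ by
    rcases eq_or_ne m 0 with rfl | hm
    · simpa [idx] using hxK
    · simpa [idx, hm] using interior_subset (hxind (f^[m] x))
  have hidx0 : idx 0 = i := by simp [idx]
  have hnorm : ‖chartDeriv (φ i) x v‖ < 2 * ρ := by
    have h1 := dist_triangle_right (φ i x + chartDeriv (φ i) x v) (φ i x) (φ i x₀)
    have h2 : dist (φ i x + chartDeriv (φ i) x v) (φ i x) = ‖chartDeriv (φ i) x v‖ := by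
      rw [dist_eq_norm, add_sub_cancel_left]
    rw [Metric.mem_ball] at hz hzu
    linarith
  have hsmall : C * (c * gnorm g v) < δ := by
    have h1 := (hCg' i hi x hxK x hxs (Metric.mem_ball_self hδ) v).2
    have h2 : ρ ≤ δ / (2 * (C * (c * C) + 1)) := min_le_right _ _
    rw [le_div_iff₀ (by positivity)] at h2
    calc C * (c * gnorm g v) ≤ C * (c * (C * (2 * ρ))) := by gcongr; exact h1.trans (by gcongr)
      _ = 2 * (C * (c * C)) * ρ := by ring
      _ < δ := by nlinarith
  have htr := track x y idx hidx hidxK (by rwa [hidx0]) v hv hsmall (by rwa [hidx0])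
  -- `w'` and `w` have the same components and the iterates the same linear part, so the images have
  -- the same chart components; comparing norms at `y` and at `x` costs one factor `C` each.
  have hbound : ∀ m : ℕ, gnorm g (mfderiv (𝓡 n) (𝓡 n) (⇑f)^[m] y w') ≤
      (C * (C * (c * gnorm g w))) * lam ^ m := by
    intro m
    obtain ⟨L, hLx, hLy, hys', hyb, -⟩ := htr m
    have h1 := (hCg' (idx m) (hidx m) _ (hidxK m) _ hys' hyb (mfderiv (𝓡 n) (𝓡 n) f^[m] y w')).2
    have h2 := (hCg' (idx m) (hidx m) _ (hidxK m) _ (hKφ _ (hidxK m)) (Metric.mem_ball_self hδ)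
      (mfderiv (𝓡 n) (𝓡 n) f^[m] x w)).1
    rw [hidx0] at hLx hLy
    rw [hLy, hw', ← hLx] at h1
    have h3 := hcontr m x w hw
    calc _ ≤ _ := h1
      _ ≤ C * (C * (c * lam ^ m * gnorm g w)) := by gcongr; exact h2.trans (by gcongr)
      _ = _ := by ring
  refine squeeze_zero (fun m ↦ gnorm_nonneg g _) hbound ?_
  simpa using (tendsto_pow_atTop_nhds_zero_of_lt_one hlam.le hlam1).const_mul
    (C * (C * (c * gnorm g w)))

end Dynamics

/-! ### Straightening a field of subspaces -/

section SliceCharts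

/-- Straightening of a field of graphs `{(a, L a)}` which is constant along these graphs. -/
theorem exists_slice_chart {P Q : Type*} [NormedAddCommGroup P] [NormedSpace ℝ P]
    [NormedAddCommGroup Q] [NormedSpace ℝ Q] (L : P × Q → P →L[ℝ] Q) {r : ℝ} (hr : 0 < r)
    (hL : ContinuousOn L (Metric.ball 0 r))
    (hconst : ∀ w ∈ Metric.ball (0 : P × Q) r, ∀ a : P, w + (a, L w a) ∈ Metric.ball 0 r →
      L (w + (a, L w a)) = L w) :
    ∃ ψ : OpenPartialHomeomorph (P × Q) (P × Q), 0 ∈ ψ.source ∧ ψ.source ⊆ Metric.ball 0 r ∧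
      ∀ y ∈ ψ.source, ∀ z ∈ ψ.source, (ψ y).2 = (ψ z).2 ↔ (z - y).2 = L y (z - y).1 := by
  have hmem : ∀ a : P, ∀ b : Q, (a, b) ∈ Metric.ball (0 : P × Q) r ↔ ‖a‖ < r ∧ ‖b‖ < r :=
    fun a b ↦ by rw [mem_ball_zero_iff, Prod.norm_def, max_lt_iff]
  -- Sliding along the slice through `(a, b)` back to the transversal `{0} × Q` does not change `L`;
  -- `h2` is the reverse motion.
  have h1 : ∀ a b, (a, b) ∈ Metric.ball (0 : P × Q) r → ‖b - L (a, b) a‖ < r →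
      L (0, b - L (a, b) a) = L (a, b) := fun a b hab ht ↦ by
    have h := hconst (a, b) hab (-a)
    have e : (a, b) + (-a, L (a, b) (-a)) = (0, b - L (a, b) a) := by
      simp [sub_eq_add_neg]
    rw [e] at h
    exact h ((hmem _ _).2 ⟨by simpa using hr, ht⟩)
  have h2 : ∀ a t, ‖t‖ < r → (a, t + L (0, t) a) ∈ Metric.ball (0 : P × Q) r →
      L (a, t + L (0, t) a) = L (0, t) := fun a t ht hat ↦ by
    have h := hconst (0, t) ((hmem _ _).2 ⟨by simpa using hr, ht⟩) a
    have e : ((0 : P), t) + (a, L (0, t) a) = (a, t + L (0, t) a) := by simp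
    rw [e] at h
    exact h hat
  have hLt : ContinuousOn (fun w : P × Q ↦ L (0, w.2)) (Metric.ball 0 r) :=
    hL.comp (by fun_prop) fun w hw ↦ (hmem _ _).2 ⟨by simpa using hr, ((hmem w.1 w.2).1 hw).2⟩
  have hc1 : ContinuousOn (fun w : P × Q ↦ w.2 - L w w.1) (Metric.ball 0 r) :=
    continuousOn_snd.sub (hL.clm_apply continuousOn_fst)
  have hc2 : ContinuousOn (fun w : P × Q ↦ w.2 + L (0, w.2) w.1) (Metric.ball 0 r) :=
    continuousOn_snd.add (hLt.clm_apply continuousOn_fst)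
  -- The second coordinate becomes the height at which the slice meets the transversal. This height
  -- determines `L` on the slice, whence the explicit inverse.
  let ψ : OpenPartialHomeomorph (P × Q) (P × Q) :=
    { toFun := fun w ↦ (w.1, w.2 - L w w.1)
      invFun := fun w ↦ (w.1, w.2 + L (0, w.2) w.1)
      source := Metric.ball 0 r ∩ (fun w : P × Q ↦ w.2 - L w w.1) ⁻¹' Metric.ball 0 r
      target := Metric.ball 0 r ∩ (fun w : P × Q ↦ w.2 + L (0, w.2) w.1) ⁻¹' Metric.ball 0 r
      map_source' := by
        rintro ⟨a, b⟩ ⟨hab, ht⟩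
        simp only [mem_preimage, mem_ball_zero_iff] at ht
        have hab' := (hmem _ _).1 hab
        refine ⟨(hmem _ _).2 ⟨hab'.1, ht⟩, ?_⟩
        simpa only [mem_preimage, h1 a b hab ht, sub_add_cancel, mem_ball_zero_iff] using hab'.2
      map_target' := by
        rintro ⟨a, t⟩ ⟨hat, hb⟩
        simp only [mem_preimage, mem_ball_zero_iff] at hb
        have hat' := (hmem _ _).1 hat
        have hab := (hmem _ _).2 ⟨hat'.1, hb⟩
        refine ⟨hab, ?_⟩
        simpa only [mem_preimage, h2 a t hat'.2 hab, add_sub_cancel_right, mem_ball_zero_iff]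
          using hat'.2
      left_inv' := by
        rintro ⟨a, b⟩ ⟨hab, ht⟩
        simp only [mem_preimage, mem_ball_zero_iff] at ht
        simp only [h1 a b hab ht, sub_add_cancel]
      right_inv' := by
        rintro ⟨a, t⟩ ⟨hat, hb⟩
        simp only [mem_preimage, mem_ball_zero_iff] at hb
        have hat' := (hmem _ _).1 hat
        simp only [h2 a t hat'.2 ((hmem _ _).2 ⟨hat'.1, hb⟩), add_sub_cancel_right]
      open_source := hc1.isOpen_inter_preimage Metric.isOpen_ball Metric.isOpen_ball
      open_target := hc2.isOpen_inter_preimage Metric.isOpen_ball Metric.isOpen_ball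
      continuousOn_toFun := (continuousOn_fst.prodMk hc1).mono inter_subset_left
      continuousOn_invFun := (continuousOn_fst.prodMk hc2).mono inter_subset_left }
  refine ⟨ψ, ⟨by simpa using hr, by simpa using hr⟩, inter_subset_left, ?_⟩
  rintro ⟨a, b⟩ ⟨hab, ht⟩ ⟨a', b'⟩ ⟨hab', ht'⟩
  simp only [mem_preimage, mem_ball_zero_iff] at ht ht'
  change b - L (a, b) a = b' - L (a', b') a' ↔ b' - b = L (a, b) (a' - a)
  constructor
  · intro h
    have hLL : L (a', b') = L (a, b) := by rw [← h1 a b hab ht, ← h1 a' b' hab' ht', h]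
    rw [hLL] at h
    rw [map_sub, sub_eq_sub_iff_add_eq_add]
    rw [sub_eq_sub_iff_add_eq_add] at h
    rw [← h, add_comm]
  · intro h
    have e : (a, b) + (a' - a, L (a, b) (a' - a)) = (a', b') := by rw [← h]; simp
    have hLL := hconst (a, b) hab (a' - a)
    rw [e] at hLL
    rw [hLL hab', eq_add_of_sub_eq h, map_sub]
    abel

/-- An injective linear map extends to a linear equivalence from a product. -/
theorem exists_equiv_extending {k n : ℕ} (A : Euc k →L[ℝ] Euc n) (hA : Function.Injective A) :
    ∃ q, k + q = n ∧ ∃ Θ : (Euc k × Euc q) ≃L[ℝ] Euc n, ∀ a, Θ (a, 0) = A a := by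
  let S := LinearMap.range A.toLinearMap
  have hrank : Module.finrank ℝ S = k := by
    rw [LinearMap.finrank_range_of_inj hA, finrank_euclideanSpace_fin]
  obtain ⟨T, hT⟩ := Submodule.exists_isCompl S
  have h := Submodule.finrank_add_eq_of_isCompl hT
  rw [hrank, finrank_euclideanSpace_fin] at h
  refine ⟨Module.finrank ℝ T, h, ?_⟩
  let B : Euc (Module.finrank ℝ T) →L[ℝ] Euc n := T.subtypeL ∘L (ContinuousLinearEquiv.ofFinrankEq
    finrank_euclideanSpace_fin : Euc _ ≃L[ℝ] T).toContinuousLinearMap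
  have hB_inj : Function.Injective B :=
    Subtype.val_injective.comp (ContinuousLinearEquiv.injective _)
  have hB_mem : ∀ b, B b ∈ T := fun b ↦ Subtype.property _
  have hΘ_inj : Function.Injective (A.coprod B) := by
    rw [injective_iff_map_eq_zero]
    rintro ⟨a, b⟩ hab
    have h : A a + B b = 0 := hab
    have h1 : A a = 0 := by
      refine Submodule.disjoint_def.1 hT.disjoint _ ⟨a, rfl⟩ ?_
      rw [eq_neg_of_add_eq_zero_left h]
      exact T.neg_mem (hB_mem b)
    rw [h1, zero_add] at h
    rw [Prod.mk_eq_zero]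
    exact ⟨hA (by rw [h1, map_zero]), hB_inj (by rw [h, map_zero])⟩
  refine ⟨(LinearEquiv.ofInjectiveOfFinrankEq (A.coprod B).toLinearMap hΘ_inj
    (by simp [h])).toContinuousLinearEquiv, fun a ↦ ?_⟩
  change A a + B 0 = A a
  rw [map_zero, add_zero]

/-- A field of subspaces with a continuous frame which is constant along its own slices can be
straightened by a foliated chart. -/
theorem exists_foliated_coordinates {n k : ℕ} (F : Euc n → Submodule ℝ (Euc n))
    (s : Fin k → Euc n → Euc n) {z₀ : Euc n} {ρ : ℝ} (hρ : 0 < ρ)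
    (hs : ∀ i, ContinuousOn (s i) (Metric.ball z₀ ρ))
    (hli : ∀ z ∈ Metric.ball z₀ ρ, LinearIndependent ℝ fun i ↦ s i z)
    (hspan : ∀ z ∈ Metric.ball z₀ ρ, Submodule.span ℝ (range fun i ↦ s i z) = F z)
    (hconst : ∀ z ∈ Metric.ball z₀ ρ, ∀ u ∈ F z, z + u ∈ Metric.ball z₀ ρ → F (z + u) = F z) :
    ∃ (q : ℕ) (_ : k + q = n) (ψ : OpenPartialHomeomorph (Euc n) (Euc k × Euc q)),
      z₀ ∈ ψ.source ∧ ψ.source ⊆ Metric.ball z₀ ρ ∧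
      ∀ y ∈ ψ.source, ∀ z ∈ ψ.source, (ψ y).2 = (ψ z).2 ↔ z - y ∈ F y := by
  have hz₀ : z₀ ∈ Metric.ball z₀ ρ := Metric.mem_ball_self hρ
  -- the frame as a family of linear maps
  let σ : Euc n → Euc k →L[ℝ] Euc n := fun z ↦
    ∑ i, (EuclideanSpace.proj i : Euc k →L[ℝ] ℝ).smulRight (s i z)
  have hσ_apply : ∀ z a, σ z a = ∑ i, a i • s i z := fun z a ↦ by simp [σ]
  have hσ_cont : ContinuousOn σ (Metric.ball z₀ ρ) := by
    refine continuousOn_finsetSum _ fun i _ ↦ ?_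
    exact (ContinuousLinearMap.smulRightL ℝ (Euc k) (Euc n)
      (EuclideanSpace.proj i : Euc k →L[ℝ] ℝ)).continuous.comp_continuousOn (hs i)
  have hσ_range : ∀ z ∈ Metric.ball z₀ ρ, ∀ u, u ∈ F z ↔ ∃ a, σ z a = u := fun z hz u ↦ by
    rw [← hspan z hz, Submodule.mem_span_range_iff_exists_fun]
    constructor
    · rintro ⟨c, hc⟩
      exact ⟨WithLp.toLp 2 c, by rw [hσ_apply]; exact hc⟩
    · rintro ⟨a, ha⟩
      exact ⟨fun i ↦ a i, by rw [← hσ_apply]; exact ha⟩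
  have hσ_inj : Function.Injective (σ z₀) := by
    rw [injective_iff_map_eq_zero]
    intro a ha
    rw [hσ_apply] at ha
    ext i
    exact Fintype.linearIndependent_iff.1 (hli z₀ hz₀) (fun i ↦ a i) ha i
  obtain ⟨q, hq, Θ, hΘ⟩ := exists_equiv_extending (σ z₀) hσ_inj
  -- graphs
  let pr₁ : Euc n →L[ℝ] Euc k := ContinuousLinearMap.fst ℝ _ _ ∘L Θ.symm.toContinuousLinearMap
  let pr₂ : Euc n →L[ℝ] Euc q := ContinuousLinearMap.snd ℝ _ _ ∘L Θ.symm.toContinuousLinearMap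
  have hdecomp : ∀ u, Θ (pr₁ u, pr₂ u) = u := fun u ↦ Θ.apply_symm_apply u
  have hid : pr₁ ∘L σ z₀ = ContinuousLinearMap.id ℝ _ := by
    ext1 a
    change (Θ.symm (σ z₀ a)).1 = a
    have : Θ.symm (σ z₀ a) = (a, 0) := by
      rw [ContinuousLinearEquiv.symm_apply_eq, hΘ]
    rw [this]
  have hτ : ContinuousOn (fun z ↦ pr₁ ∘L σ z) (Metric.ball z₀ ρ) :=
    continuousOn_const.clm_comp hσ_cont
  -- At `z₀` this composite is the identity and units are open, so nearby subspaces stay graphs over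
  -- the first factor.
  have hunits : {z | z ∈ Metric.ball z₀ ρ → IsUnit (pr₁ ∘L σ z)} ∈ 𝓝 z₀ := by
    have h1 : ContinuousAt (fun z ↦ pr₁ ∘L σ z) z₀ := hτ.continuousAt (Metric.ball_mem_nhds _ hρ)
    have h2 : ∀ᶠ z in 𝓝 z₀, (pr₁ ∘L σ z) ∈ {x : Euc k →L[ℝ] Euc k | IsUnit x} := by
      refine h1.eventually (Units.isOpen.mem_nhds ?_)
      change IsUnit (pr₁ ∘L σ z₀)
      rw [hid]
      exact isUnit_one
    filter_upwards [h2] with z hz _ using hz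
  obtain ⟨ρ', hρ', hball⟩ := Metric.mem_nhds_iff.1 hunits
  let N : Set (Euc n) := Metric.ball z₀ (min ρ ρ')
  have hNρ : N ⊆ Metric.ball z₀ ρ := Metric.ball_subset_ball (min_le_left _ _)
  have hNu : ∀ z ∈ N, IsUnit (pr₁ ∘L σ z) := fun z hz ↦
    hball (Metric.ball_subset_ball (min_le_right _ _) hz) (hNρ hz)
  -- Reparametrising the frame by its first component gives the slope of the graph.
  let Λ : Euc n → Euc k →L[ℝ] Euc q := fun z ↦ (pr₂ ∘L σ z) ∘L Ring.inverse (pr₁ ∘L σ z)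
  have hΛ_cont : ContinuousOn Λ N := by
    refine (continuousOn_const.clm_comp (hσ_cont.mono hNρ)).clm_comp fun z hz ↦ ?_
    obtain ⟨u, hu⟩ := hNu z hz
    have h1 : ContinuousAt Ring.inverse (pr₁ ∘L σ z) := by
      rw [← hu]; exact NormedRing.inverse_continuousAt u
    exact ContinuousAt.comp_continuousWithinAt (g := Ring.inverse) h1 (hτ.mono hNρ z hz)
  have hΛ : ∀ z ∈ N, ∀ a b, Θ (a, b) ∈ F z ↔ b = Λ z a := fun z hz a b ↦ by
    have hu := hNu z hz
    have hr : ∀ x, pr₁ (σ z (Ring.inverse (pr₁ ∘L σ z) x)) = x := fun x ↦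
      DFunLike.congr_fun (Ring.mul_inverse_cancel _ hu) x
    have hl : ∀ x, Ring.inverse (pr₁ ∘L σ z) (pr₁ (σ z x)) = x := fun x ↦
      DFunLike.congr_fun (Ring.inverse_mul_cancel _ hu) x
    rw [hσ_range z (hNρ hz)]
    constructor
    · rintro ⟨x, hx⟩
      have h1 : pr₁ (σ z x) = a := by
        rw [hx]; exact congrArg Prod.fst (Θ.symm_apply_apply (a, b))
      have h2 : pr₂ (σ z x) = b := by
        rw [hx]; exact congrArg Prod.snd (Θ.symm_apply_apply (a, b))
      change b = pr₂ (σ z (Ring.inverse (pr₁ ∘L σ z) a))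
      rw [← h1, hl, h2]
    · intro hb
      refine ⟨Ring.inverse (pr₁ ∘L σ z) a, ?_⟩
      rw [← hdecomp (σ z _), hr, hb]
      rfl
  -- coordinates centred at `z₀`
  let θ : Euc k × Euc q ≃ₜ Euc n := Θ.toHomeomorph.trans (Homeomorph.addLeft z₀)
  have hθ : ∀ w, θ w = z₀ + Θ w := fun w ↦ rfl
  obtain ⟨r, hr, hrN⟩ : ∃ r > 0, Metric.ball (0 : Euc k × Euc q) r ⊆ θ ⁻¹' N := by
    refine Metric.mem_nhds_iff.1 (θ.continuous.continuousAt.preimage_mem_nhds ?_)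
    rw [hθ, map_zero, add_zero]
    exact Metric.ball_mem_nhds _ (lt_min hρ hρ')
  obtain ⟨ψ, h0, hψr, hψ⟩ := exists_slice_chart (fun w ↦ Λ (θ w)) hr
    (hΛ_cont.comp θ.continuous.continuousOn hrN) (fun w hw a hwa ↦ by
      have hu : Θ (a, Λ (θ w) a) ∈ F (θ w) := (hΛ _ (hrN hw) _ _).2 rfl
      have e : θ (w + (a, Λ (θ w) a)) = θ w + Θ (a, Λ (θ w) a) := by
        rw [hθ, hθ, map_add, add_assoc]
      have hF : F (θ (w + (a, Λ (θ w) a))) = F (θ w) := by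
        rw [e]
        exact hconst _ (hNρ (hrN hw)) _ hu (by rw [← e]; exact hNρ (hrN hwa))
      ext1 x
      have := (hΛ _ (hrN hwa) x (Λ (θ w) x)).1
        (by rw [hF]; exact (hΛ _ (hrN hw) _ _).2 rfl)
      exact this.symm)
  refine ⟨q, hq, θ.symm.toOpenPartialHomeomorph.trans ψ, ?_, ?_, ?_⟩
  · rw [OpenPartialHomeomorph.trans_source]
    refine ⟨mem_univ _, ?_⟩
    change θ.symm z₀ ∈ ψ.source
    rw [(Homeomorph.symm_apply_eq θ).2 (show z₀ = θ 0 by rw [hθ, map_zero, add_zero])]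
    exact h0
  · intro z hz
    rw [OpenPartialHomeomorph.trans_source] at hz
    have := hNρ (hrN (hψr hz.2))
    simpa using this
  · intro y hy z hz
    rw [OpenPartialHomeomorph.trans_source] at hy hz
    have key := hψ _ hy.2 _ hz.2
    change ((ψ (θ.symm y)).2 = (ψ (θ.symm z)).2) ↔ _
    refine key.trans ?_
    change (θ.symm z - θ.symm y).2 = Λ (θ (θ.symm y)) (θ.symm z - θ.symm y).1 ↔ _
    have hyN : θ (θ.symm y) ∈ N := hrN (hψr hy.2)
    rw [← hΛ _ hyN, Prod.mk.eta, map_sub, θ.apply_symm_apply]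
    have e : ∀ w, Θ (θ.symm w) = w - z₀ := fun w ↦ by
      rw [eq_sub_iff_add_eq', ← hθ, θ.apply_symm_apply]
    rw [e, e, sub_sub_sub_cancel_right]

end SliceCharts

/-! ### The slice foliation and its leaf topology -/

section Foliations

variable {n : ℕ} {M : Type*} [TopologicalSpace M] [ChartedSpace (Euc n) M]

theorem distIn_apply {φ : OpenPartialHomeomorph M (Euc n)} (E : Distribution n M) {x : M}
    (hx : x ∈ φ.source) : distIn φ E (φ x) = (E x).map (chartDeriv φ x).toLinearMap := by
  have h : ∀ y, y = x → (E y).map (chartDeriv φ y).toLinearMap =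
      (E x).map (chartDeriv φ x).toLinearMap := by rintro y rfl; rfl
  exact h _ (φ.left_inv hx)

variable [IsManifold (𝓡 n) ∞ M]

theorem contMDiffAt_zero_of_continuousOn {σ : Π x : M, TangentSpace (𝓡 n) x} {U : Set M} {x : M}
    (hU : U ∈ 𝓝 x)
    (hσ : ContinuousOn (fun y ↦ (⟨y, σ y⟩ : TangentBundle (𝓡 n) M)) U) :
    ContMDiffAt (𝓡 n) (𝓡 n).tangent 0 (fun y ↦ (⟨y, σ y⟩ : TangentBundle (𝓡 n) M)) x :=
  (contMDiffOn_zero_iff.2 hσ).contMDiffAt hU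

theorem continuousAt_fieldIn {φ : OpenPartialHomeomorph M (Euc n)}
    (hφ : φ ∈ IsManifold.maximalAtlas (𝓡 n) ∞ M) {σ : Π x : M, TangentSpace (𝓡 n) x} {U : Set M}
    {x : M} (hU : U ∈ 𝓝 x) (hx : x ∈ φ.source)
    (hσ : ContinuousOn (fun y ↦ (⟨y, σ y⟩ : TangentBundle (𝓡 n) M)) U) :
    ContinuousAt (fieldIn φ σ) (φ x) := by
  have hz := φ.map_source hx
  have h1 : ContMDiffAt 𝓘(ℝ, Euc n) (𝓘(ℝ, Euc n)).tangent 0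
      (fun z ↦ (⟨z, VectorField.mpullback 𝓘(ℝ, Euc n) (𝓡 n) φ.symm σ z⟩ :
        TangentBundle 𝓘(ℝ, Euc n) (Euc n))) (φ x) :=
    ContMDiffAt.mpullback_vectorField_preimage (n := ∞)
      (by rw [φ.left_inv hx]; exact contMDiffAt_zero_of_continuousOn hU hσ)
      (contMDiffAt_chart_symm hφ hz) (isInvertible_mfderiv_chart_symm hφ hz) (by simp)
  refine ContinuousAt.congr (contMDiffAt_vectorSpace_iff_contDiffAt.1 h1).continuousAt ?_
  filter_upwards [φ.open_target.mem_nhds hz] with z hz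
  exact (fieldIn_eq_mpullback hφ hz σ).symm

/-- In an affine chart, `z` lies on the affine subspace through `y` with direction `E y`. -/
def SameSlice (E : Distribution n M) (φ : OpenPartialHomeomorph M (Euc n)) (y z : M) : Prop :=
  φ z - φ y ∈ distIn φ E (φ y)

/-- The change of charts is affine near `x`. Its linear part carries both the displacement and `E`
from one chart to the other, so being on one slice does not depend on the affine chart. -/
theorem eventually_sameSlice_iff [T2Space M] {D : Connection n M} (E : Distribution n M)
    {φ ψ : OpenPartialHomeomorph M (Euc n)} (hφ : IsAffineChart D φ) (hψ : IsAffineChart D ψ)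
    {x : M} (hxφ : x ∈ φ.source) (hxψ : x ∈ ψ.source) :
    ∃ U ∈ 𝓝 x, ∀ y ∈ U, ∀ z ∈ U, SameSlice E φ y z ↔ SameSlice E ψ y z := by
  have hopen : φ.target ∩ φ.symm ⁻¹' ψ.source ∈ 𝓝 (φ x) :=
    (φ.symm.isOpen_inter_preimage ψ.open_source).mem_nhds
      ⟨φ.map_source hxφ, by simpa [φ.left_inv hxφ] using hxψ⟩
  obtain ⟨r, hr, hball⟩ := Metric.mem_nhds_iff.1 hopen
  obtain ⟨A, hA, hAd, hAs⟩ := hφ.affine_transition hψ Metric.isOpen_ball (convex_ball (φ x) r)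
    (fun z hz ↦ (hball hz).1) (fun z hz ↦ (hball hz).2)
  refine ⟨φ.source ∩ ψ.source ∩ φ ⁻¹' Metric.ball (φ x) r, ?_, ?_⟩
  · refine inter_mem (inter_mem (φ.open_source.mem_nhds hxφ) (ψ.open_source.mem_nhds hxψ)) ?_
    exact (φ.continuousAt hxφ).preimage_mem_nhds (Metric.ball_mem_nhds _ hr)
  · rintro y ⟨⟨hyφ, hyψ⟩, hyr⟩ z ⟨⟨hzφ, hzψ⟩, hzr⟩
    have h1 := hAs _ hyr _ hzr
    rw [φ.left_inv hyφ, φ.left_inv hzφ] at h1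
    have h2 := hAd _ hyr
    rw [φ.left_inv hyφ] at h2
    unfold SameSlice
    rw [distIn_apply E hyφ, distIn_apply E hyψ, h1, Submodule.mem_map, Submodule.mem_map]
    constructor
    · rintro ⟨v, hv, hv'⟩
      exact ⟨v, hv, (h2 v).trans (congrArg A hv')⟩
    · rintro ⟨v, hv, hv'⟩
      exact ⟨v, hv, hA ((h2 v).symm.trans hv')⟩

/-- The foliated charts whose plaques are pieces of the slices of `E`. -/
def sliceAtlas (D : Connection n M) (E : Distribution n M) : Set (FoliatedChart n M) :=
  {c | ∀ x ∈ c.chart.source, ∃ φ, IsAffineChart D φ ∧ x ∈ φ.source ∧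
    ∃ U ∈ 𝓝 x, ∀ y ∈ U, ∀ z ∈ U, (c.chart y).2 = (c.chart z).2 ↔ SameSlice E φ y z}

theorem sameSlice_of_mem_sliceAtlas [T2Space M] {D : Connection n M} {E : Distribution n M}
    {c : FoliatedChart n M} (hc : c ∈ sliceAtlas D E) {φ : OpenPartialHomeomorph M (Euc n)}
    (hφ : IsAffineChart D φ) {x : M} (hx : x ∈ c.chart.source) (hxφ : x ∈ φ.source) :
    ∃ U ∈ 𝓝 x, ∀ y ∈ U, ∀ z ∈ U, (c.chart y).2 = (c.chart z).2 ↔ SameSlice E φ y z := by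
  obtain ⟨ψ, hψ, hxψ, U, hU, h⟩ := hc x hx
  obtain ⟨V, hV, h'⟩ := eventually_sameSlice_iff E hψ hφ hxψ hxφ
  exact ⟨U ∩ V, inter_mem hU hV, fun y hy z hz ↦
    (h y hy.1 z hz.1).trans (h' y hy.2 z hz.2)⟩

theorem IsAffinelyIntegrable.exists_mem_sliceAtlas {D : Connection n M} {E : Distribution n M}
    (hI : IsAffinelyIntegrable D E) (hE : IsContinuousSubbundle E) (x : M) :
    ∃ c ∈ sliceAtlas D E, x ∈ c.chart.source := by
  obtain ⟨φ, hφ, hx, ρ₁, hρ₁, hball₁, hconst⟩ := hI x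
  obtain ⟨U, hU, k, σ, hσ, hframe⟩ := hE x
  have hUo : φ.symm ⁻¹' interior U ∈ 𝓝 (φ x) :=
    (φ.continuousAt_symm (φ.map_source hx)).preimage_mem_nhds
      (by rw [φ.left_inv hx]; exact interior_mem_nhds.2 hU)
  obtain ⟨ρ₂, hρ₂, hball₂⟩ := Metric.mem_nhds_iff.1 hUo
  let ρ := min ρ₁ ρ₂
  have h1 : Metric.ball (φ x) ρ ⊆ Metric.ball (φ x) ρ₁ := Metric.ball_subset_ball (min_le_left _ _)
  have h2 : Metric.ball (φ x) ρ ⊆ Metric.ball (φ x) ρ₂ := Metric.ball_subset_ball (min_le_right _ _)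
  have hρ : 0 < ρ := lt_min hρ₁ hρ₂
  have hinj : ∀ z ∈ Metric.ball (φ x) ρ, Function.Injective (chartDeriv φ (φ.symm z)) :=
    fun z hz ↦ (chartDeriv_bijective hφ.1 (φ.map_target (hball₁ (h1 hz)))).1
  obtain ⟨q, hq, ψ, hxψ, hψ, hslice⟩ := exists_foliated_coordinates (distIn φ E)
    (fun i ↦ fieldIn φ (σ i)) hρ
    (fun i z hz ↦ by
      have hzt := hball₁ (h1 hz)
      have := continuousAt_fieldIn hφ.1 (mem_interior_iff_mem_nhds.1 (hball₂ (h2 hz)))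
        (φ.map_target hzt) (hσ i)
      rw [φ.right_inv hzt] at this
      exact this.continuousWithinAt)
    (fun z hz ↦ ((hframe _ (interior_subset (hball₂ (h2 hz)))).1.map'
      (chartDeriv φ (φ.symm z)).toLinearMap (LinearMap.ker_eq_bot.2 (hinj z hz))))
    (fun z hz ↦ by
      rw [distIn, ← (hframe _ (interior_subset (hball₂ (h2 hz)))).2, Submodule.map_span,
        ← range_comp]
      rfl)
    (fun z hz u hu hzu ↦ hconst z (h1 hz) u hu (h1 hzu))
  refine ⟨⟨k, q, hq, φ.trans ψ⟩, ?_, ?_⟩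
  · intro y hy
    have hy' : y ∈ φ.source ∧ φ y ∈ ψ.source := by
      simpa [OpenPartialHomeomorph.trans_source] using hy
    refine ⟨φ, hφ, hy'.1, φ.source ∩ φ ⁻¹' ψ.source,
      (φ.isOpen_inter_preimage ψ.open_source).mem_nhds hy', fun z hz w hw ↦ ?_⟩
    exact hslice _ hz.2 _ hw.2
  · rw [OpenPartialHomeomorph.trans_source]
    exact ⟨hx, hxψ⟩

/-- The foliation whose plaques are the slices of an affinely integrable distribution. -/
def sliceFoliation [T2Space M] {D : Connection n M} {E : Distribution n M}
    (hI : IsAffinelyIntegrable D E) (hE : IsContinuousSubbundle E) : TopFoliation n M where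
  atlas := sliceAtlas D E
  cover := hI.exists_mem_sliceAtlas hE
  compatible c hc c' hc' x hx := by
    obtain ⟨φ, hφ, hxφ, U, hU, h⟩ := hc x hx.1
    obtain ⟨V, hV, h'⟩ := sameSlice_of_mem_sliceAtlas hc' hφ hx.2 hxφ
    exact ⟨U ∩ V, inter_mem hU hV, fun y hy z hz ↦
      (h y hy.1 z hz.1).trans (h' y hy.2 z hz.2).symm⟩

variable [T2Space M] {D : Connection n M} {E : Distribution n M}
  (hI : IsAffinelyIntegrable D E) (hE : IsContinuousSubbundle E)

/-- The identity map from `M` with the leaf topology to `M`. -/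
def fromFine (F : TopFoliation n M) : F.Fine → M := id

/-- The identity map from `M` to `M` with the leaf topology. -/
def toFine (F : TopFoliation n M) : M → F.Fine := id

/-- Near a point, the plaque of any foliated chart of the atlas coincides with the slice through
this point in any affine chart. Hence leaf neighbourhoods are traces on that slice of neighbourhoods
in `M`. -/
theorem nhds_sliceFoliation {φ : OpenPartialHomeomorph M (Euc n)} (hφ : IsAffineChart D φ) {x : M}
    (hx : x ∈ φ.source) :
    𝓝 (toFine (sliceFoliation hI hE) x) =
      (𝓝[{y | SameSlice E φ x y}] x).map (toFine (sliceFoliation hI hE)) := by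
  have hmap : ∀ l : Filter M, l.map (toFine (sliceFoliation hI hE)) = l := fun l ↦ Filter.map_id
  rw [hmap, TopologicalSpace.nhds_generateFrom]
  apply le_antisymm
  · intro s hs
    obtain ⟨W, hW, hxW, hWs⟩ := mem_nhdsWithin.1 hs
    obtain ⟨c, hc, hxc⟩ := hI.exists_mem_sliceAtlas hE x
    obtain ⟨V, hV, hVc⟩ := sameSlice_of_mem_sliceAtlas hc hφ hxc hx
    refine mem_iInf_of_mem {y ∈ interior V ∩ W ∩ c.chart.source | (c.chart y).2 = (c.chart x).2}
      (mem_iInf_of_mem ⟨⟨⟨⟨mem_interior_iff_mem_nhds.2 hV, hxW⟩, hxc⟩, rfl⟩, c, hc, _, _,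
        (isOpen_interior.inter hW).inter c.chart.open_source, inter_subset_right, rfl⟩ ?_)
    rintro y ⟨⟨⟨hyV, hyW⟩, hyc⟩, hy⟩
    exact hWs ⟨hyW, (hVc x (mem_of_mem_nhds hV) y (interior_subset hyV)).1 hy.symm⟩
  · refine le_iInf₂ fun P hP ↦ le_principal_iff.2 ?_
    obtain ⟨hxP, c, hc, U, t, hU, hUc, rfl⟩ := hP
    obtain ⟨hxU, hxt⟩ := hxP
    obtain ⟨V, hV, hVc⟩ := sameSlice_of_mem_sliceAtlas hc hφ (hUc hxU) hx
    refine mem_nhdsWithin_iff_exists_mem_nhds_inter.2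
      ⟨V ∩ U, inter_mem hV (hU.mem_nhds hxU), ?_⟩
    rintro y ⟨⟨hyV, hyU⟩, hy⟩
    exact ⟨hyU, ((hVc x (mem_of_mem_nhds hV) y hyV).2 hy).symm.trans hxt⟩

theorem continuous_fromFine : Continuous (fromFine (sliceFoliation hI hE)) := by
  rw [continuous_iff_continuousAt]
  intro x
  obtain ⟨φ, hφ, hx, -⟩ := hI (fromFine _ x)
  have h := nhds_sliceFoliation hI hE hφ hx
  change Tendsto _ (𝓝 x) _
  change 𝓝 x = _ at h
  rw [h, tendsto_map'_iff]
  exact tendsto_id.mono_left nhdsWithin_le_nhds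

/-- Around each point there is a chart of the leaf topology with values in the direction of `E`,
given by an affine chart. -/
theorem exists_plaque_chart (x : M) :
    ∃ φ, IsAffineChart D φ ∧ x ∈ φ.source ∧
      ∃ e : OpenPartialHomeomorph (sliceFoliation hI hE).Fine (distIn φ E (φ x)),
        toFine _ x ∈ e.source ∧ (∃ r > 0, e.target = Metric.ball 0 r) ∧
        ∀ y ∈ e.source, fromFine _ y ∈ φ.source ∧ φ (fromFine _ y) = φ x + e y ∧
          distIn φ E (φ (fromFine _ y)) = distIn φ E (φ x) := by
  obtain ⟨φ, hφ, hx, r, hr, hball, hconst⟩ := hI x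
  refine ⟨φ, hφ, hx, ?_⟩
  let S := distIn φ E (φ x)
  have hsub : ∀ u : S, ‖u‖ < r → φ x + u ∈ Metric.ball (φ x) r := fun u hu ↦ by
    simpa using hu
  have hS : ∀ u : S, ‖u‖ < r → distIn φ E (φ x + u) = S := fun u hu ↦
    hconst _ (Metric.mem_ball_self hr) _ u.2 (hsub u hu)
  -- Only its values on `S` matter; it serves as a continuous total retraction onto `S`.
  let pr : Euc n →L[ℝ] S := S.orthogonalProjectionOnto
  have hpr : ∀ w ∈ S, (pr w : Euc n) = w := fun w hw ↦ Submodule.starProjection_eq_self_iff.2 hw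
  have hprS : ∀ u : S, pr (u : Euc n) = u := fun u ↦ Subtype.ext (hpr _ u.2)
  let e : OpenPartialHomeomorph (sliceFoliation hI hE).Fine S :=
    { toFun := fun y ↦ pr (φ (fromFine _ y) - φ x)
      invFun := fun u ↦ toFine _ (φ.symm (φ x + u))
      source := {y | fromFine _ y ∈ φ.source ∧ φ (fromFine _ y) ∈ Metric.ball (φ x) r ∧
        SameSlice E φ x (fromFine _ y)}
      target := Metric.ball 0 r
      map_source' := by
        rintro y ⟨hy, hyr, hys⟩
        rw [mem_ball_zero_iff, ← Submodule.norm_coe, hpr _ hys]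
        exact mem_ball_iff_norm.1 hyr
      map_target' := by
        intro u hu
        rw [mem_ball_zero_iff] at hu
        have hut := hball (hsub u hu)
        refine ⟨φ.map_target hut, ?_, ?_⟩
        · change φ (φ.symm _) ∈ _
          rw [φ.right_inv hut]; exact hsub u hu
        · change φ (φ.symm _) - _ ∈ _
          rw [φ.right_inv hut, add_sub_cancel_left]; exact u.2
      left_inv' := by
        rintro y ⟨hy, hyr, hys⟩
        rw [hpr _ hys, add_sub_cancel, φ.left_inv hy]
        rfl
      right_inv' := by
        intro u hu
        rw [mem_ball_zero_iff] at hu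
        change pr (φ (φ.symm _) - _) = _
        rw [φ.right_inv (hball (hsub u hu)), add_sub_cancel_left, hprS]
      -- At each point `y` of the source the direction of `E` is still `S`, so the slice through `y`
      -- is locally the slice through `x`.
      open_source := by
        rw [isOpen_iff_mem_nhds]
        rintro y ⟨hy, hyr, hys⟩
        have h := nhds_sliceFoliation hI hE hφ hy
        change 𝓝 y = _ at h
        rw [h, mem_map, mem_nhdsWithin_iff_exists_mem_nhds_inter]
        refine ⟨φ.source ∩ φ ⁻¹' Metric.ball (φ x) r,
          (φ.isOpen_inter_preimage Metric.isOpen_ball).mem_nhds ⟨hy, hyr⟩, ?_⟩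
        rintro z ⟨⟨hz, hzr⟩, hzs⟩
        refine ⟨hz, hzr, ?_⟩
        have hS' : distIn φ E (φ (fromFine _ y)) = S := by
          have := hconst _ (Metric.mem_ball_self hr) _ hys
          rw [add_sub_cancel] at this
          exact this hyr
        change φ z - φ (fromFine _ y) ∈ distIn φ E (φ (fromFine _ y)) at hzs
        rw [hS'] at hzs
        have := S.add_mem hzs hys
        rwa [sub_add_sub_cancel] at this
      open_target := Metric.isOpen_ball
      continuousOn_toFun := by
        refine pr.continuous.comp_continuousOn (ContinuousOn.sub ?_ continuousOn_const)
        exact φ.continuousOn.comp (continuous_fromFine hI hE).continuousOn fun y hy ↦ hy.1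
      continuousOn_invFun := by
        intro u hu
        rw [mem_ball_zero_iff] at hu
        have hut := hball (hsub u hu)
        refine ContinuousAt.continuousWithinAt ?_
        change Tendsto _ _ (𝓝 (toFine _ (φ.symm (φ x + u))))
        rw [nhds_sliceFoliation hI hE hφ (φ.map_target hut)]
        change Tendsto ((toFine _) ∘ fun u : S ↦ φ.symm (φ x + u)) _ _
        refine tendsto_map.comp (tendsto_nhdsWithin_iff.2 ⟨?_, ?_⟩)
        · exact ContinuousAt.comp (f := fun u : S ↦ φ x + (u : Euc n))
            (φ.continuousAt_symm hut) (by fun_prop)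
        · filter_upwards [Metric.isOpen_ball.mem_nhds (mem_ball_zero_iff.2 hu)] with u' hu'
          rw [mem_ball_zero_iff] at hu'
          change _ - _ ∈ distIn φ E _
          rw [φ.right_inv hut, φ.right_inv (hball (hsub u' hu')), hS u hu,
            add_sub_add_left_eq_sub]
          exact S.sub_mem u'.2 u.2 }
  refine ⟨e, ⟨hx, Metric.mem_ball_self hr, ?_⟩, ⟨r, hr, rfl⟩, ?_⟩
  · change φ x - φ x ∈ _
    rw [sub_self]
    exact Submodule.zero_mem _
  · rintro y ⟨hy, hyr, hys⟩
    have h1 : φ (fromFine _ y) = φ x + e y := by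
      change _ = _ + (pr _ : Euc n)
      rw [hpr _ hys, add_sub_cancel]
    refine ⟨hy, h1, ?_⟩
    rw [h1]
    refine hS _ ?_
    have := hyr
    rw [h1] at this
    simpa using this

end Foliations

/-! ### Affine submanifold structure from adapted charts -/

section Submanifolds

variable {n k : ℕ} {M : Type*} [TopologicalSpace M] [ChartedSpace (Euc n) M]
  {L : Type*} [TopologicalSpace L]

theorem exists_affine_leftInverse (a : Euc k →ᵃ[ℝ] Euc n) (ha : Function.Injective a) :
    ∃ b : Euc n → Euc k, ContDiff ℝ ∞ b ∧ ∀ z, b (a z) = z := by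
  obtain ⟨B, hB⟩ := LinearMap.exists_leftInverse_of_injective a.linear
    (LinearMap.ker_eq_bot.2 ((AffineMap.linear_injective_iff a).2 ha))
  refine ⟨fun w ↦ B.toContinuousLinearMap (w - a 0), by fun_prop, fun z ↦ ?_⟩
  have h : a z - a 0 = a.linear z := by
    rw [← vsub_eq_sub, ← AffineMap.linearMap_vsub]; simp
  change B (a z - a 0) = z
  rw [h]
  exact DFunLike.congr_fun hB z

theorem contDiff_affineMap (a : Euc k →ᵃ[ℝ] Euc n) : ContDiff ℝ ∞ a := by
  have h : (a : Euc k → Euc n) = fun z ↦ a.linear.toContinuousLinearMap z + a 0 := by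
    ext1 z
    exact congrFun (AffineMap.decomp a) z
  rw [h]
  fun_prop

theorem hasFDerivAt_affineMap (a : Euc k →ᵃ[ℝ] Euc n) (z : Euc k) :
    HasFDerivAt a a.linear.toContinuousLinearMap z := by
  have h : (a : Euc k → Euc n) = fun z ↦ a.linear.toContinuousLinearMap z + a 0 := by
    ext1 z
    exact congrFun (AffineMap.decomp a) z
  rw [h]
  exact (ContinuousLinearMap.hasFDerivAt _).add_const _

/-- Differentiating `φ ∘ j = a ∘ ψ` identifies the image of the derivative of `j`, read in `φ`, with
the range of `a.linear`, which is `E` there. -/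
theorem range_mfderiv_of_adapted {E : Distribution n M} {j : L → M}
    {φ : OpenPartialHomeomorph M (Euc n)} {ψ : OpenPartialHomeomorph L (Euc k)}
    {a : Euc k →ᵃ[ℝ] Euc n} [ChartedSpace (Euc k) L] [IsManifold (𝓡 k) ∞ L]
    (hφ : φ ∈ IsManifold.maximalAtlas (𝓡 n) ∞ M) (hψ : ψ ∈ IsManifold.maximalAtlas (𝓡 k) ∞ L)
    (h : ∀ q ∈ ψ.source, j q ∈ φ.source ∧ φ (j q) = a (ψ q) ∧
      distIn φ E (φ (j q)) = LinearMap.range a.linear)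
    {p : L} (hp : p ∈ ψ.source) (hj : MDifferentiableAt (𝓡 k) (𝓡 n) j p) :
    LinearMap.range (mfderiv (𝓡 k) (𝓡 n) j p).toLinearMap = E (j p) := by
  obtain ⟨h1, h2, h3⟩ := h p hp
  have hcomp : chartDeriv φ (j p) ∘L mfderiv (𝓡 k) (𝓡 n) j p =
      a.linear.toContinuousLinearMap ∘L chartDeriv ψ p := by
    have e1 := (((contMDiffAt_chart hφ h1).mdifferentiableAt (by simp)).hasMFDerivAt.comp p
      hj.hasMFDerivAt)
    have e2 := ((hasFDerivAt_affineMap a (ψ p)).hasMFDerivAt.comp p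
      ((contMDiffAt_chart hψ hp).mdifferentiableAt (by simp)).hasMFDerivAt)
    have e3 : φ ∘ j =ᶠ[𝓝 p] a ∘ ψ := by
      filter_upwards [ψ.open_source.mem_nhds hp] with q hq using (h q hq).2.1
    exact hasMFDerivAt_unique e1 (e2.congr_of_eventuallyEq e3)
  have hc : ∀ v, chartDeriv φ (j p) (mfderiv (𝓡 k) (𝓡 n) j p v) = a.linear (chartDeriv ψ p v) :=
    fun v ↦ DFunLike.congr_fun hcomp v
  rw [distIn_apply E h1] at h3
  ext v
  have hv : v ∈ E (j p) ↔ chartDeriv φ (j p) v ∈ LinearMap.range a.linear := by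
    rw [← h3, Submodule.mem_map]
    refine ⟨fun hv ↦ ⟨v, hv, rfl⟩, ?_⟩
    rintro ⟨w, hw, hwv⟩
    rwa [← (chartDeriv_bijective hφ h1).1 hwv]
  rw [hv]
  constructor
  · rintro ⟨w, rfl⟩
    exact ⟨chartDeriv ψ p w, (hc w).symm⟩
  · rintro ⟨w, hw⟩
    obtain ⟨w', rfl⟩ := (chartDeriv_bijective hψ hp).2 w
    exact ⟨w', (chartDeriv_bijective hφ h1).1 ((hc w').trans hw)⟩

variable [IsManifold (𝓡 n) ∞ M]

/-- The chart `ψ` of `L` makes `j : L → M` affine in an affine chart of `M`, with image tangent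
to `E`. -/
def IsAdaptedChart (D : Connection n M) (E : Distribution n M) (j : L → M)
    (ψ : OpenPartialHomeomorph L (Euc k)) : Prop :=
  ∃ φ, IsAffineChart D φ ∧ ∃ a : Euc k →ᵃ[ℝ] Euc n, Function.Injective a ∧ ∀ q ∈ ψ.source,
    j q ∈ φ.source ∧ φ (j q) = a (ψ q) ∧ distIn φ E (φ (j q)) = LinearMap.range a.linear

/-- The transition equals `b ∘ φ' ∘ φ.symm ∘ a` with `b` a smooth left inverse of `a'`, so
smoothness is inherited from `M`. -/
theorem contDiffOn_adapted_transition {D : Connection n M} {E : Distribution n M} {j : L → M}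
    {ψ ψ' : OpenPartialHomeomorph L (Euc k)} (hψ : IsAdaptedChart D E j ψ)
    (hψ' : IsAdaptedChart D E j ψ') :
    ContDiffOn ℝ ∞ (ψ.symm.trans ψ') (ψ.symm.trans ψ').source := by
  obtain ⟨φ, hφ, a, ha, h⟩ := hψ
  obtain ⟨φ', hφ', a', ha', h'⟩ := hψ'
  obtain ⟨b, hb, hba⟩ := exists_affine_leftInverse a' ha'
  have hmem : ∀ z ∈ (ψ.symm.trans ψ').source, z ∈ ψ.target ∧ ψ.symm z ∈ ψ'.source := fun z hz ↦ by
    simpa [OpenPartialHomeomorph.trans_source] using hz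
  have heq : ∀ z ∈ (ψ.symm.trans ψ').source,
      (ψ.symm.trans ψ') z = (b ∘ φ' ∘ φ.symm ∘ a) z := fun z hz ↦ by
    obtain ⟨hz1, hz2⟩ := hmem z hz
    obtain ⟨h1, h2, -⟩ := h _ (ψ.map_target hz1)
    rw [ψ.right_inv hz1] at h2
    change ψ' (ψ.symm z) = b (φ' (φ.symm (a z)))
    rw [← h2, φ.left_inv h1, (h' _ hz2).2.1, hba]
  refine ContDiffOn.congr (fun z hz ↦ ?_) heq
  obtain ⟨hz1, hz2⟩ := hmem z hz
  obtain ⟨h1, h2, -⟩ := h _ (ψ.map_target hz1)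
  rw [ψ.right_inv hz1] at h2
  have h3 : ContDiffAt ℝ ∞ (φ' ∘ φ.symm) (a z) := by
    refine ContMDiffAt.contDiffAt (ContMDiffAt.comp _ (I' := 𝓡 n) (contMDiffAt_chart hφ'.1 ?_)
      (contMDiffAt_chart_symm hφ.1 ?_))
    · rw [← h2, φ.left_inv h1]
      exact (h' _ hz2).1
    · rw [← h2]
      exact φ.map_source h1
  exact (hb.contDiffAt.comp z (h3.comp z (contDiff_affineMap a).contDiffAt)).contDiffWithinAt

/-- The smooth structure on `L` defined by adapted charts. -/
abbrev adaptedChartedSpace (D : Connection n M) (E : Distribution n M) (j : L → M)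
    (h : ∀ q : L, ∃ ψ : OpenPartialHomeomorph L (Euc k), q ∈ ψ.source ∧ IsAdaptedChart D E j ψ) :
    ChartedSpace (Euc k) L where
  atlas := {ψ | IsAdaptedChart D E j ψ}
  chartAt q := (h q).choose
  mem_chart_source q := (h q).choose_spec.1
  chart_mem_atlas q := (h q).choose_spec.2

theorem isManifold_adapted {D : Connection n M} {E : Distribution n M} {j : L → M}
    (h : ∀ q : L, ∃ ψ : OpenPartialHomeomorph L (Euc k), q ∈ ψ.source ∧ IsAdaptedChart D E j ψ) :
    letI := adaptedChartedSpace D E j h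
    IsManifold (𝓡 k) ∞ L := by
  let _ := adaptedChartedSpace D E j h
  refine isManifold_of_contDiffOn (𝓡 k) ∞ L fun ψ ψ' hψ hψ' ↦ ?_
  simpa using contDiffOn_adapted_transition hψ hψ'

section Adapted

variable {D : Connection n M} {E : Distribution n M} {j : L → M}
  {φ : OpenPartialHomeomorph M (Euc n)} {ψ : OpenPartialHomeomorph L (Euc k)}
  {a : Euc k →ᵃ[ℝ] Euc n}

/-- After translating the target chart by `-a 0`, the map reads as an injective linear map; extended
to an isomorphism `Θ`, it takes the normal form `z ↦ Θ (z, 0)`. -/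
theorem isImmersionAt_of_adapted [ChartedSpace (Euc k) L] [IsManifold (𝓡 k) ∞ L]
    (hφ : φ ∈ IsManifold.maximalAtlas (𝓡 n) ∞ M) (hψ : ψ ∈ IsManifold.maximalAtlas (𝓡 k) ∞ L)
    (ha : Function.Injective a) (h : ∀ q ∈ ψ.source, j q ∈ φ.source ∧ φ (j q) = a (ψ q))
    {p : L} (hp : p ∈ ψ.source) :
    IsImmersionAtOfComplement (Euc (n - k)) (𝓡 k) (𝓡 n) ∞ j p := by
  obtain ⟨q, hq, Θ, hΘ⟩ := exists_equiv_extending a.linear.toContinuousLinearMap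
    ((AffineMap.linear_injective_iff a).2 ha)
  obtain rfl : q = n - k := by omega
  let τ : Euc n ≃ₜ Euc n := Homeomorph.addRight (-a 0)
  have hτ : φ.trans τ.toOpenPartialHomeomorph ∈ IsManifold.maximalAtlas (𝓡 n) ∞ M := by
    refine trans_mem_maximalAtlas hφ ?_ ?_
    · exact ContDiff.contDiffOn (contDiff_id.add contDiff_const)
    · exact ContDiff.contDiffOn (contDiff_id.add contDiff_const)
  have hsrc : (φ.trans τ.toOpenPartialHomeomorph).source = φ.source := by simp
  refine IsImmersionAtOfComplement.mk_of_charts Θ ψ (φ.trans τ.toOpenPartialHomeomorph) hp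
    (by rw [hsrc]; exact (h p hp).1) hψ hτ (fun q hq ↦ by
      rw [mem_preimage, hsrc]; exact (h q hq).1) ?_
  intro z hz
  have hz' : z ∈ ψ.target := by simpa using hz
  have h1 := (h _ (ψ.map_target hz')).2
  rw [ψ.right_inv hz'] at h1
  change φ (j (ψ.symm z)) + -a 0 = Θ (z, 0)
  rw [h1, hΘ, AffineMap.decomp a]
  simp

/-- In the affine chart `D` is the ordinary derivative and `E` is one fixed subspace `S` along `L`.
The components of `σ` projected to the orthogonal complement of `S` vanish along `L`, hence so does
their derivative in directions tangent to `L`. -/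
theorem connection_mem_of_adapted (hφ : IsAffineChart D φ)
    (h : ∀ q ∈ ψ.source, j q ∈ φ.source ∧ φ (j q) = a (ψ q) ∧
      distIn φ E (φ (j q)) = LinearMap.range a.linear)
    {p : L} (hp : p ∈ ψ.source) {σ : Π x : M, TangentSpace (𝓡 n) x} (hσ : IsSmoothField σ)
    (htan : ∀ᶠ q in 𝓝 p, σ (j q) ∈ E (j q)) {v : TangentSpace (𝓡 n) (j p)} (hv : v ∈ E (j p)) :
    D σ (j p) v ∈ E (j p) := by
  obtain ⟨h1, h2, h3⟩ := h p hp
  let S := LinearMap.range a.linear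
  have hmem : ∀ q ∈ ψ.source, ∀ w : TangentSpace (𝓡 n) (j q),
      w ∈ E (j q) ↔ chartDeriv φ (j q) w ∈ S := fun q hq w ↦ by
    obtain ⟨h1, -, h3⟩ := h q hq
    rw [distIn_apply E h1] at h3
    change _ ↔ _ ∈ LinearMap.range a.linear
    rw [← h3, Submodule.mem_map]
    refine ⟨fun hv ↦ ⟨w, hv, rfl⟩, ?_⟩
    rintro ⟨w', hw, hwv⟩
    rwa [← (chartDeriv_bijective hφ.1 h1).1 hwv]
  rw [hmem p hp, hφ.chartDeriv_connection h1 (mdifferentiableAt_of_isSmoothField hσ _)]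
  obtain ⟨w, hw⟩ := (hmem p hp v).1 hv
  let π : Euc n →L[ℝ] Euc n := Sᗮ.starProjection
  have hπ : ∀ u, π u = 0 ↔ u ∈ S := fun u ↦ by
    rw [Submodule.starProjection_apply_eq_zero_iff, Submodule.orthogonal_orthogonal]
  have hd : HasFDerivAt (fieldIn φ σ) (fderiv ℝ (fieldIn φ σ) (φ (j p))) (a (ψ p)) := by
    rw [← h2]
    exact (differentiableAt_fieldIn hφ.1 h1 (mdifferentiableAt_of_isSmoothField hσ _)).hasFDerivAt
  have hG := π.hasFDerivAt.comp (ψ p) (hd.comp (ψ p) (hasFDerivAt_affineMap a (ψ p)))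
  have h0 : π ∘ fieldIn φ σ ∘ a =ᶠ[𝓝 (ψ p)] fun _ ↦ 0 := by
    have htan' : ∀ᶠ z in 𝓝 (ψ p), σ (j (ψ.symm z)) ∈ E (j (ψ.symm z)) := by
      refine Tendsto.eventually ?_ htan
      have := (ψ.continuousAt_symm (ψ.map_source hp)).tendsto
      rwa [ψ.left_inv hp] at this
    filter_upwards [htan', ψ.open_target.mem_nhds (ψ.map_source hp)] with z hz hzt
    have hq := ψ.map_target hzt
    obtain ⟨h1, h2, -⟩ := h _ hq
    change π (fieldIn φ σ (a z)) = 0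
    rw [ψ.right_inv hzt] at h2
    rw [hπ, ← h2, fieldIn_apply_chart h1]
    exact (hmem _ hq _).1 hz
  have h4 := hG.unique ((hasFDerivAt_const (0 : Euc n) (ψ p)).congr_of_eventuallyEq h0)
  rw [← hπ, ← hw]
  exact DFunLike.congr_fun h4 w

end Adapted

theorem isImmersedAffineSubmanifold_of_adapted [T2Space M] [SecondCountableTopology L]
    {D : Connection n M} {E : Distribution n M} {j : L → M} (hj : Continuous j)
    (hinj : Function.Injective j)
    (h : ∀ q : L, ∃ ψ : OpenPartialHomeomorph L (Euc k), q ∈ ψ.source ∧ IsAdaptedChart D E j ψ) :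
    IsImmersedAffineSubmanifold D E j := by
  let _ := adaptedChartedSpace D E j h
  have hman : IsManifold (𝓡 k) ∞ L := isManifold_adapted h
  have hatlas : ∀ ψ, IsAdaptedChart D E j ψ → ψ ∈ IsManifold.maximalAtlas (𝓡 k) ∞ L :=
    fun ψ hψ ↦ IsManifold.subset_maximalAtlas hψ
  have himm : IsImmersionOfComplement (Euc (n - k)) (𝓡 k) (𝓡 n) ∞ j := fun p ↦ by
    obtain ⟨ψ, hp, hψ⟩ := h p
    have hψ' := hatlas ψ hψ
    obtain ⟨φ, hφ, a, ha, haψ⟩ := hψ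
    exact isImmersionAt_of_adapted hφ.1 hψ' ha (fun q hq ↦ ⟨(haψ q hq).1, (haψ q hq).2.1⟩) hp
  refine ⟨T2Space.of_injective_continuous hinj hj, inferInstance, hinj, k, inferInstance, hman,
    ⟨_, inferInstance, inferInstance, himm⟩, ?_, ?_, ?_⟩
  · intro p
    obtain ⟨ψ, hp, hψ⟩ := h p
    have hψ' := hatlas ψ hψ
    obtain ⟨φ, hφ, a, ha, haψ⟩ := hψ
    exact range_mfderiv_of_adapted hφ.1 hψ' haψ hp
      ((himm p).contMDiffAt.mdifferentiableAt (by simp))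
  · intro p
    obtain ⟨ψ, hp, hψ⟩ := h p
    have hψ' := hatlas ψ hψ
    obtain ⟨φ, hφ, a, ha, haψ⟩ := hψ
    exact ⟨φ, hφ, ψ, hψ', hp, a, ha, fun q hq ↦ ⟨(haψ q hq).1, (haψ q hq).2.1⟩⟩
  · intro σ hσ p htan v hv
    obtain ⟨ψ, hp, φ, hφ, a, ha, haψ⟩ := h p
    exact connection_mem_of_adapted hφ haψ hp hσ htan hv

end Submanifolds

/-! ### Second countability from plaques -/

section Countability

/-- A connected space which is covered by countably many families of pairwise disjoint open second
countable sets is second countable. -/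
theorem secondCountableTopology_of_plaques {X ι : Type*} {τ : ι → Type*} [TopologicalSpace X]
    [PreconnectedSpace X] [Countable ι] (P : ∀ i, τ i → Set X)
    (hopen : ∀ i t, IsOpen (P i t)) (hdisj : ∀ i, Pairwise fun s t ↦ Disjoint (P i s) (P i t))
    (hsc : ∀ i t, SecondCountableTopology (P i t)) (hcov : ∀ x, ∃ i t, x ∈ P i t) :
    SecondCountableTopology X := by
  rcases isEmpty_or_nonempty X with hX | ⟨⟨x₀⟩⟩
  · infer_instance
  obtain ⟨i₀, t₀, hx₀⟩ := hcov x₀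
  -- Adds one link to chains of successively meeting plaques; `C m` collects the ends of chains with
  -- `m` links from the first plaque.
  let step : Set (Σ i, τ i) → Set (Σ i, τ i) := fun C ↦
    {a | ∃ b ∈ C, (P a.1 a.2 ∩ P b.1 b.2).Nonempty}
  let C : ℕ → Set (Σ i, τ i) := fun m ↦ step^[m] {⟨i₀, t₀⟩}
  have hC_succ : ∀ m, C (m + 1) = step (C m) := fun m ↦ Function.iterate_succ_apply' _ _ _
  -- Disjoint nonempty open traces on a second countable plaque are countable in number.
  have hmeet : ∀ i (b : Σ i, τ i), {t | (P i t ∩ P b.1 b.2).Nonempty}.Countable := fun i b ↦ by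
    have := hsc b.1 b.2
    refine Set.PairwiseDisjoint.countable_of_isOpen
      (s := fun t ↦ ((↑) : P b.1 b.2 → X) ⁻¹' P i t) ?_
      (fun t _ ↦ (hopen i t).preimage continuous_subtype_val) ?_
    · intro s _ t _ hst
      exact (hdisj i hst).preimage _
    · rintro t ⟨x, hx, hxb⟩
      exact ⟨⟨x, hxb⟩, hx⟩
  have hC : ∀ m, (C m).Countable := fun m ↦ by
    induction m with
    | zero => exact countable_singleton _
    | succ m ih =>
      rw [hC_succ]
      have : step (C m) ⊆ ⋃ b ∈ C m, ⋃ i, Sigma.mk i '' {t | (P i t ∩ P b.1 b.2).Nonempty} := by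
        rintro ⟨i, t⟩ ⟨b, hb, hbt⟩
        exact mem_biUnion hb (mem_iUnion.2 ⟨i, t, hbt, rfl⟩)
      exact (ih.biUnion fun b _ ↦ countable_iUnion fun i ↦ (hmeet i b).image _).mono this
  let U : Set X := ⋃ a ∈ ⋃ m, C m, P a.1 a.2
  have hUo : IsOpen U := isOpen_biUnion fun a _ ↦ hopen _ _
  -- A plaque around a point of the closure meets some plaque of a chain, so it ends a chain one
  -- link longer.
  have hUc : IsClosed U := by
    refine isClosed_of_closure_subset fun y hy ↦ ?_
    obtain ⟨i, t, hyt⟩ := hcov y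
    obtain ⟨z, hz, hzU⟩ := mem_closure_iff.1 hy _ (hopen i t) hyt
    obtain ⟨a, ha, hza⟩ := mem_iUnion₂.1 hzU
    obtain ⟨m, hm⟩ := mem_iUnion.1 ha
    refine mem_biUnion (x := ⟨i, t⟩) (mem_iUnion.2 ⟨m + 1, ?_⟩) hyt
    rw [hC_succ]
    exact ⟨a, hm, z, hz, hza⟩
  have hU : U = univ := IsClopen.eq_univ ⟨hUc, hUo⟩
    ⟨x₀, mem_biUnion (x := ⟨i₀, t₀⟩) (mem_iUnion.2 ⟨0, rfl⟩) hx₀⟩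
  have hcount : Countable (⋃ m, C m) := (countable_iUnion hC).to_subtype
  have : ∀ a : (⋃ m, C m), SecondCountableTopology (P a.1.1 a.1.2) := fun a ↦ hsc _ _
  refine TopologicalSpace.secondCountableTopology_of_countable_cover
    (U := fun a : (⋃ m, C m) ↦ P a.1.1 a.1.2) (fun a ↦ hopen _ _) ?_
  rw [← hU]
  exact (biUnion_eq_iUnion (⋃ m, C m) (fun a _ ↦ P a.1 a.2)).symm

end Countability

/-! ### The leaves of the slice foliation -/

section Leaves

variable {n : ℕ} {M : Type*} [TopologicalSpace M] [ChartedSpace (Euc n) M]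
  [IsManifold (𝓡 n) ∞ M] [T2Space M] {D : Connection n M} {E : Distribution n M}
  (hI : IsAffinelyIntegrable D E) (hE : IsContinuousSubbundle E)

/-- The leaf topology is locally connected: its charts have balls as targets. -/
theorem isOpen_connectedComponent_fine (x : (sliceFoliation hI hE).Fine) :
    IsOpen (connectedComponent x) := by
  rw [isOpen_iff_mem_nhds]
  intro y hy
  obtain ⟨φ, -, -, e, hye, ⟨r, -, hr⟩, -⟩ := exists_plaque_chart hI hE (fromFine _ y)
  refine mem_of_superset (e.open_source.mem_nhds hye) ?_
  rw [connectedComponent_eq hy]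
  refine IsPreconnected.subset_connectedComponent ?_ hye
  rw [← e.symm_image_target_eq_source]
  refine IsPreconnected.image ?_ _ e.continuousOn_symm
  rw [hr]
  exact (convex_ball _ _).isPreconnected

theorem continuous_leaf_incl (x : M) :
    Continuous (TopFoliation.Leaf.incl (sliceFoliation hI hE) x) :=
  (continuous_fromFine hI hE).comp continuous_subtype_val

/-- The rank is locally constant on `M` and the leaf is connected, so one model space serves all its
charts. -/
theorem finrank_leaf (x : M) (y : (sliceFoliation hI hE).Leaf x) :
    Module.finrank ℝ (E (TopFoliation.Leaf.incl _ x y)) = Module.finrank ℝ (E x) := by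
  have : PreconnectedSpace ((sliceFoliation hI hE).Leaf x) :=
    Subtype.preconnectedSpace isPreconnected_connectedComponent
  have h : IsLocallyConstant fun y : (sliceFoliation hI hE).Leaf x ↦
      Module.finrank ℝ (E (TopFoliation.Leaf.incl _ x y)) := by
    rw [IsLocallyConstant.iff_eventually_eq]
    intro y
    exact (continuous_leaf_incl hI hE x).continuousAt.eventually (hE.eventually_finrank _)
  exact h.apply_eq_of_preconnectedSpace y ⟨toFine _ x, mem_connectedComponent⟩

/-- The leaf is open in the leaf topology, so a plaque chart restricts to it; a linear
identification of its direction `S` with `ℝᵏ` gives the adapted chart. -/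
theorem exists_adapted_chart_leaf (x : M) (p : (sliceFoliation hI hE).Leaf x) :
    ∃ ψ : OpenPartialHomeomorph ((sliceFoliation hI hE).Leaf x) (Euc (Module.finrank ℝ (E x))),
      p ∈ ψ.source ∧ IsAdaptedChart D E (TopFoliation.Leaf.incl _ x) ψ := by
  obtain ⟨φ, hφ, hp, e, hpe, -, he⟩ := exists_plaque_chart hI hE (TopFoliation.Leaf.incl _ x p)
  let S := distIn φ E (φ (TopFoliation.Leaf.incl _ x p))
  have hS : Module.finrank ℝ S = Module.finrank ℝ (E x) := by
    rw [finrank_distIn hφ.1 E (φ.map_source hp), φ.left_inv hp, finrank_leaf hI hE x p]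
  let Θ : Euc (Module.finrank ℝ (E x)) ≃L[ℝ] S :=
    ContinuousLinearEquiv.ofFinrankEq (by rw [hS, finrank_euclideanSpace_fin])
  have : Nonempty ((sliceFoliation hI hE).Leaf x) := ⟨p⟩
  let ι := (isOpen_connectedComponent_fine hI hE x).isOpenEmbedding_subtypeVal
  let ψ := ((ι.toOpenPartialHomeomorph _).trans e).trans
    Θ.symm.toHomeomorph.toOpenPartialHomeomorph
  have hψ : ∀ q, ψ q = Θ.symm (e q.1) := fun q ↦ rfl
  have hsrc : ∀ q, q ∈ ψ.source ↔ q.1 ∈ e.source := fun q ↦ by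
    simp [ψ]
  refine ⟨ψ, (hsrc _).2 hpe, φ, hφ, (S.subtype ∘ₗ Θ.toLinearEquiv.toLinearMap).toAffineMap +
    AffineMap.const ℝ _ (φ (TopFoliation.Leaf.incl _ x p)), ?_, ?_⟩
  · intro z w hzw
    have : (Θ z : Euc n) + φ _ = Θ w + φ _ := hzw
    exact Θ.injective (Subtype.ext (add_right_cancel this))
  · intro q hq
    obtain ⟨h1, h2, h3⟩ := he q.1 ((hsrc q).1 hq)
    refine ⟨h1, ?_, h3.trans ?_⟩
    · change φ (fromFine _ q.1) = (Θ (Θ.symm (e q.1)) : Euc n) + _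
      rw [Θ.apply_symm_apply, h2, add_comm]
      rfl
    · have e1 : ((S.subtype ∘ₗ Θ.toLinearEquiv.toLinearMap).toAffineMap +
          AffineMap.const ℝ _ (φ (TopFoliation.Leaf.incl _ x p))).linear =
          S.subtype ∘ₗ Θ.toLinearEquiv.toLinearMap := by
        rw [AffineMap.add_linear, AffineMap.const_linear, add_zero]
        rfl
      rw [e1, LinearMap.range_comp, LinearEquiv.range, Submodule.map_top, Submodule.range_subtype]

/-- A plaque of a foliated chart has the topology induced from `M`. -/
theorem isInducing_plaque {c : FoliatedChart n M} (hc : c ∈ sliceAtlas D E) (x : M)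
    (t : Euc c.q) :
    IsInducing fun y : {y : (sliceFoliation hI hE).Leaf x |
      TopFoliation.Leaf.incl _ x y ∈ c.chart.source ∧
        (c.chart (TopFoliation.Leaf.incl _ x y)).2 = t} ↦ TopFoliation.Leaf.incl _ x y.1 := by
  rw [isInducing_iff_nhds]
  rintro ⟨y, hyc, hyt⟩
  apply le_antisymm
  · exact ((continuous_leaf_incl hI hE x).comp continuous_subtype_val).continuousAt.tendsto.le_comap
  · obtain ⟨φ, hφ, hyφ, U, hU, h⟩ := hc _ hyc
    rw [nhds_subtype, nhds_subtype, comap_comap, ← tendsto_iff_comap]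
    have hn := nhds_sliceFoliation hI hE hφ hyφ
    change 𝓝 y.1 = _ at hn
    change Tendsto _ _ (𝓝 y.1)
    rw [hn]
    refine tendsto_map.comp (f := fun z : {y : (sliceFoliation hI hE).Leaf x |
      TopFoliation.Leaf.incl _ x y ∈ c.chart.source ∧
        (c.chart (TopFoliation.Leaf.incl _ x y)).2 = t} ↦ TopFoliation.Leaf.incl _ x z.1)
      (tendsto_nhdsWithin_iff.2 ⟨tendsto_comap, ?_⟩)
    filter_upwards [preimage_mem_comap hU] with z hz
    exact (h _ (mem_of_mem_nhds hU) _ hz).1 (hyt.trans z.2.2.symm)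

/-- Finitely many foliated charts cover `M`. The plaques of one chart are disjoint, open in the
leaf, and second countable as they carry the topology induced from `M`. -/
theorem secondCountableTopology_leaf [CompactSpace M] (x : M) :
    SecondCountableTopology ((sliceFoliation hI hE).Leaf x) := by
  have hM : SecondCountableTopology M := ChartedSpace.secondCountable_of_sigmaCompact (Euc n) M
  have hconn : PreconnectedSpace ((sliceFoliation hI hE).Leaf x) :=
    Subtype.preconnectedSpace isPreconnected_connectedComponent
  choose c hc hxc using hI.exists_mem_sliceAtlas hE
  obtain ⟨s, hs⟩ := isCompact_univ.elim_finite_subcover (fun x ↦ (c x).chart.source)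
    (fun x ↦ (c x).chart.open_source) (fun x _ ↦ mem_iUnion.2 ⟨x, hxc x⟩)
  let j := TopFoliation.Leaf.incl (sliceFoliation hI hE) x
  refine secondCountableTopology_of_plaques (ι := s) (τ := fun i ↦ Euc (c i).q)
    (fun i t ↦ {y | j y ∈ (c i).chart.source ∧ ((c i).chart (j y)).2 = t}) ?_ ?_ ?_ ?_
  · intro i t
    exact IsOpen.preimage (continuous_subtype_val (X := (sliceFoliation hI hE).Fine))
      (TopologicalSpace.isOpen_generateFrom_of_mem ⟨c i, hc i, (c i).chart.source, t,
        (c i).chart.open_source, subset_rfl, rfl⟩)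
  · intro i t t' htt'
    rw [Set.disjoint_left]
    rintro y ⟨-, hy⟩ ⟨-, hy'⟩
    exact htt' (hy.symm.trans hy')
  · intro i t
    exact (isInducing_plaque hI hE (hc i) x t).secondCountableTopology
  · intro y
    obtain ⟨i, hi, hy⟩ := mem_iUnion₂.1 (hs (mem_univ (j y)))
    exact ⟨⟨i, hi⟩, _, hy, rfl⟩

theorem isAffineTangentTo_sliceFoliation [CompactSpace M] :
    (sliceFoliation hI hE).IsAffineTangentTo D E := fun x ↦ by
  have := secondCountableTopology_leaf hI hE x
  exact isImmersedAffineSubmanifold_of_adapted (continuous_leaf_incl hI hE x)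
    Subtype.val_injective (exists_adapted_chart_leaf hI hE x)

end Leaves

/-! ### Passage to the inverse diffeomorphism -/

section Inverse

variable {n : ℕ} {M : Type*} [TopologicalSpace M] [ChartedSpace (Euc n) M]

theorem mfderiv_symm_iterate (f : M ≃ₘ^∞⟮𝓡 n, 𝓡 n⟯ M) (m : ℕ) (x : M)
    (v : TangentSpace (𝓡 n) x) :
    mfderiv (𝓡 n) (𝓡 n) f.symm^[m] (f^[m] x) (mfderiv (𝓡 n) (𝓡 n) f^[m] x v) = v := by
  have h := mfderiv_comp x ((contMDiff_iterate f.symm m).mdifferentiable (by simp) (f^[m] x))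
    ((contMDiff_iterate f m).mdifferentiable (by simp) x)
  have e : f.symm^[m] ∘ f^[m] = id :=
    funext ((Function.LeftInverse.iterate f.symm_apply_apply m))
  rw [e, mfderiv_id] at h
  exact (DFunLike.congr_fun h v).symm

theorem mfderiv_symm_apply_mfderiv (f : M ≃ₘ^∞⟮𝓡 n, 𝓡 n⟯ M) (x : M)
    (v : TangentSpace (𝓡 n) x) :
    mfderiv (𝓡 n) (𝓡 n) f.symm (f x) (mfderiv (𝓡 n) (𝓡 n) f x v) = v :=
  mfderiv_symm_iterate f 1 x v

/-- Transports membership along the propositional equality of `f.symm^[m] (f^[m] x)` and `x`, since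
the fibre of `E` depends on the base point. -/
theorem mfderiv_symm_mem_iff (f : M ≃ₘ^∞⟮𝓡 n, 𝓡 n⟯ M) (E : Distribution n M) (m : ℕ) (x : M)
    (v : TangentSpace (𝓡 n) x) :
    mfderiv (𝓡 n) (𝓡 n) f.symm^[m] (f^[m] x) (mfderiv (𝓡 n) (𝓡 n) f^[m] x v) ∈
      E (f.symm^[m] (f^[m] x)) ↔ v ∈ E x := by
  have h : ∀ y, y = x → ∀ w : Euc n, w = v →
      ((show TangentSpace (𝓡 n) y from w) ∈ E y ↔ v ∈ E x) := by
    rintro y rfl w rfl; rfl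
  exact h _ (Function.LeftInverse.iterate f.symm_apply_apply m x) _ (mfderiv_symm_iterate f m x v)

theorem map_mfderiv_symm {f : M ≃ₘ^∞⟮𝓡 n, 𝓡 n⟯ M} {E : Distribution n M}
    (h : ∀ x, (E x).map (mfderiv (𝓡 n) (𝓡 n) f x).toLinearMap = E (f x)) (x : M) :
    (E x).map (mfderiv (𝓡 n) (𝓡 n) f.symm x).toLinearMap = E (f.symm x) := by
  obtain ⟨x, rfl⟩ : ∃ y, f y = x := f.surjective x
  ext u
  obtain ⟨v, rfl⟩ : ∃ v : TangentSpace (𝓡 n) x,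
      mfderiv (𝓡 n) (𝓡 n) f.symm (f x) (mfderiv (𝓡 n) (𝓡 n) f x v) = u :=
    ⟨u, mfderiv_symm_apply_mfderiv f x u⟩
  refine Iff.trans ?_ (mfderiv_symm_mem_iff f E 1 x v).symm
  rw [← h x]
  constructor
  · rintro ⟨_, ⟨w, hw, rfl⟩, hwu⟩
    have h1 := mfderiv_symm_apply_mfderiv f x w
    have h2 := mfderiv_symm_apply_mfderiv f x v
    have h3 : w = v := h1.symm.trans (hwu.trans h2)
    rwa [← h3]
  · intro hv
    exact ⟨_, ⟨v, hv, rfl⟩, rfl⟩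

theorem map_mfderiv_iterate {f : M ≃ₘ^∞⟮𝓡 n, 𝓡 n⟯ M} {E : Distribution n M}
    (h : ∀ x, (E x).map (mfderiv (𝓡 n) (𝓡 n) f x).toLinearMap = E (f x)) (m : ℕ) (x : M) :
    (E x).map (mfderiv (𝓡 n) (𝓡 n) f^[m] x).toLinearMap = E (f^[m] x) := by
  induction m with
  | zero =>
    have e : mfderiv (𝓡 n) (𝓡 n) f^[0] x = ContinuousLinearMap.id ℝ _ := mfderiv_id
    rw [e]
    exact Submodule.map_id _
  | succ m ih =>
    rw [Function.iterate_succ', mfderiv_iterate_succ]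
    exact (Submodule.map_comp _ _ _).trans ((congrArg _ ih).trans (h _))

theorem mpullback_mpullback_symm (f : M ≃ₘ^∞⟮𝓡 n, 𝓡 n⟯ M)
    (σ : Π x : M, TangentSpace (𝓡 n) x) :
    VectorField.mpullback (𝓡 n) (𝓡 n) f (VectorField.mpullback (𝓡 n) (𝓡 n) f.symm σ) = σ := by
  ext1 x
  rw [VectorField.mpullback_apply, VectorField.mpullback_apply]
  have h1 := (isInvertible_mfderiv_diffeo f x).self_apply_inverse
    ((mfderiv (𝓡 n) (𝓡 n) f.symm (f x)).inverse (σ (f.symm (f x))))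
  have h2 := (isInvertible_mfderiv_diffeo f.symm (f x)).self_apply_inverse (σ (f.symm (f x)))
  have h3 := mfderiv_symm_apply_mfderiv f x ((mfderiv (𝓡 n) (𝓡 n) f x).inverse
    ((mfderiv (𝓡 n) (𝓡 n) f.symm (f x)).inverse (σ (f.symm (f x)))))
  have h4 : ∀ y, y = x → (σ y : Euc n) = σ x := by rintro y rfl; rfl
  refine h3.symm.trans ((congrArg _ h1).trans (h2.trans (h4 _ (f.symm_apply_apply x))))

variable [IsManifold (𝓡 n) ∞ M]

/-- The hypothesis on `f` is applied to the pullback of `σ` by the inverse, whose pullback by `f` is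
`σ` again. -/
theorem IsAffineDiffeo.symm {D : Connection n M} {f : M ≃ₘ^∞⟮𝓡 n, 𝓡 n⟯ M}
    (hf : IsAffineDiffeo D f) : IsAffineDiffeo D f.symm := by
  intro σ hσ x v
  obtain ⟨x, rfl⟩ : ∃ y, f y = x := f.surjective x
  obtain ⟨w, rfl⟩ := (mfderiv_diffeo_bijective f x).2 v
  have hτ : IsSmoothField (VectorField.mpullback (𝓡 n) (𝓡 n) f.symm σ) :=
    ContMDiff.mpullback_vectorField (n := ∞) hσ f.symm.contMDiff
      (fun x ↦ isInvertible_mfderiv_diffeo f.symm x) (by simp)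
  have h := hf _ hτ x w
  rw [mpullback_mpullback_symm] at h
  rw [← h]
  have h1 : ∀ y, y = x → ∀ u : Euc n, u = w →
      (D σ y (show TangentSpace (𝓡 n) y from u) : Euc n) = D σ x w := by
    rintro y rfl u rfl; rfl
  exact (mfderiv_symm_apply_mfderiv f x _).trans
    (h1 _ (f.symm_apply_apply x) _ (mfderiv_symm_apply_mfderiv f x w)).symm

theorem gnorm_symm_iterate
    (g : Bundle.ContMDiffRiemannianMetric (𝓡 n) ∞ (Euc n) (TangentSpace (𝓡 n) : M → Type _))
    (f : M ≃ₘ^∞⟮𝓡 n, 𝓡 n⟯ M) (m : ℕ) (x : M) (v : TangentSpace (𝓡 n) x) :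
    gnorm g (mfderiv (𝓡 n) (𝓡 n) f.symm^[m] (f^[m] x) (mfderiv (𝓡 n) (𝓡 n) f^[m] x v)) =
      gnorm g v := by
  have h : ∀ y, y = x → ∀ w : Euc n, w = v →
      gnorm g (show TangentSpace (𝓡 n) y from w) = gnorm g v := by
    rintro y rfl w rfl; rfl
  exact h _ (Function.LeftInverse.iterate f.symm_apply_apply m x) _ (mfderiv_symm_iterate f m x v)

/-- The inverse of an Anosov diffeomorphism is Anosov, with the distributions exchanged. -/
theorem IsAnosov.symm {f : M ≃ₘ^∞⟮𝓡 n, 𝓡 n⟯ M} {Es Eu : Distribution n M}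
    (h : IsAnosov f Es Eu) : IsAnosov f.symm Eu Es := by
  obtain ⟨g, c, c', lam, hc, hc', hlam, hlam1, hs, hu⟩ := h.hyperbolic
  -- With vectors written as images under `df^m`, expansion of `Eu` by `f^m` becomes contraction by
  -- the inverse with constant `c'⁻¹`, and contraction of `Es` becomes expansion with `c⁻¹`.
  refine ⟨h.bundle_u, h.bundle_s, fun x ↦ (h.splitting x).symm, map_mfderiv_symm h.invariant_u,
    map_mfderiv_symm h.invariant_s, g, c'⁻¹, c⁻¹, lam, by positivity, by positivity, hlam, hlam1,
    fun m hm x v hv ↦ ?_, fun m hm x v hv ↦ ?_⟩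
  · obtain ⟨x, rfl⟩ : ∃ y, f^[m] y = x := (f.surjective.iterate m) x
    rw [← map_mfderiv_iterate h.invariant_u m x] at hv
    obtain ⟨w, hw, rfl⟩ := hv
    refine (gnorm_symm_iterate g f m x w).trans_le ?_
    have := hu m hm x w hw
    calc gnorm g w = c'⁻¹ * lam ^ m * (c' * (lam ^ m)⁻¹ * gnorm g w) := by
          have := pow_pos hlam m
          field_simp
      _ ≤ _ := by gcongr; exact this
  · obtain ⟨x, rfl⟩ : ∃ y, f^[m] y = x := (f.surjective.iterate m) x
    rw [← map_mfderiv_iterate h.invariant_s m x] at hv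
    obtain ⟨w, hw, rfl⟩ := hv
    refine le_of_le_of_eq ?_ (gnorm_symm_iterate g f m x w).symm
    have := hs m hm x w hw
    calc _ ≤ c⁻¹ * (lam ^ m)⁻¹ * (c * lam ^ m * gnorm g w) := by gcongr; exact this
      _ = gnorm g w := by
          have := pow_pos hlam m
          field_simp

end Inverse

/-! ### Affine integrability of the stable distribution -/

section Integrability

variable {n : ℕ} {M : Type*} [TopologicalSpace M] [ChartedSpace (Euc n) M]
  [IsManifold (𝓡 n) ∞ M]

/-- The stable distribution consists of the vectors whose forward iterates tend to zero. -/
theorem mem_of_tendsto_gnorm {f : M ≃ₘ^∞⟮𝓡 n, 𝓡 n⟯ M} {Es Eu : Distribution n M}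
    {g : Bundle.ContMDiffRiemannianMetric (𝓡 n) ∞ (Euc n) (TangentSpace (𝓡 n) : M → Type _)}
    {c c' lam : ℝ} (hc' : 0 < c') (hlam : 0 < lam) (hlam1 : lam < 1)
    (hsplit : ∀ x, IsCompl (Es x) (Eu x))
    (hs : ∀ (m : ℕ), 1 ≤ m → ∀ (x : M), ∀ v ∈ Es x,
      gnorm g (mfderiv (𝓡 n) (𝓡 n) (⇑f)^[m] x v) ≤ c * lam ^ m * gnorm g v)
    (hu : ∀ (m : ℕ), 1 ≤ m → ∀ (x : M), ∀ w ∈ Eu x,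
      c' * (lam ^ m)⁻¹ * gnorm g w ≤ gnorm g (mfderiv (𝓡 n) (𝓡 n) (⇑f)^[m] x w))
    {x : M} {v : TangentSpace (𝓡 n) x}
    (hv : Tendsto (fun m : ℕ ↦ gnorm g (mfderiv (𝓡 n) (𝓡 n) (⇑f)^[m] x v)) atTop (𝓝 0)) :
    v ∈ Es x := by
  obtain ⟨s, hss, u, huu, rfl⟩ :=
    Submodule.mem_sup.1 (show v ∈ Es x ⊔ Eu x by rw [(hsplit x).sup_eq_top]; trivial)
  have hpow : Tendsto (fun m : ℕ ↦ c * lam ^ m * gnorm g s) atTop (𝓝 0) := by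
    simpa using ((tendsto_pow_atTop_nhds_zero_of_lt_one hlam.le hlam1).const_mul c).mul_const
      (gnorm g s)
  -- The unstable part is the vector minus its stable part, and the iterates of both tend to zero,
  -- while the norm of the iterates of `u` is at least `c' * gnorm g u`.
  have hle : ∀ᶠ m : ℕ in atTop, c' * gnorm g u ≤
      2 * (gnorm g (mfderiv (𝓡 n) (𝓡 n) (⇑f)^[m] x (s + u)) + c * lam ^ m * gnorm g s) := by
    filter_upwards [eventually_ge_atTop 1] with m hm
    have h1 := gnorm_sub_le g (mfderiv (𝓡 n) (𝓡 n) (⇑f)^[m] x (s + u))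
      (mfderiv (𝓡 n) (𝓡 n) (⇑f)^[m] x s)
    rw [← map_sub, add_sub_cancel_left] at h1
    have h2 : 1 ≤ (lam ^ m)⁻¹ := (one_le_inv₀ (pow_pos hlam m)).2 (pow_le_one₀ hlam.le hlam1.le)
    calc c' * gnorm g u = c' * 1 * gnorm g u := by ring
      _ ≤ c' * (lam ^ m)⁻¹ * gnorm g u := by gcongr; exact gnorm_nonneg g u
      _ ≤ _ := hu m hm x u huu
      _ ≤ _ := h1
      _ ≤ _ := by gcongr; exact hs m hm x s hss
  have h0 : c' * gnorm g u ≤ 0 :=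
    ge_of_tendsto (by simpa using (hv.add hpow).const_mul 2) hle
  have hu0 : u = 0 := by
    by_contra hne
    have := mul_pos hc' (gnorm_pos g hne)
    linarith
  rwa [hu0, add_zero]

theorem IsAnosov.isAffinelyIntegrable [T2Space M] [CompactSpace M] {D : Connection n M}
    (hD : IsAffineStructure D) {f : M ≃ₘ^∞⟮𝓡 n, 𝓡 n⟯ M} (hf : IsAffineDiffeo D f)
    {Es Eu : Distribution n M} (hA : IsAnosov f Es Eu) : IsAffinelyIntegrable D Es := by
  obtain ⟨g, c, c', lam, hc, hc', hlam, hlam1, hs, hu⟩ := hA.hyperbolic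
  -- The hyperbolic estimate starts at `m = 1`; the maximum with 1 covers `m = 0`.
  refine isAffinelyIntegrable_of_contracted hD hf hA.bundle_s g (c := max c 1) (by positivity)
    hlam hlam1 (fun m x v hv ↦ ?_)
    fun x v hv ↦ mem_of_tendsto_gnorm hc' hlam hlam1 hA.splitting hs hu hv
  rcases Nat.eq_zero_or_pos m with rfl | hm
  · have e : mfderiv (𝓡 n) (𝓡 n) f^[0] x = ContinuousLinearMap.id ℝ _ := mfderiv_id
    rw [e, pow_zero, mul_one]
    exact le_mul_of_one_le_left (gnorm_nonneg g v) (le_max_right _ _)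
  · refine (hs m hm x v hv).trans ?_
    gcongr
    · exact gnorm_nonneg g v
    · exact le_max_left _ _

end Integrability

end AffineAnosov

end

/-! ### Conclusion -/

theorem proposition1p1 {n : ℕ} {M : Type*} [TopologicalSpace M] [T2Space M] [CompactSpace M]
    [ChartedSpace (AffineAnosov.Euc n) M] [IsManifold (𝓡 n) ∞ M]
    (D : AffineAnosov.Connection n M) (hD : AffineAnosov.IsAffineStructure D)
    (f : M ≃ₘ^∞⟮𝓡 n, 𝓡 n⟯ M) (hf : AffineAnosov.IsAffineDiffeo D f)
    (Es Eu : AffineAnosov.Distribution n M) (hA : AffineAnosov.IsAnosov f Es Eu) :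
    (∃ Fs : AffineAnosov.TopFoliation n M, Fs.IsAffineTangentTo D Es) ∧
      (∃ Fu : AffineAnosov.TopFoliation n M, Fu.IsAffineTangentTo D Eu) :=
  ⟨⟨_, AffineAnosov.isAffineTangentTo_sliceFoliation (hA.isAffinelyIntegrable hD hf) hA.bundle_s⟩,
    ⟨_, AffineAnosov.isAffineTangentTo_sliceFoliation (hA.symm.isAffinelyIntegrable hD hf.symm)
      hA.bundle_u⟩⟩
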